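/- **Conventions.** Let $P$ be an ergodic reversible Markov chain on a finite graph $G=(V,E)$ (irreducible, aperiodic, moving along edges or staying put) with stationary distribution $\pi$, and put $|\pi\rangle=\sum_x\sqrt{\pi_x}\,|x\rangle$. For $M\subseteq V$ let $P'$ be $P$ with the outgoing transitions of the vertices of $M$ replaced by self-loops, let $D(P)=\sqrt{P\circ P^{\mathsf T}}$ entrywise, and let $$\mathrm{HT}(M)=\sum_k\frac{|\langle v'_k|\bar\pi\rangle|^2}{1-\lambda'_k},\qquad |\bar\pi\rangle=\frac1{\sqrt{1-\pi_M}}\sum_{x\notin M}\sqrt{\pi_x}\,|x\rangle,$$ the sum running over an orthonormal eigenbasis $v'_k$ of $D(P')$ with the eigenvalue $1$ left out. Put $\mathrm{HT}=\max_{x}\mathrm{HT}(\{x\})$. If $P$ has a negative eigenvalue, the algorithm walks on $(I+P)/2$ instead of $P$ (in the definition of $\mathrm{HT}$, $P$ is kept); write $\hat P$ for the chain walked on, and $\hat P(s)=(1-s)\hat P+s\hat P'$ with marked set $\{g\}$. Fix a unit vector $|\bar0\rangle$ in the span of the $|x\rangle$. The walk operator of a chain $Q$ is $W(Q)=A^\dagger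 S A R_{\bar 0}$, where $A$ is a unitary with $A|x\rangle|\bar0\rangle=|x\rangle\sum_y\sqrt{Q_{xy}}\,|y\rangle$, $S$ swaps $|x\rangle|y\rangle$ if $xy\in E$ and fixes it otherwise, and $R_{\bar0}=I\otimes(2|\bar0\rangle\langle\bar0|-I)$. With $\delta(Q)$ the eigenvalue gap of $Q$, $t=\lceil\frac{2}{\delta(Q)}\ln\frac4\varepsilon\rceil$ and $p_l$ the coefficients in $x^t=\sum_l p_lT_l(x)$ ($T_l$ the Chebyshev polynomials), the fast-forwarding circuit is $W_\tau=V_q^\dagger\big(\sum_{l<2^\tau}W^l\otimes|l\rangle\langle l|\big)V_q$, where $V_q$ is a unitary on $\tau$ qubits with $V_q|0^\tau\rangle=\sum_{l<2^\tau}\sqrt{p_l/(1-\sum_{x=2^\tau}^tp_x)}\,|l\rangle$, and qubit $i$ of the control register controls $2^i$ calls to $W$. **Algorithm.** Let $g\in V$ with $\pi_g\le\frac12$ known, $s=1-\frac{\pi_g}{1-\pi_g}$, $\tau=\lceil\log_2\Gamma\rceil$. On five registers, where $\mathsf R_1\mathsf R_2$ have basis $V\times V$, $\mathsf R_3$ has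 $\tau$ qubits and $\mathsf R_4,\mathsf R_5$ are single qubits, apply to $|g\rangle|\bar0\rangle|0^\tau\rangle|0\rangle|0\rangle$ the unitary $$U_{main}=ccX_{2,4}\,X_4\,(W(s)_\tau^\dagger\otimes I)\,ccX_{234,5}\,(W(s)_\tau\otimes I)\,X_4\,ccX_{2,4},\qquad W(s)=W(\hat P(s)),$$ where $ccX_{a,b}$ flips the qubit $\mathsf R_b$ if the registers $a$ are in their zero states ($|\bar 0\rangle$ for $\mathsf R_2$). The *amplified algorithm* applies $U_{main}$ and then, for each pair $(\alpha,\beta)$ of a given list of phases, the approximate phase $e^{i\alpha}$ on $|\pi\rangle|\bar0\rangle$ (that is $ccX_{2,4'}(W_\tau^\dagger\otimes I)\,cc\mathrm{Ph}(\alpha)_{23',4'}(W_\tau\otimes I)\,ccX_{2,4'}$ with $W=W(\hat P)$ and $\tau+1$ fresh ancilla qubits $\mathsf R_{3'}\mathsf R_{4'}$, where $\mathrm{Ph}(\alpha)=\mathrm{diag}(1,e^{i\alpha})$; for $\alpha=\pi$ it is an approximate reflection), then $U_{main}^\dagger$, then the phase $e^{i\beta}$ on the start state $|g\rangle|\bar0\rangle|0^\tau\rangle|0\rangle|0\rangle$,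 and then $U_{main}$. **Theorem.** There are a universal constant $b_0>0$ and a universal finite list of phases such that for every $B$ there are constants $c,C>0$ with the following property. For every ergodic reversible chain $P$ as above, every $g$ with $\pi_g\le\frac12$, every unit vector $|\bar 0\rangle$, every $0<\varepsilon<\frac12$ and every $\Gamma$ with $$b_0\ln(1/\varepsilon)\sqrt{\mathrm{HT}}\le\Gamma\le B\ln(1/\varepsilon)\sqrt{\mathrm{HT}},$$ unitaries $A$ and $V_q$ as required exist (for $\hat P(s)$ and for $\hat P$), and for every choice of them: 1. The output of the algorithm is found in $|\pi\rangle$ on $\mathsf R_1$ with probability $p_{succ}\ge(\frac12-\varepsilon)^2$. Moreover, the probability $p$ of finding both $|\pi\rangle$ on $\mathsf R_1$ and $|1\rangle$ on $\mathsf R_5$ satisfies $\big|\sqrt{p}-\frac{\sqrt{\pi_g}+\sqrt{1-\pi_g}}2\big|\le\varepsilon$ (so $p$ is about $1/4$ for small $\pi_g$). 2. The number $N$ of calls to the controlled walk operator or its inverse satisfies $c\ln(1/\varepsilon)\sqrt{\mathrm{HT}}\le N\le C\ln(1/\varepsilon)\sqrt{\mathrm{HT}}$, and the number $a$ of ancilla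 qubits satisfies $cL\le a\le CL$ with $L=1+\log_2\sqrt{\mathrm{HT}}+\log_2\log_2(1/\varepsilon)$. 3. The amplified algorithm, with the universal list of phases, outputs a state that is found in $|\pi\rangle$ on $\mathsf R_1$ with probability at least $1-\varepsilon^2$, which exceeds $1-\varepsilon$ (its state on $\mathsf R_1$ is within trace distance $\varepsilon$ of $|\pi\rangle$), and the bounds of item 2 hold for its numbers of calls and of ancilla qubits too. -/

import Mathlib

open scoped Matrix Kronecker

noncomputable section

namespace QSampling

/-! ### Markov chains -/

section Chains

variable {V : Type*} [Fintype V] [DecidableEq V]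

/-- `P` is (the transition matrix of) an ergodic reversible Markov chain on the graph `G`, with
stationary distribution `π`. -/
structure IsErgodicReversible (G : SimpleGraph V) (P : Matrix V V ℝ) (π : V → ℝ) : Prop where
  nonneg : ∀ x y, 0 ≤ P x y
  row_sum : ∀ x, ∑ y, P x y = 1
  /-- transitions move along edges (or stay put) -/
  on_graph : ∀ x y, P x y ≠ 0 → x = y ∨ G.Adj x y
  irreducible : ∀ x y, ∃ k : ℕ, 0 < (P ^ k) x y
  /-- the lengths of the directed loops have greatest common divisor `1` -/
  aperiodic : ∀ d : ℕ, (∀ k : ℕ, 0 < k → ∀ x, 0 < (P ^ k) x x → d ∣ k) → d = 1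
  dist_nonneg : ∀ x, 0 ≤ π x
  dist_sum : ∑ x, π x = 1
  stationary : π ᵥ* P = π
  reversible : ∀ x y, π x * P x y = π y * P y x

/-- The lazy chain `(I + P) / 2`. -/
def lazyChain (P : Matrix V V ℝ) : Matrix V V ℝ := (1 / 2 : ℝ) • (1 + P)

open Classical in
/-- The chain that is walked on: `P` itself if its eigenvalues all lie in `[0, 1]`, and the lazy
chain otherwise. -/
def walkChain (P : Matrix V V ℝ) : Matrix V V ℝ :=
  if ∀ μ ∈ spectrum ℝ P, 0 ≤ μ then P else lazyChain P

/-- `P'`: outgoing transitions of the marked vertices are replaced by self-loops. -/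
def absorbing (P : Matrix V V ℝ) (M : Finset V) : Matrix V V ℝ :=
  fun x y => if x ∈ M then (if x = y then 1 else 0) else P x y

/-- The interpolated chain `P(s) = (1 - s) P + s P'`. -/
def interpolated (P : Matrix V V ℝ) (M : Finset V) (s : ℝ) : Matrix V V ℝ :=
  (1 - s) • P + s • absorbing P M

/-- The discriminant matrix `D(P) = √(P ∘ Pᵀ)` (entrywise). -/
def discriminant (P : Matrix V V ℝ) : Matrix V V ℝ :=
  fun x y => Real.sqrt (P x y * P y x)

theorem discriminant_isHermitian {V : Type*} (P : Matrix V V ℝ) :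
    (discriminant P).IsHermitian := by
  ext x y
  simp [discriminant, mul_comm]

/-- The eigenvalue gap `1 - λ₁`: the least value of `1 - μ` over the eigenvalues `μ ≠ 1`. -/
def gap (P : Matrix V V ℝ) : ℝ :=
  sInf ((fun μ : ℝ => 1 - μ) '' (spectrum ℝ P \ {1}))

/-- The vector `|π̄⟩ = (1 - π_M)^{-1/2} ∑_{x ∉ M} √π_x |x⟩`. -/
def unmarkedState (π : V → ℝ) (M : Finset V) : V → ℝ :=
  fun x => if x ∈ M then 0 else Real.sqrt (π x) / Real.sqrt (1 - ∑ y ∈ M, π y)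

/-- The hitting time `HT(M) = ∑_k |⟨v'_k | π̄⟩|² / (1 - λ'_k)` of the marked set `M`, where `v'_k`
runs over an orthonormal eigenbasis of `D(P')` and the eigenvalue `1` is left out. -/
def hittingTime (P : Matrix V V ℝ) (π : V → ℝ) (M : Finset V) : ℝ :=
  ∑ k, if (discriminant_isHermitian (absorbing P M)).eigenvalues k = 1 then 0 else
    (∑ x, (discriminant_isHermitian (absorbing P M)).eigenvectorBasis k x *
        unmarkedState π M x) ^ 2 /
      (1 - (discriminant_isHermitian (absorbing P M)).eigenvalues k)

/-- `HT = max_x HT({x})`. -/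
def maxHittingTime (P : Matrix V V ℝ) (π : V → ℝ) : ℝ :=
  ⨆ x : V, hittingTime P π {x}

end Chains

/-! ### Walk operators -/

section Walk

variable {V : Type*} [Fintype V] [DecidableEq V]

/-- `|ψ⟩|φ⟩` on the registers `R₁R₂`. -/
def tensor (ψ φ : V → ℂ) : V × V → ℂ := fun p => ψ p.1 * φ p.2

/-- `z` is a unit vector (it plays the role of `|0̄⟩`). -/
def IsUnitState (z : V → ℂ) : Prop := ∑ x, ‖z x‖ ^ 2 = 1

/-- `I ⊗ |0̄⟩⟨0̄|` on `R₁R₂`. -/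
def zeroProj (z : V → ℂ) : Matrix (V × V) (V × V) ℂ :=
  (1 : Matrix V V ℂ) ⊗ₖ Matrix.vecMulVec z (star z)

/-- `R_{0̄} = I ⊗ (2|0̄⟩⟨0̄| - I)`. -/
def zeroReflection (z : V → ℂ) : Matrix (V × V) (V × V) ℂ :=
  (2 : ℂ) • zeroProj z - 1

open Classical in
/-- The shift: `|x⟩|y⟩ ↦ |y⟩|x⟩` if `xy` is an edge, and `|x⟩|y⟩ ↦ |x⟩|y⟩` otherwise. -/
def shift (G : SimpleGraph V) : Matrix (V × V) (V × V) ℂ :=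
  fun p q => if p = (if G.Adj q.1 q.2 then (q.2, q.1) else q) then 1 else 0

/-- `A` is a unitary with `A |x⟩|0̄⟩ = |x⟩ ∑_y √(P_{xy}) |y⟩` for every `x`. -/
def IsStepUnitary (z : V → ℂ) (P : Matrix V V ℝ) (A : Matrix (V × V) (V × V) ℂ) : Prop :=
  A ∈ Matrix.unitaryGroup (V × V) ℂ ∧
    ∀ x, A *ᵥ tensor (Pi.single x 1) z =
      tensor (Pi.single x 1) (fun y => (Real.sqrt (P x y) : ℂ))

/-- The walk operator `W = A† S A R_{0̄}`. -/
def walkOp (G : SimpleGraph V) (z : V → ℂ) (A : Matrix (V × V) (V × V) ℂ) :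
    Matrix (V × V) (V × V) ℂ :=
  Aᴴ * shift G * A * zeroReflection z

end Walk

/-! ### Circuits with counted walk calls

The registers are `R₁R₂` (basis `V × V`) and ancilla qubits labelled by `Q` (basis `Q → Bool`). -/

section Circuits

variable (V : Type*) [Fintype V] [DecidableEq V] (Q : Type*) [Fintype Q] [DecidableEq Q]

/-- Operators on all registers. -/
abbrev Op := Matrix ((V × V) × (Q → Bool)) ((V × V) × (Q → Bool)) ℂ

/-- A gate: a walk-independent operation, or one call to a walk operator (or its inverse)
controlled by an ancilla qubit. -/
inductive Gate
  | free (U : Op V Q)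
  | call (W : Matrix (V × V) (V × V) ℂ) (q : Q)
  | callInv (W : Matrix (V × V) (V × V) ℂ) (q : Q)

/-- A circuit is the list of its gates in the order of execution. -/
abbrev Circuit := List (Gate V Q)

variable {V Q}

/-- The operator `∑_b F(b) ⊗ |b⟩⟨b|`. -/
def blockOp (F : (Q → Bool) → Matrix (V × V) (V × V) ℂ) : Op V Q :=
  fun p q => if p.2 = q.2 then F q.2 p.1 q.1 else 0

/-- The controlled operator that applies `W` to `R₁R₂` if qubit `q` is `|1⟩`. -/
def controlled (W : Matrix (V × V) (V × V) ℂ) (q : Q) : Op V Q :=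
  blockOp fun b => if b q then W else 1

/-- The operator of a gate. -/
def Gate.toOp : Gate V Q → Op V Q
  | .free U => U
  | .call W q => controlled W q
  | .callInv W q => controlled Wᴴ q

/-- The inverse gate. -/
def Gate.inv : Gate V Q → Gate V Q
  | .free U => .free Uᴴ
  | .call W q => .callInv W q
  | .callInv W q => .call W q

/-- The number of walk-operator calls of a gate. -/
def Gate.calls : Gate V Q → ℕ
  | .free _ => 0
  | .call _ _ => 1
  | .callInv _ _ => 1

/-- The operator of a circuit. -/
def circuitOp : Circuit V Q → Op V Q
  | [] => 1
  | a :: c => circuitOp c * a.toOp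

/-- The inverse circuit. -/
def circuitInv (c : Circuit V Q) : Circuit V Q := (c.map Gate.inv).reverse

/-- The number of (controlled) walk-operator calls of a circuit. -/
def circuitCalls (c : Circuit V Q) : ℕ := (c.map Gate.calls).sum

/-- The number of ancilla qubits of a circuit. -/
def ancillaCount (_c : Circuit V Q) : ℕ := Fintype.card Q

/-- Pauli `X` on ancilla qubit `q`. -/
def notOp (q : Q) : Op V Q :=
  (1 : Matrix (V × V) (V × V) ℂ) ⊗ₖ
    (Matrix.of fun b b' => if b = Function.update b' q (!b' q) then 1 else 0)

/-- The phase gate `diag(1, e^{iα})` on ancilla qubit `q`. -/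
def phaseOp (q : Q) (α : ℝ) : Op V Q :=
  (1 : Matrix (V × V) (V × V) ℂ) ⊗ₖ
    (Matrix.diagonal fun b => if b q then Complex.exp (α * Complex.I) else 1)

/-- The projection of the ancilla qubits in `S` onto `|0⋯0⟩`. -/
def allZero (S : Finset Q) : Matrix (Q → Bool) (Q → Bool) ℂ :=
  Matrix.diagonal fun b => if ∀ q ∈ S, b q = false then 1 else 0

/-- The operator `U`, applied if `R₂` is in `|0̄⟩` and all qubits in `S` are `|0⟩`. -/
def zeroControlled (z : V → ℂ) (S : Finset Q) (U : Op V Q) : Op V Q :=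
  (zeroProj z ⊗ₖ allZero S) * U + (1 - zeroProj z ⊗ₖ allZero S)

/-- The operator `U` on the ancilla register whose `i`-th qubit is `r i`. -/
def onRegister {τ : ℕ} (r : Fin τ → Q) (U : Matrix (Fin τ → Bool) (Fin τ → Bool) ℂ) : Op V Q :=
  (1 : Matrix (V × V) (V × V) ℂ) ⊗ₖ
    (Matrix.of fun b b' =>
      if ∀ q, (∀ i, r i ≠ q) → b q = b' q then U (b ∘ r) (b' ∘ r) else 0)

/-- The phase `e^{iα}` on the state `|g⟩|0̄⟩|0⋯0⟩` (zeros on the qubits in `S`); for `α = π` this is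
the reflection `I - 2|g 0̄ 0⋯0⟩⟨g 0̄ 0⋯0|`. -/
def startPhase (z : V → ℂ) (g : V) (S : Finset Q) (α : ℝ) : Op V Q :=
  1 + (Complex.exp (α * Complex.I) - 1) •
    (Matrix.vecMulVec (tensor (Pi.single g 1) z) (star (tensor (Pi.single g 1) z)) ⊗ₖ allZero S)

/-- The start state `|g⟩|0̄⟩|0⋯0⟩`. -/
def startState (z : V → ℂ) (g : V) : (V × V) × (Q → Bool) → ℂ :=
  fun p => tensor (Pi.single g 1) z p.1 * (if ∀ q, p.2 q = false then 1 else 0)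

/-! ### Quantum fast-forwarding -/

/-- The number with binary digits `b`, least significant first. -/
def bitVal {τ : ℕ} (b : Fin τ → Bool) : ℕ := ∑ i, if b i then 2 ^ (i : ℕ) else 0

/-- The coefficients of `x ^ t = ∑_l p_l T_l(x)` in Chebyshev polynomials. -/
def qffProb (t l : ℕ) : ℝ :=
  if l ≤ t ∧ Even (t - l) then
    (if l = 0 then 1 else 2) * (t.choose ((t - l) / 2) : ℝ) / 2 ^ t
  else 0

/-- `V_q` is a unitary with
`V_q |0^τ⟩ = ∑_{l < 2^τ} √(p_l / (1 - ∑_{x = 2^τ}^t p_x)) |l⟩`. -/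
def IsPrepUnitary (τ t : ℕ) (Vq : Matrix (Fin τ → Bool) (Fin τ → Bool) ℂ) : Prop :=
  Vq ∈ Matrix.unitaryGroup (Fin τ → Bool) ℂ ∧
    ∀ b, Vq b (fun _ => false) =
      (Real.sqrt (qffProb t (bitVal b) /
        (1 - ∑ x ∈ Finset.Icc (2 ^ τ) t, qffProb t x)) : ℂ)

/-- The circuit of `W_ctrl = ∑_l W^l ⊗ |l⟩⟨l|`: qubit `i` controls `2^i` calls. -/
def ctrlPowers {τ : ℕ} (r : Fin τ → Q) (W : Matrix (V × V) (V × V) ℂ) : Circuit V Q :=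
  (List.finRange τ).flatMap fun (i : Fin τ) => List.replicate (2 ^ (i : ℕ)) (.call W (r i))

set_option linter.unusedSectionVars false in
theorem blockOp_mul (F F' : (Q → Bool) → Matrix (V × V) (V × V) ℂ) :
    blockOp F * blockOp F' = blockOp fun b => F b * F' b := by
  ext ⟨p, b⟩ ⟨q, b'⟩
  simp only [Matrix.mul_apply, blockOp, Fintype.sum_prod_type]
  by_cases h : b = b'
  · subst h
    simp only [if_true]
    refine Finset.sum_congr rfl fun x _ => Finset.sum_congr rfl fun y _ => ?_
    rw [Finset.sum_eq_single b] <;> simp +contextual [eq_comm]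
  · simp only [h, if_false]
    refine Finset.sum_eq_zero fun x _ => Finset.sum_eq_zero fun y _ =>
      Finset.sum_eq_zero fun d _ => ?_
    by_cases h1 : b = d
    · subst h1; simp [h]
    · simp [h1]

set_option linter.unusedSectionVars false in
theorem blockOp_one : blockOp (fun _ : Q → Bool => (1 : Matrix (V × V) (V × V) ℂ)) = 1 := by
  ext ⟨p, b⟩ ⟨q, b'⟩
  by_cases h : b = b' <;> by_cases h' : p = q <;> simp [blockOp, Matrix.one_apply, h, h']

theorem circuitOp_append (c d : Circuit V Q) : circuitOp (c ++ d) = circuitOp d * circuitOp c := by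
  induction c with
  | nil => simp [circuitOp]
  | cons a c ih => simp [circuitOp, ih, mul_assoc]

theorem circuitOp_replicate (n : ℕ) (W : Matrix (V × V) (V × V) ℂ) (q : Q) :
    circuitOp (List.replicate n (.call W q)) = blockOp fun b => if b q then W ^ n else 1 := by
  induction n with
  | zero => simp [circuitOp, blockOp_one]
  | succ n ih =>
    rw [List.replicate_succ, circuitOp, ih, Gate.toOp, controlled, blockOp_mul]
    congr 1
    funext b
    by_cases h : b q <;> simp [h, pow_succ]

/-- The circuit `ctrlPowers` implements `∑_l W^l ⊗ |l⟩⟨l|`. -/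
theorem circuitOp_ctrlPowers {τ : ℕ} (r : Fin τ → Q) (W : Matrix (V × V) (V × V) ℂ) :
    circuitOp (ctrlPowers r W) = blockOp fun b => W ^ bitVal (b ∘ r) := by
  have key : ∀ l : List (Fin τ),
      circuitOp (l.flatMap fun (i : Fin τ) =>
        List.replicate (2 ^ (i : ℕ)) (Gate.call W (r i) : Gate V Q)) =
      blockOp fun b => W ^ (l.map fun i => if b (r i) then 2 ^ (i : ℕ) else 0).sum := by
    intro l
    induction l with
    | nil => simp [circuitOp, blockOp_one]
    | cons a l ih =>
      rw [List.flatMap_cons, circuitOp_append, ih, circuitOp_replicate, blockOp_mul]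
      congr 1
      funext b
      by_cases h : b (r a) <;> simp [h, pow_add, (Commute.pow_pow_self W _ _).eq]
  simp only [ctrlPowers, key, bitVal, ← List.sum_ofFn, List.ofFn_eq_map, Function.comp_apply]

/-- The circuit of `W_τ = V_q† W_ctrl V_q`, on the control register `r`. -/
def fastForward {τ : ℕ} (r : Fin τ → Q) (W : Matrix (V × V) (V × V) ℂ)
    (Vq : Matrix (Fin τ → Bool) (Fin τ → Bool) ℂ) : Circuit V Q :=
  [.free (onRegister r Vq)] ++ ctrlPowers r W ++ [.free (onRegister r Vqᴴ)]

/-! ### The algorithms -/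

/-- The circuit of
`U_main = ccX_{2,4} X₄ (W_τ† ⊗ I) ccX_{234,5} (W_τ ⊗ I) X₄ ccX_{2,4}`. -/
def mainCircuit {τ : ℕ} (r₃ : Fin τ → Q) (r₄ r₅ : Q) (z : V → ℂ)
    (W : Matrix (V × V) (V × V) ℂ) (Vq : Matrix (Fin τ → Bool) (Fin τ → Bool) ℂ) :
    Circuit V Q :=
  [.free (zeroControlled z ∅ (notOp r₄)), .free (notOp r₄)] ++
    fastForward r₃ W Vq ++
    [.free (zeroControlled z (insert r₄ (Finset.univ.image r₃)) (notOp r₅))] ++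
    circuitInv (fastForward r₃ W Vq) ++
    [.free (notOp r₄), .free (zeroControlled z ∅ (notOp r₄))]

/-- The circuit of the approximate phase `e^{iα}` on `|π⟩|0̄⟩`; for `α = π` it is the approximate
reflection `R̃_π = ccX_{2,4} (W_τ† ⊗ I) ccZ_{23,4} (W_τ ⊗ I) ccX_{2,4}`. -/
def reflectionCircuit {τ : ℕ} (r₃ : Fin τ → Q) (r₄ : Q) (z : V → ℂ)
    (W : Matrix (V × V) (V × V) ℂ) (Vq : Matrix (Fin τ → Bool) (Fin τ → Bool) ℂ) (α : ℝ) :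
    Circuit V Q :=
  [.free (zeroControlled z ∅ (notOp r₄))] ++
    fastForward r₃ W Vq ++
    [.free (zeroControlled z (Finset.univ.image r₃) (phaseOp r₄ α))] ++
    circuitInv (fastForward r₃ W Vq) ++
    [.free (zeroControlled z ∅ (notOp r₄))]

/-- Amplitude amplification: apply `U`, and then for each pair `(α, β)` of phases apply the
(approximate) phase `α` on the target, `U†`, the phase `β` on the start state, and `U`. -/
def amplify (U : Circuit V Q) (target : ℝ → Circuit V Q) (start : ℝ → Op V Q)
    (phases : List (ℝ × ℝ)) : Circuit V Q :=
  U ++ phases.flatMap fun p => target p.1 ++ circuitInv U ++ [.free (start p.2)] ++ U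

/-- The probability of finding `|π⟩ = ∑_x √π_x |x⟩` in `R₁`, that is `‖(|π⟩⟨π| ⊗ I) ψ‖²`. -/
def successProb (π : V → ℝ) (ψ : (V × V) × (Q → Bool) → ℂ) : ℝ :=
  ∑ y, ∑ b, ‖∑ x, (Real.sqrt (π x) : ℂ) * ψ ((x, y), b)‖ ^ 2

/-- The probability of finding `|π⟩` in `R₁` and `|1⟩` in the ancilla qubit `q`. -/
def flaggedProb (π : V → ℝ) (q : Q) (ψ : (V × V) × (Q → Bool) → ℂ) : ℝ :=
  ∑ y, ∑ b, if b q then ‖∑ x, (Real.sqrt (π x) : ℂ) * ψ ((x, y), b)‖ ^ 2 else 0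

end Circuits

section Algorithm

variable {V : Type*} [Fintype V] [DecidableEq V]

/-- The ancilla qubits `R₃R₄R₅` of the preparation algorithm. -/
abbrev MainQubits (τ : ℕ) := Fin τ ⊕ Fin 2

/-- `R₃R₄R₅` together with the `τ + 1` ancilla qubits of the reflection on `|π⟩`. -/
abbrev AmpQubits (τ : ℕ) := MainQubits τ ⊕ (Fin τ ⊕ Fin 1)

/-- `s = 1 - π_g / (1 - π_g)`. -/
def interpParam (π : V → ℝ) (g : V) : ℝ := 1 - π g / (1 - π g)

/-- The interpolated chain `P(s)` with marked set `{g}` and `s = 1 - π_g / (1 - π_g)`. -/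
def chosenChain (P : Matrix V V ℝ) (π : V → ℝ) (g : V) : Matrix V V ℝ :=
  interpolated (walkChain P) {g} (interpParam π g)

/-- The number of fast-forwarded steps, `t = ⌈(2 / δ) log (4 / ε)⌉`. -/
def ffSteps (P : Matrix V V ℝ) (ε : ℝ) : ℕ := ⌈2 / gap P * Real.log (4 / ε)⌉₊

/-- `τ = ⌈log₂ Γ⌉`. -/
def tau (Γ : ℝ) : ℕ := ⌈Real.logb 2 Γ⌉₊

/-- Unitaries that implement the data of the algorithm: the step unitaries of `P(s)` and of the
unmarked chain, and the unitaries `V_q` for fast-forwarding them. They are prescribed only on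
`|x⟩|0̄⟩` and on `|0^τ⟩`; every choice is allowed. -/
structure Realization (z : V → ℂ) (P : Matrix V V ℝ) (π : V → ℝ) (g : V) (ε : ℝ) (τ : ℕ) where
  stepS : Matrix (V × V) (V × V) ℂ
  stepS_spec : IsStepUnitary z (chosenChain P π g) stepS
  step : Matrix (V × V) (V × V) ℂ
  step_spec : IsStepUnitary z (walkChain P) step
  prepS : Matrix (Fin τ → Bool) (Fin τ → Bool) ℂ
  prepS_spec : IsPrepUnitary τ (ffSteps (chosenChain P π g) ε) prepS
  prep : Matrix (Fin τ → Bool) (Fin τ → Bool) ℂ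
  prep_spec : IsPrepUnitary τ (ffSteps (walkChain P) ε) prep

variable {z : V → ℂ} {P : Matrix V V ℝ} {π : V → ℝ} {g : V} {ε : ℝ} {τ : ℕ}

/-- The preparation algorithm: the circuit `U_main` for the walk operator `W(s)`. -/
def prepAlgorithm (G : SimpleGraph V) (A : Realization z P π g ε τ) :
    Circuit V (MainQubits τ) :=
  mainCircuit Sum.inl (Sum.inr 0) (Sum.inr 1) z (walkOp G z A.stepS) A.prepS

/-- The preparation algorithm followed by amplitude amplification with the given phases. -/
def ampAlgorithm (G : SimpleGraph V) (A : Realization z P π g ε τ) (phases : List (ℝ × ℝ)) :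
    Circuit V (AmpQubits τ) :=
  amplify
    (mainCircuit (fun i => Sum.inl (Sum.inl i)) (Sum.inl (Sum.inr 0)) (Sum.inl (Sum.inr 1)) z
      (walkOp G z A.stepS) A.prepS)
    (reflectionCircuit (fun i => Sum.inr (Sum.inl i)) (Sum.inr (Sum.inr 0)) z
      (walkOp G z A.step) A.prep)
    (startPhase z g (Finset.univ.image Sum.inl))
    phases

end Algorithm

end QSampling

end

/-!
The theorem rests on three facts.

*The gap is controlled by the hitting time.* If a function `f` vanishes at `y`, Cauchy–Schwarz in an
eigenbasis of `D(P')` for the marked set `{y}` bounds `⟨f, √π⟩ ^ 2` by `(1 - π y) * HT({y})` times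
the Dirichlet energy of `f`. Applied to `v - (v y / √(π y)) √π` and averaged over `y` with weights
`π y`, this gives the Poincaré inequality `IsErgodicReversible.poincare`, so that `1 / gap ≤ HT`.
Laziness costs a factor two. The energy of the interpolated chain at `v` is that of the walked
chain at `v` with the coordinate `g` damped; bounding this coordinate by the hitting time of `g`
and the rest by the Poincaré inequality gives `1 / gap ≤ 3 HT` for both chains walked on
(`isGapped_walkChain`, `isGapped_chosenChain`). Their discriminants are positive semidefinite. The
stationary vector of the interpolated chain is `u = (|g⟩ + |π̄⟩) / √2` (`mixState`).

*Fast-forwarding is an approximate projection.* Compressed to `|0̄⟩`, the power `W ^ l` of the walk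
operator is the Chebyshev polynomial `T_l` of the discriminant. The coefficients of
`x ^ t = ∑ p_l T_l(x)` are the law of the absolute value of a simple random walk after `t` steps, so
cutting the sum at `2 ^ τ` leaves the tail `2 exp(-4 ^ τ / (2 t))` (`qffTail_le`). For the given `t`
and `τ` the compression of `W_τ` is therefore within `ε / 20` of the projection on the stationary
vector, which it fixes exactly (`IsGapped.isApproxProjector`). Exactness on that vector and the
unitarity of `W_τ` control the adjoint as well, although the part of `W_τ` outside the compression
is arbitrary (`IsApproxProjector.conj_approx`). So `U_main` approximately flips the flag on the
component along `u`, and the other circuit puts a phase on the component along `√π`.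

*One round of amplification is exact.* With `k = u g`, `k ^ 2 = 1 / 2`, and `σ = ⟨u, √π⟩`, the ideal
output of `U_main` is `(|g⟩ - k u)|0⟩ + k u |1⟩`. Its flagged amplitude on `√π` is
`k σ = (√(π g) + √(1 - π g)) / 2`, and the total probability of `√π` is exactly one half, whatever
`π g` is. With success probability one half, a single round with the two phases `π / 2` is exact: it
yields `√π` in the first register with certainty (`amplification_approx`). The errors of the four
approximate circuits in sequence add up to at most `17 ε / 20`.

The numbers of calls are multiples of `2 ^ τ - 1`, where `Γ ≤ 2 ^ τ ≤ 2 Γ`, and the numbers of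
ancilla qubits are affine in `τ`.
-/

set_option linter.unusedSectionVars false

namespace QSampling

/-! ### Euclidean norms of coordinate vectors -/

/-- The Euclidean norm of a vector given by its coordinates. -/
noncomputable def l2 {ι : Type*} [Fintype ι] (ψ : ι → ℂ) : ℝ :=
  ‖(WithLp.toLp 2 ψ : EuclideanSpace ℂ ι)‖

section Norm

variable {ι : Type*} [Fintype ι]

theorem l2_nonneg (ψ : ι → ℂ) : 0 ≤ l2 ψ := norm_nonneg _

theorem l2_sq (ψ : ι → ℂ) : l2 ψ ^ 2 = ∑ i, ‖ψ i‖ ^ 2 := by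
  simp [l2, EuclideanSpace.norm_sq_eq]

theorem l2_add_le (ψ φ : ι → ℂ) : l2 (ψ + φ) ≤ l2 ψ + l2 φ := by
  simp only [l2, WithLp.toLp_add]
  exact norm_add_le _ _

theorem l2_sub_le (ψ φ : ι → ℂ) : l2 (ψ - φ) ≤ l2 ψ + l2 φ := by
  simp only [l2, WithLp.toLp_sub]
  exact norm_sub_le _ _

theorem l2_sub_rev (ψ φ : ι → ℂ) : l2 (ψ - φ) = l2 (φ - ψ) := by
  simp only [l2, WithLp.toLp_sub]
  exact norm_sub_rev _ _

theorem l2_smul (c : ℂ) (ψ : ι → ℂ) : l2 (c • ψ) = ‖c‖ * l2 ψ := by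
  simp only [l2, WithLp.toLp_smul, norm_smul]

theorem abs_l2_sub_le (ψ φ : ι → ℂ) : |l2 ψ - l2 φ| ≤ l2 (ψ - φ) := by
  simp only [l2, WithLp.toLp_sub]
  exact abs_norm_sub_norm_le _ _

theorem l2_eq_zero {ψ : ι → ℂ} (h : l2 ψ = 0) : ψ = 0 := by
  have := norm_eq_zero.mp h
  simpa using congrArg WithLp.ofLp this

theorem l2_sq_eq_dotProduct (ψ : ι → ℂ) : ((l2 ψ ^ 2 : ℝ) : ℂ) = star ψ ⬝ᵥ ψ := by
  rw [l2_sq, dotProduct]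
  push_cast
  refine Finset.sum_congr rfl fun i _ => ?_
  rw [Pi.star_apply, RCLike.star_def, mul_comm, Complex.mul_conj, Complex.normSq_eq_norm_sq]
  push_cast; rfl

theorem star_mulVec_dotProduct_mulVec {κ : Type*} [Fintype κ] (U : Matrix ι κ ℂ) (ψ φ : κ → ℂ) :
    star (U *ᵥ ψ) ⬝ᵥ (U *ᵥ φ) = star ψ ⬝ᵥ ((Uᴴ * U) *ᵥ φ) := by
  rw [Matrix.star_mulVec, ← Matrix.dotProduct_mulVec, Matrix.mulVec_mulVec]

variable [DecidableEq ι]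

theorem unitary_conjTranspose_mul {U : Matrix ι ι ℂ} (hU : U ∈ Matrix.unitaryGroup ι ℂ) :
    Uᴴ * U = 1 := Matrix.mem_unitaryGroup_iff'.mp hU

theorem unitary_mul_conjTranspose {U : Matrix ι ι ℂ} (hU : U ∈ Matrix.unitaryGroup ι ℂ) :
    U * Uᴴ = 1 := Matrix.mem_unitaryGroup_iff.mp hU

theorem conjTranspose_mem_unitary {U : Matrix ι ι ℂ} (hU : U ∈ Matrix.unitaryGroup ι ℂ) :
    Uᴴ ∈ Matrix.unitaryGroup ι ℂ := Unitary.star_mem hU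

theorem l2_unitary {U : Matrix ι ι ℂ} (hU : U ∈ Matrix.unitaryGroup ι ℂ) (ψ : ι → ℂ) :
    l2 (U *ᵥ ψ) = l2 ψ := by
  have h : ((l2 (U *ᵥ ψ) ^ 2 : ℝ) : ℂ) = ((l2 ψ ^ 2 : ℝ) : ℂ) := by
    rw [l2_sq_eq_dotProduct, l2_sq_eq_dotProduct, star_mulVec_dotProduct_mulVec,
      unitary_conjTranspose_mul hU, Matrix.one_mulVec]
  exact (sq_eq_sq₀ (l2_nonneg _) (l2_nonneg _)).mp (by exact_mod_cast h)

/-- A unitary that has a fixed vector as its compression to a projection fixes that vector: no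
norm is left for the complementary component. -/
theorem unitary_fixes_of_compression {U E : Matrix ι ι ℂ} (hU : U ∈ Matrix.unitaryGroup ι ℂ)
    (hE : Eᴴ = E) {x : ι → ℂ} (hx : E *ᵥ x = x) (hUx : E *ᵥ (U *ᵥ x) = x) : U *ᵥ x = x := by
  have h1 : star x ⬝ᵥ (U *ᵥ x) = star x ⬝ᵥ x := by
    conv_lhs => rw [← hx]
    rw [Matrix.star_mulVec, hE, ← Matrix.dotProduct_mulVec, hx, hUx]
  have h2 : star (U *ᵥ x) ⬝ᵥ x = star x ⬝ᵥ x := by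
    rw [Matrix.star_dotProduct, h1, ← Matrix.star_dotProduct]
  have h3 : ((l2 (U *ᵥ x - x) ^ 2 : ℝ) : ℂ) = 0 := by
    rw [l2_sq_eq_dotProduct, star_sub, sub_dotProduct, dotProduct_sub, dotProduct_sub, h1, h2,
      star_mulVec_dotProduct_mulVec, unitary_conjTranspose_mul hU, Matrix.one_mulVec]
    ring
  have h4 : l2 (U *ᵥ x - x) = 0 := by
    have : l2 (U *ᵥ x - x) ^ 2 = 0 := by exact_mod_cast h3
    simpa using this
  exact sub_eq_zero.mp (l2_eq_zero h4)

/-- For a projection `E` and a unitary `U` that commutes with it, "`U` on the range of `E`, and the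
identity on its complement" is unitary. -/
theorem conditional_mem_unitary {U E : Matrix ι ι ℂ} (hU : U ∈ Matrix.unitaryGroup ι ℂ)
    (hE : Eᴴ = E) (hE2 : E * E = E) (hc : E * U = U * E) :
    E * U + (1 - E) ∈ Matrix.unitaryGroup ι ℂ := by
  have h0 : Uᴴ * U = 1 := unitary_conjTranspose_mul hU
  have hc' : E * Uᴴ = Uᴴ * E := by
    have := congrArg Matrix.conjTranspose hc
    simpa [Matrix.conjTranspose_mul, hE] using this.symm
  rw [Matrix.mem_unitaryGroup_iff', Matrix.star_eq_conjTranspose]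
  have e1 : (E * U + (1 - E))ᴴ = E * Uᴴ + (1 - E) := by
    simp [Matrix.conjTranspose_mul, hE, hc']
  have e2 : E * Uᴴ * (E * U) = E := by
    rw [hc', Matrix.mul_assoc, ← Matrix.mul_assoc E, hE2, hc, ← Matrix.mul_assoc, h0,
      Matrix.one_mul]
  have e3 : E * Uᴴ * (1 - E) = 0 := by
    rw [hc', Matrix.mul_sub, Matrix.mul_one, Matrix.mul_assoc, hE2, sub_self]
  have e4 : (1 - E) * (E * U) = 0 := by
    rw [← Matrix.mul_assoc, Matrix.sub_mul, Matrix.one_mul, hE2, sub_self, Matrix.zero_mul]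
  have e5 : (1 - E) * (1 - E) = 1 - E := by
    rw [Matrix.sub_mul, Matrix.one_mul, Matrix.mul_sub, Matrix.mul_one, hE2, sub_self, sub_zero]
  rw [e1, Matrix.add_mul, Matrix.mul_add, Matrix.mul_add, e2, e3, e4, e5]
  abel

end Norm

/-! ### Polynomials of symmetric matrices -/

section Spectral

variable {V : Type*} [Fintype V]

theorem aeval_mulVec_of_eigenvector [DecidableEq V] {D : Matrix V V ℝ} {v : V → ℝ}
    {r : ℝ} (h : D *ᵥ v = r • v)
    (p : Polynomial ℝ) : Polynomial.aeval D p *ᵥ v = p.eval r • v := by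
  induction p using Polynomial.induction_on' with
  | add p q hp hq => simp [Matrix.add_mulVec, hp, hq, add_smul]
  | monomial n a =>
    have hk : ∀ k : ℕ, (D ^ k) *ᵥ v = r ^ k • v := by
      intro k
      induction k with
      | zero => simp
      | succ k ih =>
        rw [pow_succ, ← Matrix.mulVec_mulVec, h, Matrix.mulVec_smul, ih, smul_smul, pow_succ,
          mul_comm]
    rw [Polynomial.aeval_monomial, ← Algebra.smul_def, Matrix.smul_mulVec, hk]
    simp [smul_smul]

/-- A matrix that is diagonal in an orthonormal basis, with all diagonal entries of modulus at most
`e`, has operator norm at most `e`. -/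
theorem sum_sq_mulVec_le_of_eigenbasis (b : OrthonormalBasis V ℝ (EuclideanSpace ℝ V))
    (X : Matrix V V ℝ) (μ : V → ℝ) (hX : ∀ k, X *ᵥ (b k).ofLp = μ k • (b k).ofLp) {e : ℝ}
    (he : ∀ k, |μ k| ≤ e) (f : V → ℝ) : ∑ x, (X *ᵥ f) x ^ 2 ≤ e ^ 2 * ∑ x, f x ^ 2 := by
  set F : EuclideanSpace ℝ V := WithLp.toLp 2 f
  have hF : F = ∑ k, b.repr F k • b k := (b.sum_repr F).symm
  have hf : f = ∑ k, b.repr F k • (b k).ofLp := by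
    have := congrArg WithLp.ofLp hF
    simpa [F, WithLp.ofLp_sum] using this
  have hXf : (WithLp.toLp 2 (X *ᵥ f) : EuclideanSpace ℝ V) = ∑ k, (μ k * b.repr F k) • b k := by
    apply (WithLp.ofLp_injective 2)
    simp only [WithLp.ofLp_sum, WithLp.ofLp_smul]
    conv_lhs => rw [hf]
    rw [Matrix.mulVec_sum]
    refine Finset.sum_congr rfl fun k _ => ?_
    rw [Matrix.mulVec_smul, hX, smul_smul, mul_comm]
  have n1 : ∑ x, (X *ᵥ f) x ^ 2 = ∑ k, (μ k * b.repr F k) ^ 2 := by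
    have h1 := EuclideanSpace.real_norm_sq_eq (WithLp.toLp 2 (X *ᵥ f) : EuclideanSpace ℝ V)
    rw [← b.sum_sq_norm_inner_right, hXf] at h1
    simp only [b.orthonormal.inner_right_fintype] at h1
    rw [← hXf] at h1
    simpa [mul_pow] using h1.symm
  have n2 : ∑ x, f x ^ 2 = ∑ k, (b.repr F k) ^ 2 := by
    have h1 := EuclideanSpace.real_norm_sq_eq F
    rw [← b.sum_sq_norm_inner_right] at h1
    simpa [b.repr_apply_apply, F] using h1.symm
  rw [n1, n2, Finset.mul_sum]
  refine Finset.sum_le_sum fun k _ => ?_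
  rw [mul_pow]
  refine mul_le_mul_of_nonneg_right ?_ (sq_nonneg _)
  rw [← sq_abs]
  exact pow_le_pow_left₀ (abs_nonneg _) (he k) 2

/-- An operator bound for a real matrix extends to complex vectors. -/
theorem l2_map_mulVec_le {X : Matrix V V ℝ} {e : ℝ} (he : 0 ≤ e)
    (h : ∀ f : V → ℝ, ∑ x, (X *ᵥ f) x ^ 2 ≤ e ^ 2 * ∑ x, f x ^ 2) (a : V → ℂ) :
    l2 (X.map (algebraMap ℝ ℂ) *ᵥ a) ≤ e * l2 a := by
  have hn : ∀ w : ℂ, ‖w‖ ^ 2 = w.re ^ 2 + w.im ^ 2 := fun w => by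
    rw [← Complex.normSq_eq_norm_sq, Complex.normSq_apply]; ring
  have hre : ∀ x, ((X.map (algebraMap ℝ ℂ) *ᵥ a) x).re = (X *ᵥ fun y => (a y).re) x := by
    intro x; simp [Matrix.mulVec, dotProduct]
  have him : ∀ x, ((X.map (algebraMap ℝ ℂ) *ᵥ a) x).im = (X *ᵥ fun y => (a y).im) x := by
    intro x; simp [Matrix.mulVec, dotProduct]
  have key : l2 (X.map (algebraMap ℝ ℂ) *ᵥ a) ^ 2 ≤ (e * l2 a) ^ 2 := by
    rw [mul_pow, l2_sq, l2_sq]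
    simp only [hn, hre, him, Finset.sum_add_distrib, mul_add]
    exact add_le_add (h _) (h _)
  exact (sq_le_sq₀ (l2_nonneg _) (mul_nonneg he (l2_nonneg _))).mp key

end Spectral

/-! ### The Chebyshev coefficients of a monomial -/

section Chebyshev

open Polynomial

/-- Folding the binomial distribution on `t - 2 k` to its absolute value gives the coefficients
`qffProb t`. -/
theorem sum_qffProb_mul (t : ℕ) (f : ℕ → ℝ) :
    ∑ l ∈ Finset.range (t + 1), qffProb t l * f l =
      (∑ k ∈ Finset.range (t + 1), (t.choose k : ℝ) * f ((t : ℤ) - 2 * k).natAbs) / 2 ^ t := by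
  have hfib := Finset.sum_fiberwise_of_maps_to (s := Finset.range (t + 1))
    (t := Finset.range (t + 1)) (g := fun k : ℕ => ((t : ℤ) - 2 * k).natAbs)
    (by intro k hk; simp only [Finset.mem_range] at hk ⊢; omega)
    (fun k : ℕ => (t.choose k : ℝ) * f ((t : ℤ) - 2 * k).natAbs)
  rw [← hfib, Finset.sum_div]
  refine Finset.sum_congr rfl fun l hl => ?_
  have hl' : l ≤ t := by simpa [Nat.lt_succ_iff] using hl
  by_cases he : Even (t - l)
  · obtain ⟨m, hm⟩ := he
    have hm2 : (t - l) / 2 = m := by omega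
    by_cases h0 : l = 0
    · subst h0
      have hfil :
          (Finset.range (t + 1)).filter (fun k : ℕ => ((t : ℤ) - 2 * k).natAbs = 0) = {m} := by
        ext k; simp only [Finset.mem_filter, Finset.mem_range, Finset.mem_singleton]; omega
      rw [hfil, Finset.sum_singleton]
      have h1 : ((t : ℤ) - 2 * m).natAbs = 0 := by omega
      have : Even (t - 0) := ⟨m, hm⟩
      rw [h1, qffProb, if_pos ⟨hl', this⟩, hm2, if_pos rfl]; ring
    · have hfil : (Finset.range (t + 1)).filter (fun k : ℕ => ((t : ℤ) - 2 * k).natAbs = l) =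
          {m, t - m} := by
        ext k
        simp only [Finset.mem_filter, Finset.mem_range, Finset.mem_insert, Finset.mem_singleton]
        omega
      have hne : m ≠ t - m := by omega
      rw [hfil, Finset.sum_pair hne]
      have h1 : ((t : ℤ) - 2 * m).natAbs = l := by omega
      have h2 : ((t : ℤ) - 2 * (t - m : ℕ)).natAbs = l := by omega
      rw [h1, h2, qffProb, if_pos ⟨hl', ⟨m, hm⟩⟩, hm2, if_neg h0, Nat.choose_symm (by omega)]
      ring
  · have hfil : (Finset.range (t + 1)).filter (fun k : ℕ => ((t : ℤ) - 2 * k).natAbs = l) = ∅ := by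
      ext k
      simp only [Finset.mem_filter, Finset.mem_range, Finset.notMem_empty, iff_false]
      rintro ⟨hk, h⟩
      apply he
      rcases Nat.lt_or_ge t (2 * k) with h1 | h1
      · exact ⟨t - k, by omega⟩
      · exact ⟨k, by omega⟩
    rw [hfil, qffProb, if_neg (fun h => he h.2)]; simp

theorem qffProb_nonneg (t l : ℕ) : 0 ≤ qffProb t l := by
  unfold qffProb
  split_ifs <;> positivity

theorem qffProb_eq_zero_of_lt {t l : ℕ} (h : t < l) : qffProb t l = 0 := by
  rw [qffProb, if_neg]; omega

theorem sum_qffProb (t : ℕ) : ∑ l ∈ Finset.range (t + 1), qffProb t l = 1 := by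
  have h := sum_qffProb_mul t (fun _ => 1)
  simp only [mul_one] at h
  rw [h, ← Nat.cast_sum, Nat.sum_range_choose]
  simp

theorem pow_eq_sum_choose_mul_T (t : ℕ) (x : ℝ) :
    (2 : ℝ) ^ t * x ^ t =
      ∑ k ∈ Finset.range (t + 1), (t.choose k : ℝ) * (Chebyshev.T ℝ ((t : ℤ) - 2 * k)).eval x := by
  have hrec : ∀ n : ℤ, 2 * x * (Chebyshev.T ℝ n).eval x =
      (Chebyshev.T ℝ (n + 1)).eval x + (Chebyshev.T ℝ (n - 1)).eval x := by
    intro n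
    rw [Chebyshev.T_add_one]; simp
  induction t with
  | zero => simp
  | succ t ih =>
    have hA : ∑ k ∈ Finset.range (t + 1), (t.choose k : ℝ) *
        (Chebyshev.T ℝ ((t : ℤ) - 2 * k + 1)).eval x =
        ∑ k ∈ Finset.range (t + 2), (t.choose k : ℝ) *
        (Chebyshev.T ℝ ((t : ℤ) - 2 * k + 1)).eval x := by
      rw [Finset.sum_range_succ _ (t + 1)]; simp
    calc (2 : ℝ) ^ (t + 1) * x ^ (t + 1) = 2 * x * ((2 : ℝ) ^ t * x ^ t) := by ring
      _ = ∑ k ∈ Finset.range (t + 1), ((t.choose k : ℝ) *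
            (Chebyshev.T ℝ ((t : ℤ) - 2 * k + 1)).eval x + (t.choose k : ℝ) *
            (Chebyshev.T ℝ ((t : ℤ) - 2 * k - 1)).eval x) := by
        rw [ih, Finset.mul_sum]
        refine Finset.sum_congr rfl fun k _ => ?_
        rw [← mul_add, ← hrec]; ring
      _ = _ := by
        rw [Finset.sum_add_distrib, hA, Finset.sum_range_succ', Finset.sum_range_succ' _ (t + 1),
          add_right_comm, ← Finset.sum_add_distrib]
        congr 1
        · refine Finset.sum_congr rfl fun k _ => ?_
          rw [Nat.choose_succ_succ]
          simp only [Nat.cast_add, Nat.cast_one, Nat.succ_eq_add_one]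
          have e1 : (t : ℤ) + 1 - 2 * ((k : ℤ) + 1) = t - 2 * k - 1 := by ring
          have e2 : (t : ℤ) - 2 * ((k : ℤ) + 1) + 1 = t - 2 * k - 1 := by ring
          rw [e1, e2]; ring
        · simp

theorem sum_qffProb_mul_T (t : ℕ) (x : ℝ) :
    ∑ l ∈ Finset.range (t + 1), qffProb t l * (Chebyshev.T ℝ (l : ℤ)).eval x = x ^ t := by
  rw [sum_qffProb_mul t fun l => (Chebyshev.T ℝ (l : ℤ)).eval x]
  simp only [Chebyshev.T_natAbs]
  rw [← pow_eq_sum_choose_mul_T]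
  field_simp

/-- The part of the Chebyshev coefficients of `x ^ t` that the control register cannot hold. -/
noncomputable def qffTail (τ t : ℕ) : ℝ := ∑ x ∈ Finset.Icc (2 ^ τ) t, qffProb t x

theorem qffTail_nonneg (τ t : ℕ) : 0 ≤ qffTail τ t :=
  Finset.sum_nonneg fun _ _ => qffProb_nonneg _ _

/-- Splitting the full Chebyshev sum into the part below `2 ^ τ` and the tail. -/
theorem sum_range_add_tail (τ t : ℕ) (f : ℕ → ℝ) :
    ∑ l ∈ Finset.range (2 ^ τ), qffProb t l * f l + ∑ l ∈ Finset.Icc (2 ^ τ) t, qffProb t l * f l =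
      ∑ l ∈ Finset.range (t + 1), qffProb t l * f l := by
  have hI : Finset.Icc (2 ^ τ) t = Finset.Ico (2 ^ τ) (t + 1) := by
    ext; simp
  rw [hI]
  rcases le_total (2 ^ τ) (t + 1) with h | h
  · exact Finset.sum_range_add_sum_Ico _ h
  · rw [Finset.Ico_eq_empty_of_le h, Finset.sum_empty, add_zero]
    symm
    apply Finset.sum_subset (Finset.range_mono h)
    intro x _ hx
    rw [qffProb_eq_zero_of_lt (by simpa using hx), zero_mul]

theorem sum_range_qffProb (τ t : ℕ) :
    ∑ l ∈ Finset.range (2 ^ τ), qffProb t l = 1 - qffTail τ t := by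
  have h := sum_range_add_tail τ t fun _ => 1
  simp only [mul_one, sum_qffProb] at h
  rw [qffTail]; linarith

theorem qffTail_lt_one {τ : ℕ} (hτ : 1 ≤ τ) (t : ℕ) : qffTail τ t < 1 := by
  have h : 0 < ∑ l ∈ Finset.range (2 ^ τ), qffProb t l := by
    have h2 : 2 ≤ 2 ^ τ := by simpa using Nat.pow_le_pow_right (n := 2) (by norm_num) hτ
    have hp : ∀ l, l ≤ t → Even (t - l) → 0 < qffProb t l := by
      intro l hl he
      have : 0 < t.choose ((t - l) / 2) := Nat.choose_pos (by omega)
      rw [qffProb, if_pos ⟨hl, he⟩]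
      split_ifs <;> positivity
    rcases Nat.even_or_odd t with he | ho
    · refine lt_of_lt_of_le (hp 0 (by omega) (by simpa using he)) ?_
      exact Finset.single_le_sum (f := fun l => qffProb t l) (fun _ _ => qffProb_nonneg _ _)
        (by simp)
    · obtain ⟨m, hm⟩ := ho
      refine lt_of_lt_of_le (hp 1 (by omega) ⟨m, by omega⟩) ?_
      exact Finset.single_le_sum (f := fun l => qffProb t l) (fun _ _ => qffProb_nonneg _ _)
        (by simp; omega)
  rw [sum_range_qffProb] at h; linarith

/-- A Chernoff bound: evaluating `x ^ t = ∑ p_l T_l(x)` at `x = cosh θ`, where `T_l` has the value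
`cosh (l θ)`. -/
theorem qffTail_le (τ t : ℕ) :
    qffTail τ t ≤ 2 * Real.exp (-((2 ^ τ : ℝ) ^ 2 / (2 * t))) := by
  rcases Nat.eq_zero_or_pos t with rfl | ht
  · have : qffTail τ 0 = 0 := by
      simp [qffTail]
    rw [this]; positivity
  have ht' : (0 : ℝ) < t := by exact_mod_cast ht
  set m : ℝ := 2 ^ τ with hm
  -- The exponent `m θ - t θ ^ 2 / 2` is largest at `θ = m / t`.
  set θ : ℝ := m / t with hθ
  have hθ0 : 0 ≤ θ := by positivity
  have h1 : qffTail τ t * Real.cosh (m * θ) ≤ Real.cosh θ ^ t := by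
    rw [← sum_qffProb_mul_T, ← sum_range_add_tail τ, qffTail, Finset.sum_mul]
    refine le_add_of_nonneg_of_le ?_ ?_
    · refine Finset.sum_nonneg fun l _ => mul_nonneg (qffProb_nonneg _ _) ?_
      rw [Chebyshev.T_real_cosh]; positivity
    · refine Finset.sum_le_sum fun l hl => mul_le_mul_of_nonneg_left ?_ (qffProb_nonneg _ _)
      rw [Chebyshev.T_real_cosh, Real.cosh_le_cosh, abs_of_nonneg (by positivity),
        abs_of_nonneg (by positivity)]
      refine mul_le_mul_of_nonneg_right ?_ hθ0
      have := (Finset.mem_Icc.mp hl).1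
      rw [hm]; exact_mod_cast this
  have h2 : Real.cosh θ ^ t ≤ Real.exp (θ ^ 2 / 2) ^ t :=
    pow_le_pow_left₀ (by positivity) (Real.cosh_le_exp_half_sq θ) t
  have h3 : Real.exp (m * θ) / 2 ≤ Real.cosh (m * θ) := by
    rw [Real.cosh_eq]; have := Real.exp_pos (-(m * θ)); linarith
  have h4 : qffTail τ t * (Real.exp (m * θ) / 2) ≤ Real.exp (t * (θ ^ 2 / 2)) := by
    rw [Real.exp_nat_mul]
    exact (mul_le_mul_of_nonneg_left h3 (qffTail_nonneg _ _)).trans (h1.trans h2)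
  have h5 : Real.exp (-(m ^ 2 / (2 * t))) = Real.exp (t * (θ ^ 2 / 2)) / Real.exp (m * θ) := by
    rw [← Real.exp_sub]
    congr 1
    rw [hθ]; field_simp; ring
  rw [h5, mul_div_assoc', le_div_iff₀ (Real.exp_pos _)]
  linarith

theorem abs_eval_T_le_one {x : ℝ} (h : |x| ≤ 1) (n : ℤ) : |(Chebyshev.T ℝ n).eval x| ≤ 1 := by
  rw [← Real.cos_arccos (abs_le.mp h).1 (abs_le.mp h).2, Chebyshev.T_real_cos]
  exact Real.abs_cos_le_one _

/-- The polynomial that fast-forwarding applies to the discriminant matrix: the truncated and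
renormalised Chebyshev expansion of `x ^ t`. -/
noncomputable def ffPoly (τ t : ℕ) : ℝ[X] :=
  ∑ l ∈ Finset.range (2 ^ τ), Polynomial.C (qffProb t l / (1 - qffTail τ t)) * Chebyshev.T ℝ (l : ℤ)

theorem eval_ffPoly (τ t : ℕ) (x : ℝ) : (ffPoly τ t).eval x =
    (∑ l ∈ Finset.range (2 ^ τ), qffProb t l * (Chebyshev.T ℝ (l : ℤ)).eval x) /
      (1 - qffTail τ t) := by
  rw [ffPoly, Polynomial.eval_finsetSum, Finset.sum_div]
  refine Finset.sum_congr rfl fun l _ => ?_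
  simp; ring

theorem eval_one_ffPoly {τ t : ℕ} (h : qffTail τ t < 1) : (ffPoly τ t).eval 1 = 1 := by
  rw [eval_ffPoly]
  simp only [Chebyshev.T_eval_one, mul_one]
  rw [sum_range_qffProb, div_self]; linarith

theorem abs_eval_ffPoly_le {τ t : ℕ} (h : qffTail τ t < 1) {x : ℝ} (hx : |x| ≤ 1) :
    |(ffPoly τ t).eval x| ≤ (|x| ^ t + qffTail τ t) / (1 - qffTail τ t) := by
  have h1 : 0 < 1 - qffTail τ t := by linarith
  rw [eval_ffPoly, abs_div, abs_of_pos h1]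
  refine div_le_div_of_nonneg_right ?_ h1.le
  have h2 := sum_range_add_tail τ t fun l => (Chebyshev.T ℝ (l : ℤ)).eval x
  rw [sum_qffProb_mul_T] at h2
  rw [eq_sub_of_add_eq h2, ← abs_pow]
  refine (abs_sub _ _).trans (add_le_add_right ?_ _)
  refine (Finset.abs_sum_le_sum_abs _ _).trans (Finset.sum_le_sum fun l _ => ?_)
  rw [abs_mul, abs_of_nonneg (qffProb_nonneg _ _)]
  exact mul_le_of_le_one_right (qffProb_nonneg _ _) (abs_eval_T_le_one hx _)

end Chebyshev

/-! ### The Dirichlet form of a reversible chain -/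

section Dirichlet

variable {V : Type*} [Fintype V]

/-- The quadratic form of `1 - D`. -/
noncomputable def energy (D : Matrix V V ℝ) (f : V → ℝ) : ℝ := f ⬝ᵥ f - f ⬝ᵥ (D *ᵥ f)

theorem dotProduct_mulVec_symm {D : Matrix V V ℝ} (hD : D.IsHermitian) (f h : V → ℝ) :
    f ⬝ᵥ (D *ᵥ h) = (D *ᵥ f) ⬝ᵥ h := by
  have : Dᵀ = D := by rw [← Matrix.conjTranspose_eq_transpose_of_trivial]; exact hD
  rw [Matrix.dotProduct_mulVec, ← Matrix.mulVec_transpose, this]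

theorem energy_sub_smul {D : Matrix V V ℝ} (hD : D.IsHermitian) {u : V → ℝ} (hu : D *ᵥ u = u)
    (f : V → ℝ) (c : ℝ) : energy D (f - c • u) = energy D f := by
  have h1 : u ⬝ᵥ (D *ᵥ f) = u ⬝ᵥ f := by rw [dotProduct_mulVec_symm hD, hu]
  simp only [energy, Matrix.mulVec_sub, Matrix.mulVec_smul, hu, sub_dotProduct, dotProduct_sub,
    smul_dotProduct, dotProduct_smul, h1, smul_eq_mul]
  ring

theorem energy_of_eigenvector {D : Matrix V V ℝ} {v : V → ℝ} {r : ℝ} (h : D *ᵥ v = r • v) :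
    energy D v = (1 - r) * (v ⬝ᵥ v) := by
  simp only [energy, h, dotProduct_smul, smul_eq_mul]; ring

theorem energy_of_fixed {D : Matrix V V ℝ} {v : V → ℝ} (h : D *ᵥ v = v) : energy D v = 0 := by
  rw [energy, h, sub_self]

theorem orthogonal_of_eigenvector {D : Matrix V V ℝ} (hD : D.IsHermitian) {u v : V → ℝ} {r : ℝ}
    (hu : D *ᵥ u = u) (h : D *ᵥ v = r • v) (hr : r ≠ 1) : v ⬝ᵥ u = 0 := by
  have h1 := dotProduct_mulVec_symm hD v u
  rw [hu, h, smul_dotProduct, smul_eq_mul] at h1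
  have : (1 - r) * (v ⬝ᵥ u) = 0 := by linarith
  exact (mul_eq_zero.mp this).resolve_left (sub_ne_zero.mpr hr.symm)

theorem dotProduct_self_pos {v : V → ℝ} (hv : v ≠ 0) : 0 < v ⬝ᵥ v := by
  have h := Finset.sum_nonneg fun i (_ : i ∈ Finset.univ) => mul_self_nonneg (v i)
  refine lt_of_le_of_ne h fun h0 => hv ?_
  exact dotProduct_self_eq_zero.mp h0.symm

/-- Detailed balance turns entries of the discriminant into transition probabilities. -/
theorem discriminant_mul_sqrt {V : Type*} {Q : Matrix V V ℝ} {w : V → ℝ} (hQ : ∀ x y, 0 ≤ Q x y)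
    (hw : ∀ x, 0 ≤ w x) (hb : ∀ x y, w x * Q x y = w y * Q y x) (x y : V) :
    discriminant Q x y * √(w y) = √(w x) * Q x y := by
  rw [discriminant, ← Real.sqrt_mul (mul_nonneg (hQ _ _) (hQ _ _)), mul_assoc, mul_comm (Q y x),
    ← hb x y, show Q x y * (w x * Q x y) = w x * (Q x y * Q x y) by ring,
    Real.sqrt_mul (hw x), Real.sqrt_mul_self (hQ x y)]

/-- The discriminant is similar to the transition matrix. -/
theorem discriminant_mulVec_sqrt {Q : Matrix V V ℝ} {w : V → ℝ} (hQ : ∀ x y, 0 ≤ Q x y)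
    (hw : ∀ x, 0 ≤ w x) (hb : ∀ x y, w x * Q x y = w y * Q y x) (h : V → ℝ) :
    (discriminant Q *ᵥ fun x => √(w x) * h x) = fun x => √(w x) * (Q *ᵥ h) x := by
  ext x
  simp only [Matrix.mulVec, dotProduct, Finset.mul_sum]
  refine Finset.sum_congr rfl fun y _ => ?_
  rw [← mul_assoc, discriminant_mul_sqrt hQ hw hb, mul_assoc]

theorem mem_spectrum_of_eigenvector [DecidableEq V] {Q : Matrix V V ℝ} {h : V → ℝ} {r : ℝ}
    (h0 : h ≠ 0)
    (hh : Q *ᵥ h = r • h) : r ∈ spectrum ℝ Q := by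
  rw [← Matrix.spectrum_toLin', ← Module.End.hasEigenvalue_iff_mem_spectrum]
  exact Module.End.hasEigenvalue_of_hasEigenvector
    ⟨Module.End.mem_eigenspace_iff.mpr (by simpa using hh), h0⟩

theorem exists_eigenvector_of_mem_spectrum [DecidableEq V] {Q : Matrix V V ℝ} {r : ℝ}
    (hr : r ∈ spectrum ℝ Q) :
    ∃ h : V → ℝ, h ≠ 0 ∧ Q *ᵥ h = r • h := by
  rw [← Matrix.spectrum_toLin', ← Module.End.hasEigenvalue_iff_mem_spectrum] at hr
  obtain ⟨h, hh⟩ := hr.exists_hasEigenvector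
  exact ⟨h, hh.2, by simpa using hh.apply_eq_smul⟩

theorem mem_spectrum_of_discriminant [DecidableEq V] {Q : Matrix V V ℝ} {w : V → ℝ}
    (hQ : ∀ x y, 0 ≤ Q x y)
    (hw : ∀ x, 0 < w x) (hb : ∀ x y, w x * Q x y = w y * Q y x) {v : V → ℝ} {r : ℝ} (h0 : v ≠ 0)
    (hv : discriminant Q *ᵥ v = r • v) : r ∈ spectrum ℝ Q := by
  have hs : ∀ x, √(w x) ≠ 0 := fun x => (Real.sqrt_pos.mpr (hw x)).ne'
  have hv' : v = fun x => √(w x) * (v x / √(w x)) := by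
    ext x; rw [mul_div_cancel₀ _ (hs x)]
  refine mem_spectrum_of_eigenvector (h := fun x => v x / √(w x)) ?_ ?_
  · intro h
    apply h0
    rw [hv']
    ext x
    have : v x / √(w x) = 0 := congrFun h x
    simp [this]
  · have h1 := discriminant_mulVec_sqrt hQ (fun x => (hw x).le) hb fun x => v x / √(w x)
    rw [← hv', hv] at h1
    ext x
    have h2 := congrFun h1 x
    simp only [Pi.smul_apply, smul_eq_mul] at h2 ⊢
    rw [mul_div_assoc', h2, mul_div_cancel_left₀ _ (hs x)]

/-- A lower bound for the eigenvalue gap from one for the discriminant. -/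
theorem one_div_gap_le [DecidableEq V] {Q : Matrix V V ℝ} {w : V → ℝ} (hQ : ∀ x y, 0 ≤ Q x y)
    (hw : ∀ x, 0 < w x) (hb : ∀ x y, w x * Q x y = w y * Q y x) {H : ℝ} (hH : 0 < H)
    (h : ∀ (v : V → ℝ) (r : ℝ), v ≠ 0 → discriminant Q *ᵥ v = r • v → r ≠ 1 → 1 ≤ H * (1 - r)) :
    1 / gap Q ≤ H ∧ ∀ (v : V → ℝ) (r : ℝ), v ≠ 0 → discriminant Q *ᵥ v = r • v → r ≠ 1 →
      0 < gap Q ∧ r ≤ 1 - gap Q := by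
  have key : ∀ μ ∈ spectrum ℝ Q \ {1}, 1 / H ≤ 1 - μ := by
    rintro μ ⟨hμ, h1⟩
    obtain ⟨k, hk0, hk⟩ := exists_eigenvector_of_mem_spectrum hμ
    rw [div_le_iff₀ hH, mul_comm]
    refine h (fun x => √(w x) * k x) μ ?_ ?_ h1
    · intro h0
      apply hk0
      ext x
      exact (mul_eq_zero.mp (congrFun h0 x)).resolve_left (Real.sqrt_pos.mpr (hw x)).ne'
    · rw [discriminant_mulVec_sqrt hQ (fun x => (hw x).le) hb, hk]
      ext x; simp; ring
  have hlow : ∀ δ ∈ (fun μ : ℝ => 1 - μ) '' (spectrum ℝ Q \ {1}), 1 / H ≤ δ := by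
    rintro _ ⟨μ, hμ, rfl⟩; exact key μ hμ
  have hgap : (spectrum ℝ Q \ {1}).Nonempty → 1 / H ≤ gap Q := fun hne =>
    le_csInf (hne.image _) hlow
  refine ⟨?_, ?_⟩
  · rcases (spectrum ℝ Q \ {1}).eq_empty_or_nonempty with he | hne
    · simp [gap, he, hH.le]
    · exact (one_div_le_one_div_of_le (by positivity) (hgap hne)).trans (one_div_one_div H).le
  · intro v r h0 hv hr
    have hmem : r ∈ spectrum ℝ Q \ {1} := ⟨mem_spectrum_of_discriminant hQ hw hb h0 hv, hr⟩
    refine ⟨lt_of_lt_of_le (by positivity) (hgap ⟨r, hmem⟩), ?_⟩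
    have : gap Q ≤ 1 - r := csInf_le ⟨1 / H, hlow⟩ ⟨r, hmem, rfl⟩
    linarith

end Dirichlet

section Reversible

variable {V : Type*} [Fintype V] [DecidableEq V] {G : SimpleGraph V} {P : Matrix V V ℝ} {π : V → ℝ}

/-- The vector `|π⟩`. -/
noncomputable def sqrtDist (π : V → ℝ) : V → ℝ := fun x => √(π x)

theorem IsErgodicReversible.pos (h : IsErgodicReversible G P π) (y : V) : 0 < π y := by
  have hx : ∃ x, 0 < π x := by
    by_contra! hc
    have : ∑ x, π x ≤ 0 := Finset.sum_nonpos fun x _ => hc x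
    linarith [h.dist_sum]
  obtain ⟨x, hx⟩ := hx
  obtain ⟨k, hk⟩ := h.irreducible x y
  have hpow : ∀ k : ℕ, π ᵥ* P ^ k = π := by
    intro k
    induction k with
    | zero => simp
    | succ k ih => rw [pow_succ, ← Matrix.vecMul_vecMul, ih, h.stationary]
  have hnn : ∀ k x y, 0 ≤ (P ^ k) x y := by
    intro k
    induction k with
    | zero => intro x y; by_cases hxy : x = y <;> simp [hxy]
    | succ k ih =>
      intro x y
      rw [pow_succ, Matrix.mul_apply]
      exact Finset.sum_nonneg fun z _ => mul_nonneg (ih _ _) (h.nonneg _ _)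
  have h1 : π y = ∑ z, π z * (P ^ k) z y := by
    conv_lhs => rw [← hpow k]
    rfl
  rw [h1]
  refine lt_of_lt_of_le (mul_pos hx hk) ?_
  exact Finset.single_le_sum (f := fun z => π z * (P ^ k) z y)
    (fun z _ => mul_nonneg (h.dist_nonneg z) (hnn _ _ _)) (Finset.mem_univ x)

theorem IsErgodicReversible.sqrtDist_pos (h : IsErgodicReversible G P π) (x : V) :
    0 < sqrtDist π x := Real.sqrt_pos.mpr (h.pos x)

theorem IsErgodicReversible.sqrtDist_sq (h : IsErgodicReversible G P π) (x : V) :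
    sqrtDist π x ^ 2 = π x := Real.sq_sqrt (h.dist_nonneg x)

theorem IsErgodicReversible.sqrtDist_dotProduct_self (h : IsErgodicReversible G P π) :
    sqrtDist π ⬝ᵥ sqrtDist π = 1 := by
  rw [dotProduct, ← h.dist_sum]
  exact Finset.sum_congr rfl fun x _ => by rw [← sq, h.sqrtDist_sq]

theorem IsErgodicReversible.discriminant_mulVec (h : IsErgodicReversible G P π) :
    discriminant P *ᵥ sqrtDist π = sqrtDist π := by
  have h1 := discriminant_mulVec_sqrt h.nonneg h.dist_nonneg h.reversible fun _ => 1
  simp only [mul_one] at h1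
  refine h1.trans ?_
  ext x
  simp [Matrix.mulVec, dotProduct, h.row_sum, sqrtDist]

/-- `⟨f, f⟩ ∓ ⟨f, D f⟩` as a sum of squares over the transitions. -/
theorem IsErgodicReversible.sum_squares (h : IsErgodicReversible G P π) (k : V → ℝ) (σ : ℝ)
    (hσ : σ ^ 2 = 1) :
    (fun x => √(π x) * k x) ⬝ᵥ (fun x => √(π x) * k x) -
      σ * ((fun x => √(π x) * k x) ⬝ᵥ (discriminant P *ᵥ fun x => √(π x) * k x)) =
    (∑ x, ∑ y, π x * P x y * (k x - σ * k y) ^ 2) / 2 := by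
  have e1 : (fun x => √(π x) * k x) ⬝ᵥ (fun x => √(π x) * k x) =
      ∑ x, ∑ y, π x * P x y * k x ^ 2 := by
    rw [dotProduct]
    refine Finset.sum_congr rfl fun x _ => ?_
    rw [← Finset.sum_mul, ← Finset.mul_sum, h.row_sum]
    linear_combination k x ^ 2 * Real.sq_sqrt (h.dist_nonneg x)
  have e2 : ∑ x, ∑ y, π x * P x y * k x ^ 2 = ∑ x, ∑ y, π x * P x y * k y ^ 2 := by
    rw [Finset.sum_comm]
    refine Finset.sum_congr rfl fun x _ => Finset.sum_congr rfl fun y _ => ?_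
    rw [h.reversible]
  have e3 : (fun x => √(π x) * k x) ⬝ᵥ (discriminant P *ᵥ fun x => √(π x) * k x) =
      ∑ x, ∑ y, π x * P x y * (k x * k y) := by
    rw [discriminant_mulVec_sqrt h.nonneg h.dist_nonneg h.reversible, dotProduct]
    refine Finset.sum_congr rfl fun x _ => ?_
    simp only [Matrix.mulVec, dotProduct, Finset.mul_sum]
    refine Finset.sum_congr rfl fun y _ => ?_
    linear_combination (k x * P x y * k y) * Real.sq_sqrt (h.dist_nonneg x)
  have e4 : ∑ x, ∑ y, π x * P x y * (k x - σ * k y) ^ 2 =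
      ∑ x, ∑ y, π x * P x y * k x ^ 2 - 2 * σ * ∑ x, ∑ y, π x * P x y * (k x * k y) +
        ∑ x, ∑ y, π x * P x y * k y ^ 2 := by
    simp only [Finset.mul_sum, ← Finset.sum_sub_distrib, ← Finset.sum_add_distrib]
    refine Finset.sum_congr rfl fun x _ => Finset.sum_congr rfl fun y _ => ?_
    linear_combination (π x * P x y * k y ^ 2) * hσ
  rw [e4, ← e2, e1, e3]; ring

theorem IsErgodicReversible.eq_sqrt_mul (h : IsErgodicReversible G P π) (f : V → ℝ) :
    f = fun x => √(π x) * (f x / √(π x)) := by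
  ext x
  exact (mul_div_cancel₀ _ (Real.sqrt_pos.mpr (h.pos x)).ne').symm

theorem IsErgodicReversible.energy_nonneg (h : IsErgodicReversible G P π) (f : V → ℝ) :
    0 ≤ energy (discriminant P) f := by
  have h1 := h.sum_squares (fun x => f x / √(π x)) 1 (by norm_num)
  rw [← h.eq_sqrt_mul f, one_mul] at h1
  rw [energy, h1]
  exact div_nonneg (Finset.sum_nonneg fun x _ => Finset.sum_nonneg fun y _ =>
    mul_nonneg (mul_nonneg (h.dist_nonneg x) (h.nonneg x y)) (sq_nonneg _)) (by norm_num)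

theorem IsErgodicReversible.neg_le_form (h : IsErgodicReversible G P π) (f : V → ℝ) :
    0 ≤ f ⬝ᵥ f + f ⬝ᵥ (discriminant P *ᵥ f) := by
  have h1 := h.sum_squares (fun x => f x / √(π x)) (-1) (by norm_num)
  rw [← h.eq_sqrt_mul f, neg_one_mul, sub_neg_eq_add] at h1
  rw [h1]
  exact div_nonneg (Finset.sum_nonneg fun x _ => Finset.sum_nonneg fun y _ =>
    mul_nonneg (mul_nonneg (h.dist_nonneg x) (h.nonneg x y)) (sq_nonneg _)) (by norm_num)

/-- By irreducibility, only the multiples of `|π⟩` have energy zero. -/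
theorem IsErgodicReversible.eq_smul_of_energy_eq_zero (h : IsErgodicReversible G P π) {f : V → ℝ}
    (hf : energy (discriminant P) f = 0) : ∃ c : ℝ, f = c • sqrtDist π := by
  have h1 := h.sum_squares (fun x => f x / √(π x)) 1 (by norm_num)
  rw [← h.eq_sqrt_mul f, one_mul] at h1
  rw [energy, h1] at hf
  set k : V → ℝ := fun x => f x / √(π x) with hk
  have hn : ∀ x y, 0 ≤ π x * P x y * (k x - 1 * k y) ^ 2 := fun x y =>
    mul_nonneg (mul_nonneg (h.dist_nonneg x) (h.nonneg x y)) (sq_nonneg _)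
  have h2 : ∑ x, ∑ y, π x * P x y * (k x - 1 * k y) ^ 2 = 0 := by linarith
  have h3 : ∀ x y, 0 < P x y → k x = k y := by
    intro x y hxy
    have h4 := (Finset.sum_eq_zero_iff_of_nonneg fun x _ =>
      Finset.sum_nonneg fun y _ => hn x y).mp h2 x (Finset.mem_univ _)
    have h5 := (Finset.sum_eq_zero_iff_of_nonneg fun y _ => hn x y).mp h4 y (Finset.mem_univ _)
    have h6 := (mul_eq_zero.mp h5).resolve_left (mul_pos (h.pos x) hxy).ne'
    have h7 := pow_eq_zero_iff (two_ne_zero) |>.mp h6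
    linarith
  have h4 : ∀ (m : ℕ) x y, (P ^ m) x y ≠ 0 → k x = k y := by
    intro m
    induction m with
    | zero =>
      intro x y hxy
      by_cases he : x = y
      · rw [he]
      · simp [he] at hxy
    | succ m ih =>
      intro x y hxy
      rw [pow_succ, Matrix.mul_apply] at hxy
      obtain ⟨z, _, hz⟩ := Finset.exists_ne_zero_of_sum_ne_zero hxy
      rw [ih x z (left_ne_zero_of_mul hz)]
      exact h3 z y (lt_of_le_of_ne (h.nonneg z y) (right_ne_zero_of_mul hz).symm)
  rcases isEmpty_or_nonempty V with he | ⟨⟨x₀⟩⟩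
  · exact ⟨0, funext fun x => (he.false x).elim⟩
  · refine ⟨k x₀, ?_⟩
    rw [h.eq_sqrt_mul f]
    ext x
    obtain ⟨m, hm⟩ := h.irreducible x₀ x
    have : k x = k x₀ := (h4 m x₀ x hm.ne').symm
    simp only [Pi.smul_apply, smul_eq_mul, sqrtDist]
    rw [mul_comm, ← this]

end Reversible

/-! ### Hitting times bound spectral gaps -/

section HittingTime

variable {V : Type*} [Fintype V] [DecidableEq V] {G : SimpleGraph V} {P : Matrix V V ℝ} {π : V → ℝ}

/-- Making `y` absorbing replaces its row and column of the discriminant by those of the identity,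
so that only the part of a vector away from `y` contributes to the energy. -/
theorem energy_discriminant_absorbing (P : Matrix V V ℝ) (y : V) (f : V → ℝ) :
    energy (discriminant (absorbing P {y})) f =
      energy (discriminant P) (Function.update f y 0) := by
  have hent : ∀ x z, discriminant (absorbing P {y}) x z =
      if x = y then (if z = y then 1 else 0) else if z = y then 0 else discriminant P x z := by
    intro x z
    by_cases hx : x = y <;> by_cases hz : z = y
    · simp [discriminant, absorbing, hx, hz]
    · have : y ≠ z := fun h => hz h.symm
      simp [discriminant, absorbing, hx, hz, this]
    · have : y ≠ x := fun h => hx h.symm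
      simp [discriminant, absorbing, hx, hz, this]
    · simp [discriminant, absorbing, hx, hz]
  set f' := Function.update f y 0 with hf'
  have hfx : ∀ x, f x = f' x + if x = y then f y else 0 := by
    intro x; by_cases hx : x = y
    · subst hx; simp [hf']
    · simp [hf', hx]
  have h1 : f ⬝ᵥ f = f' ⬝ᵥ f' + f y ^ 2 := by
    have : ∀ x, f x * f x = f' x * f' x + if x = y then f y ^ 2 else 0 := by
      intro x; by_cases hx : x = y
      · subst hx; simp [hf', sq]
      · simp [hf', hx]
    simp [dotProduct, this, Finset.sum_add_distrib]
  have h2 : f ⬝ᵥ (discriminant (absorbing P {y}) *ᵥ f) =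
      f' ⬝ᵥ (discriminant P *ᵥ f') + f y ^ 2 := by
    have hrow : ∀ x, f x * (discriminant (absorbing P {y}) *ᵥ f) x =
        f' x * (discriminant P *ᵥ f') x + if x = y then f y ^ 2 else 0 := by
      intro x
      by_cases hx : x = y
      · subst hx
        simp [Matrix.mulVec, dotProduct, hent, hf', sq]
      · have : (discriminant (absorbing P {y}) *ᵥ f) x = (discriminant P *ᵥ f') x := by
          simp only [Matrix.mulVec, dotProduct, hent, if_neg hx]
          refine Finset.sum_congr rfl fun z _ => ?_
          by_cases hz : z = y
          · subst hz; simp [hf']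
          · simp [hf', hz]
        rw [this]; simp [hf', hx]
    simp [dotProduct, hrow, Finset.sum_add_distrib]
  rw [energy, energy, h1, h2]; ring

/-- The variational upper bound that the hitting time of `y` provides: Cauchy–Schwarz in the
eigenbasis of the discriminant of the chain absorbed at `y`. -/
theorem IsErgodicReversible.sq_le_hittingTime_mul_energy (h : IsErgodicReversible G P π) {y : V}
    (hy : π y < 1) {f : V → ℝ} (hf : f y = 0) :
    (f ⬝ᵥ sqrtDist π) ^ 2 ≤ (1 - π y) * (hittingTime P π {y} * energy (discriminant P) f) := by
  set hA := discriminant_isHermitian (absorbing P {y}) with hAdef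
  set b := hA.eigenvectorBasis with hb
  set F : EuclideanSpace ℝ V := WithLp.toLp 2 f with hF
  set c : V → ℝ := fun k => b.repr F k with hc
  set d : V → ℝ := fun k => ∑ x, b k x * unmarkedState π {y} x with hd
  have hfexp : f = ∑ k, c k • (b k).ofLp := by
    have := congrArg WithLp.ofLp (b.sum_repr F).symm
    simpa [hF, hc, WithLp.ofLp_sum] using this
  have hck : ∀ k, c k = (b k).ofLp ⬝ᵥ f := by
    intro k
    simp only [hc, b.repr_apply_apply, EuclideanSpace.inner_eq_star_dotProduct, hF]
    rw [dotProduct_comm]; simp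
  have hDb : ∀ k, discriminant (absorbing P {y}) *ᵥ (b k).ofLp = hA.eigenvalues k • (b k).ofLp :=
    fun k => hA.mulVec_eigenvectorBasis k
  have hbb : ∀ j k, (b j).ofLp ⬝ᵥ (b k).ofLp = if j = k then 1 else 0 := by
    intro j k
    have := orthonormal_iff_ite.mp b.orthonormal j k
    rw [EuclideanSpace.inner_eq_star_dotProduct, dotProduct_comm] at this
    simpa using this
  have hen : ∀ k, 1 - hA.eigenvalues k =
      energy (discriminant P) (Function.update (b k).ofLp y 0) := by
    intro k
    rw [← energy_discriminant_absorbing, energy_of_eigenvector (hDb k), hbb, if_pos rfl, mul_one]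
  have hle : ∀ k, 0 ≤ 1 - hA.eigenvalues k := fun k => by rw [hen]; exact h.energy_nonneg _
  -- Eigenvectors for the eigenvalue `1` live on the absorbing vertex alone.
  have hone : ∀ k, hA.eigenvalues k = 1 → c k = 0 := by
    intro k hk
    have h0 : energy (discriminant P) (Function.update (b k).ofLp y 0) = 0 := by
      rw [← hen, hk, sub_self]
    obtain ⟨r, hr⟩ := h.eq_smul_of_energy_eq_zero h0
    have hr0 : r = 0 := by
      have := congrFun hr y
      simp only [Function.update_self, Pi.smul_apply, smul_eq_mul] at this
      exact (mul_eq_zero.mp this.symm).resolve_right (h.sqrtDist_pos y).ne'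
    rw [hck, dotProduct]
    refine Finset.sum_eq_zero fun x _ => ?_
    by_cases hx : x = y
    · rw [hx, hf, mul_zero]
    · have := congrFun hr x
      rw [Function.update_of_ne hx, hr0, zero_smul, Pi.zero_apply] at this
      rw [this, zero_mul]
  have hsum : f ⬝ᵥ unmarkedState π {y} = ∑ k, c k * d k := by
    conv_lhs => rw [hfexp]
    rw [sum_dotProduct]
    refine Finset.sum_congr rfl fun k _ => ?_
    rw [smul_dotProduct, smul_eq_mul]; rfl
  have henf : energy (discriminant P) f = ∑ k, (1 - hA.eigenvalues k) * c k ^ 2 := by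
    have hupd : Function.update f y 0 = f := by rw [← hf, Function.update_eq_self]
    have hff : f ⬝ᵥ f = ∑ k, c k ^ 2 := by
      conv_lhs => enter [1]; rw [hfexp]
      rw [sum_dotProduct]
      refine Finset.sum_congr rfl fun k _ => ?_
      rw [smul_dotProduct, smul_eq_mul, ← hck, sq]
    have hfD : f ⬝ᵥ (discriminant (absorbing P {y}) *ᵥ f) = ∑ k, hA.eigenvalues k * c k ^ 2 := by
      conv_lhs => enter [1]; rw [hfexp]
      rw [sum_dotProduct]
      refine Finset.sum_congr rfl fun k _ => ?_
      rw [smul_dotProduct, smul_eq_mul, dotProduct_mulVec_symm hA, hDb, smul_dotProduct,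
        smul_eq_mul, ← hck]
      ring
    rw [← hupd, ← energy_discriminant_absorbing, energy, hff, hfD, ← Finset.sum_sub_distrib]
    exact Finset.sum_congr rfl fun k _ => by ring
  have hCS : (∑ k, c k * d k) ^ 2 ≤ hittingTime P π {y} * energy (discriminant P) f := by
    rw [henf, hittingTime]
    refine Finset.sum_sq_le_sum_mul_sum_of_sq_le_mul _ (fun k _ => ?_) (fun k _ => ?_)
      (fun k _ => ?_)
    · split_ifs
      · exact le_rfl
      · exact div_nonneg (sq_nonneg _) (hle k)
    · exact mul_nonneg (hle k) (sq_nonneg _)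
    · split_ifs with hk
      · rw [hone k hk]; exact le_of_eq (by ring)
      · have : 1 - hA.eigenvalues k ≠ 0 := fun h0 => hk (by linarith)
        have e : d k ^ 2 / (1 - hA.eigenvalues k) * ((1 - hA.eigenvalues k) * c k ^ 2) =
            (c k * d k) ^ 2 := by
          field_simp
        exact e.symm.le
  have hpos : 0 < 1 - π y := by linarith
  have hun : f ⬝ᵥ unmarkedState π {y} = (f ⬝ᵥ sqrtDist π) / √(1 - π y) := by
    rw [dotProduct, dotProduct, Finset.sum_div]
    refine Finset.sum_congr rfl fun x _ => ?_
    by_cases hx : x = y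
    · rw [hx, hf]; simp
    · simp [unmarkedState, hx, sqrtDist, mul_div_assoc]
  rw [← hsum, hun, div_pow, Real.sq_sqrt hpos.le, div_le_iff₀ hpos] at hCS
  linarith

theorem hittingTime_le_max (P : Matrix V V ℝ) (π : V → ℝ) (y : V) :
    hittingTime P π {y} ≤ maxHittingTime P π :=
  le_ciSup (f := fun x : V => hittingTime P π {x}) (Set.finite_range _).bddAbove y

theorem IsErgodicReversible.lt_one (h : IsErgodicReversible G P π) {g : V} (hg : π g ≤ 1 / 2)
    (y : V) : π y < 1 := by
  by_cases hy : y = g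
  · rw [hy]; linarith
  · have h1 : π y + π g ≤ 1 := by
      rw [← h.dist_sum, ← Finset.sum_pair hy]
      exact Finset.sum_le_sum_of_subset_of_nonneg (Finset.subset_univ _)
        fun x _ _ => h.dist_nonneg x
    linarith [h.pos g]

theorem IsErgodicReversible.sq_le_max_mul_energy (h : IsErgodicReversible G P π) {g : V}
    (hg : π g ≤ 1 / 2) {y : V} {f : V → ℝ} (hf : f y = 0) :
    (f ⬝ᵥ sqrtDist π) ^ 2 ≤
      (1 - π y) * (maxHittingTime P π * energy (discriminant P) f) := by
  have hy := h.lt_one hg y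
  refine (h.sq_le_hittingTime_mul_energy hy hf).trans ?_
  have : 0 ≤ 1 - π y := by linarith
  gcongr
  · exact h.energy_nonneg f
  · exact hittingTime_le_max P π y

/-- Testing the hitting time of `g` with `|π⟩` restricted to the other vertices. -/
theorem IsErgodicReversible.one_le_maxHittingTime (h : IsErgodicReversible G P π) {g : V}
    (hg : π g ≤ 1 / 2) : 1 ≤ maxHittingTime P π := by
  set f : V → ℝ := Function.update (sqrtDist π) g 0 with hf
  have hfg : f g = 0 := by simp [hf]
  have h1 := h.sq_le_max_mul_energy hg hfg
  have hsplit : ∀ x, f x * sqrtDist π x = π x - if x = g then π g else 0 := by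
    intro x
    by_cases hx : x = g
    · subst hx; simp [hf]
    · simp [hf, hx, ← sq, h.sqrtDist_sq]
  have e1 : f ⬝ᵥ sqrtDist π = 1 - π g := by
    simp [dotProduct, hsplit, Finset.sum_sub_distrib, h.dist_sum]
  have hfs : ∀ x, f x * f x = f x * sqrtDist π x := by
    intro x
    by_cases hx : x = g
    · subst hx; simp [hf]
    · simp [hf, hx]
  have e2 : f ⬝ᵥ f = 1 - π g := by
    rw [← e1]; exact Finset.sum_congr rfl fun x _ => hfs x
  have hf0 : ∀ x, 0 ≤ f x := by
    intro x
    by_cases hx : x = g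
    · subst hx; simp [hf]
    · simp [hf, hx, (h.sqrtDist_pos x).le]
  have e3 : energy (discriminant P) f ≤ 1 - π g := by
    have : 0 ≤ f ⬝ᵥ (discriminant P *ᵥ f) := Finset.sum_nonneg fun x _ => mul_nonneg (hf0 x)
      (Finset.sum_nonneg fun y _ => mul_nonneg (Real.sqrt_nonneg _) (hf0 y))
    rw [energy, e2]; linarith
  have e4 := h.energy_nonneg f
  rw [e1] at h1
  have hp : 0 < 1 - π g := by linarith
  have h2 : 1 - π g ≤ maxHittingTime P π * energy (discriminant P) f := by
    by_contra! hc
    have := mul_lt_mul_of_pos_left hc hp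
    nlinarith
  by_contra! hc
  rcases e4.eq_or_lt with h0 | h0
  · rw [← h0, mul_zero] at h2; linarith
  · nlinarith

/-- The Poincaré inequality: the spectral gap is at least the inverse of the largest hitting time.
It results from averaging the bound for the hitting time of `y` over `y` with weights `π y`, where
the test vector is `w` with a multiple of `|π⟩` subtracted that makes it vanish at `y`. -/
theorem IsErgodicReversible.poincare (h : IsErgodicReversible G P π) {g : V} (hg : π g ≤ 1 / 2)
    (w : V → ℝ) :
    w ⬝ᵥ w - (w ⬝ᵥ sqrtDist π) ^ 2 ≤ maxHittingTime P π * energy (discriminant P) w := by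
  set η := maxHittingTime P π * energy (discriminant P) w with hη
  set p := w ⬝ᵥ sqrtDist π with hp
  have hη0 : 0 ≤ η :=
    mul_nonneg (zero_le_one.trans (h.one_le_maxHittingTime hg)) (h.energy_nonneg w)
  have key : ∀ y, π y * p ^ 2 - 2 * p * (w y * sqrtDist π y) + w y * w y ≤ π y * η := by
    intro y
    have hs := h.sqrtDist_pos y
    have h0 : (w - (w y / sqrtDist π y) • sqrtDist π) y = 0 := by
      simp [hs.ne']
    have h1 := h.sq_le_max_mul_energy hg h0
    rw [energy_sub_smul (discriminant_isHermitian P) h.discriminant_mulVec, sub_dotProduct,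
      smul_dotProduct, h.sqrtDist_dotProduct_self, ← hp, smul_eq_mul, mul_one, ← hη] at h1
    have h2 : (p - w y / sqrtDist π y) ^ 2 ≤ η :=
      h1.trans (by have := h.dist_nonneg y; nlinarith)
    have h3 := mul_le_mul_of_nonneg_left h2 (h.dist_nonneg y)
    refine le_trans (le_of_eq ?_) h3
    rw [← h.sqrtDist_sq y]
    field_simp
    ring
  have hs := Finset.sum_le_sum fun y (_ : y ∈ Finset.univ) => key y
  rw [Finset.sum_add_distrib, Finset.sum_sub_distrib, ← Finset.sum_mul, ← Finset.sum_mul,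
    ← Finset.mul_sum, h.dist_sum] at hs
  change 1 * p ^ 2 - 2 * p * p + w ⬝ᵥ w ≤ 1 * η at hs
  linarith

end HittingTime

/-! ### The chains that are walked on -/

section WalkChain

variable {V : Type*} [Fintype V] [DecidableEq V] {G : SimpleGraph V} {P : Matrix V V ℝ} {π : V → ℝ}

/-- What the analysis of fast-forwarding uses of a chain `Q`: the unit vector `u` spans the
eigenspace of its discriminant for the eigenvalue `1`, the other eigenvalues are nonnegative and
respect the gap, and the inverse gap is at most `H`. -/
structure IsGapped (G : SimpleGraph V) (Q : Matrix V V ℝ) (u : V → ℝ) (H : ℝ) : Prop where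
  nonneg : ∀ x y, 0 ≤ Q x y
  on_graph : ∀ x y, Q x y ≠ 0 → x = y ∨ G.Adj x y
  fixed : discriminant Q *ᵥ u = u
  unit : u ⬝ᵥ u = 1
  simple : ∀ v, discriminant Q *ᵥ v = v → ∃ c : ℝ, v = c • u
  eigenvalue_bounds : ∀ (v : V → ℝ) (r : ℝ), v ≠ 0 → discriminant Q *ᵥ v = r • v → r ≠ 1 →
    0 ≤ r ∧ 0 < gap Q ∧ r ≤ 1 - gap Q
  one_div_gap_le : 1 / gap Q ≤ H

theorem nonneg_of_form {V : Type*} [Fintype V] {D : Matrix V V ℝ}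
    (hD : ∀ f, 0 ≤ f ⬝ᵥ (D *ᵥ f)) {v : V → ℝ} {r : ℝ} (hv : v ≠ 0) (h : D *ᵥ v = r • v) :
    0 ≤ r := by
  have h1 := hD v
  rw [h, dotProduct_smul, smul_eq_mul] at h1
  exact nonneg_of_mul_nonneg_left h1 (dotProduct_self_pos hv)

theorem discriminant_lazy {V : Type*} [DecidableEq V] {P : Matrix V V ℝ} (hP : ∀ x, 0 ≤ P x x)
    {κ : ℝ} (h0 : 0 ≤ κ) (h1 : κ ≤ 1) :
    discriminant ((1 - κ) • (1 : Matrix V V ℝ) + κ • P) =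
      (1 - κ) • (1 : Matrix V V ℝ) + κ • discriminant P := by
  ext x y
  by_cases hxy : x = y
  · subst hxy
    have : 0 ≤ 1 - κ + κ * P x x := add_nonneg (by linarith) (mul_nonneg h0 (hP x))
    simp [discriminant, Real.sqrt_mul_self this, Real.sqrt_mul_self (hP x)]
  · have hyx : y ≠ x := fun h => hxy h.symm
    simp only [discriminant, Matrix.add_apply, Matrix.smul_apply, Matrix.one_apply_ne hxy,
      Matrix.one_apply_ne hyx, smul_eq_mul, mul_zero, zero_add]
    rw [show κ * P x y * (κ * P y x) = κ * κ * (P x y * P y x) by ring,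
      Real.sqrt_mul (mul_self_nonneg κ), Real.sqrt_mul_self h0]

/-- A nonnegative spectrum makes the quadratic form of the discriminant nonnegative. -/
theorem form_nonneg_of_spectrum (h : IsErgodicReversible G P π)
    (hs : ∀ μ ∈ spectrum ℝ P, 0 ≤ μ) (f : V → ℝ) : 0 ≤ f ⬝ᵥ (discriminant P *ᵥ f) := by
  have hA := discriminant_isHermitian P
  have hpsd : (discriminant P).PosSemidef := by
    refine hA.posSemidef_iff_eigenvalues_nonneg.mpr fun k => hs _ ?_
    refine mem_spectrum_of_discriminant h.nonneg h.pos h.reversible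
      (v := (hA.eigenvectorBasis k).ofLp) ?_ (hA.mulVec_eigenvectorBasis k)
    intro h0
    exact hA.eigenvectorBasis.orthonormal.ne_zero k (by ext x; simpa using congrFun h0 x)
  simpa using hpsd.dotProduct_mulVec_nonneg f

/-- The chain walked on is a lazy version of `P` with laziness at most one half, and its
discriminant is positive semidefinite. -/
theorem walkChain_spec (h : IsErgodicReversible G P π) : ∃ κ : ℝ, 1 / 2 ≤ κ ∧ κ ≤ 1 ∧
    walkChain P = (1 - κ) • (1 : Matrix V V ℝ) + κ • P ∧
    ∀ f, 0 ≤ f ⬝ᵥ (discriminant (walkChain P) *ᵥ f) := by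
  by_cases hs : ∀ μ ∈ spectrum ℝ P, 0 ≤ μ
  · refine ⟨1, by norm_num, le_rfl, by simp [walkChain, if_pos hs], ?_⟩
    rw [walkChain, if_pos hs]
    exact form_nonneg_of_spectrum h hs
  · have e : walkChain P = (1 - 1 / 2 : ℝ) • (1 : Matrix V V ℝ) + (1 / 2 : ℝ) • P := by
      rw [walkChain, if_neg hs, lazyChain, smul_add]; norm_num
    refine ⟨1 / 2, le_rfl, by norm_num, e, fun f => ?_⟩
    rw [e, discriminant_lazy (fun x => h.nonneg x x) (by norm_num) (by norm_num),
      Matrix.add_mulVec, Matrix.smul_mulVec, Matrix.smul_mulVec, Matrix.one_mulVec,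
      dotProduct_add, dotProduct_smul, dotProduct_smul, smul_eq_mul, smul_eq_mul]
    linarith [h.neg_le_form f]

theorem walkChain_nonneg (h : IsErgodicReversible G P π) (x y : V) : 0 ≤ walkChain P x y := by
  obtain ⟨κ, h1, h2, e, -⟩ := walkChain_spec h
  rw [e, Matrix.add_apply, Matrix.smul_apply, Matrix.smul_apply, smul_eq_mul, smul_eq_mul]
  refine add_nonneg (mul_nonneg (by linarith) ?_) (mul_nonneg (by linarith) (h.nonneg x y))
  rw [Matrix.one_apply]; split_ifs <;> norm_num

theorem walkChain_row_sum (h : IsErgodicReversible G P π) (x : V) : ∑ y, walkChain P x y = 1 := by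
  obtain ⟨κ, -, -, e, -⟩ := walkChain_spec h
  simp [e, Finset.sum_add_distrib, ← Finset.mul_sum, h.row_sum, Matrix.one_apply]

theorem walkChain_on_graph (h : IsErgodicReversible G P π) (x y : V) (hxy : walkChain P x y ≠ 0) :
    x = y ∨ G.Adj x y := by
  obtain ⟨κ, -, -, e, -⟩ := walkChain_spec h
  by_contra! hc
  rw [e] at hxy
  by_cases hP : P x y = 0
  · simp [Matrix.one_apply_ne hc.1, hP] at hxy
  · exact (h.on_graph x y hP).elim hc.1 hc.2

theorem walkChain_reversible (h : IsErgodicReversible G P π) (x y : V) :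
    π x * walkChain P x y = π y * walkChain P y x := by
  obtain ⟨κ, -, -, e, -⟩ := walkChain_spec h
  by_cases hxy : x = y
  · rw [hxy]
  · have hyx : y ≠ x := fun h => hxy h.symm
    simp only [e, Matrix.add_apply, Matrix.smul_apply, Matrix.one_apply_ne hxy,
      Matrix.one_apply_ne hyx, smul_eq_mul, mul_zero, zero_add]
    linear_combination κ * h.reversible x y

theorem walkChain_fixed (h : IsErgodicReversible G P π) :
    discriminant (walkChain P) *ᵥ sqrtDist π = sqrtDist π := by
  have h1 := discriminant_mulVec_sqrt (walkChain_nonneg h) h.dist_nonneg (walkChain_reversible h)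
    fun _ => 1
  simp only [mul_one] at h1
  refine h1.trans ?_
  ext x
  simp [Matrix.mulVec, dotProduct, walkChain_row_sum h, sqrtDist]

/-- Laziness costs at most a factor two in the energy. -/
theorem energy_le_two_mul (h : IsErgodicReversible G P π) (f : V → ℝ) :
    energy (discriminant P) f ≤ 2 * energy (discriminant (walkChain P)) f := by
  obtain ⟨κ, h1, h2, e, -⟩ := walkChain_spec h
  have h3 : energy (discriminant (walkChain P)) f = κ * energy (discriminant P) f := by
    rw [e, discriminant_lazy (fun x => h.nonneg x x) (by linarith) h2, energy, energy,
      Matrix.add_mulVec, Matrix.smul_mulVec, Matrix.smul_mulVec, Matrix.one_mulVec,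
      dotProduct_add, dotProduct_smul, dotProduct_smul, smul_eq_mul, smul_eq_mul]
    ring
  rw [h3]
  nlinarith [h.energy_nonneg f]

theorem isGapped_walkChain (h : IsErgodicReversible G P π) {g : V} (hg : π g ≤ 1 / 2) :
    IsGapped G (walkChain P) (sqrtDist π) (3 * maxHittingTime P π) := by
  have hH := h.one_le_maxHittingTime hg
  have hD := discriminant_isHermitian (walkChain P)
  have hgap : ∀ (v : V → ℝ) (r : ℝ), v ≠ 0 → discriminant (walkChain P) *ᵥ v = r • v → r ≠ 1 →
      1 ≤ 3 * maxHittingTime P π * (1 - r) := by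
    intro v r hv0 hv hr
    have h1 := h.poincare hg v
    rw [orthogonal_of_eigenvector hD (walkChain_fixed h) hv hr] at h1
    have h2 := energy_le_two_mul h v
    rw [energy_of_eigenvector hv] at h2
    have h3 := dotProduct_self_pos hv0
    have h4 := h.energy_nonneg v
    have h5 : 0 ≤ 1 - r := by
      by_contra! hc
      nlinarith
    have h6 : v ⬝ᵥ v ≤ maxHittingTime P π * (2 * ((1 - r) * (v ⬝ᵥ v))) := by
      refine le_trans ?_ (mul_le_mul_of_nonneg_left h2 (by linarith))
      linarith
    have h7 : 1 * (v ⬝ᵥ v) ≤ (2 * maxHittingTime P π * (1 - r)) * (v ⬝ᵥ v) := by linarith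
    have h8 := le_of_mul_le_mul_right h7 h3
    nlinarith
  obtain ⟨κ, -, -, -, hpsd⟩ := walkChain_spec h
  have hb := one_div_gap_le (walkChain_nonneg h) h.pos (walkChain_reversible h)
    (by linarith) hgap
  refine ⟨walkChain_nonneg h, walkChain_on_graph h, walkChain_fixed h,
    h.sqrtDist_dotProduct_self, fun v hv => ?_, fun v r h0 hv hr =>
    ⟨nonneg_of_form hpsd h0 hv, hb.2 v r h0 hv hr⟩, hb.1⟩
  refine h.eq_smul_of_energy_eq_zero (le_antisymm ?_ (h.energy_nonneg v))
  have := energy_le_two_mul h v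
  rwa [energy_of_fixed hv, mul_zero] at this

/-- The stationary vector `(|g⟩ + |π̄⟩) / √2` of the interpolated chain. -/
noncomputable def mixState (π : V → ℝ) (g : V) : V → ℝ :=
  fun x => (if x = g then √(1 - π g) else √(π x)) / √(2 * (1 - π g))

/-- Damping of the coordinate `g` by `√(1 - s)`. -/
noncomputable def damp (π : V → ℝ) (g : V) (v : V → ℝ) : V → ℝ :=
  fun x => (if x = g then √(1 - interpParam π g) else 1) * v x

section Interpolated

variable {g : V}

theorem chosenChain_apply (P : Matrix V V ℝ) (π : V → ℝ) (g x y : V) : chosenChain P π g x y =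
    if x = g then (1 - interpParam π g) * walkChain P x y +
      interpParam π g * (if x = y then 1 else 0) else walkChain P x y := by
  by_cases hx : x = g
  · simp [chosenChain, interpolated, absorbing, hx]
  · simp [chosenChain, interpolated, absorbing, hx]; ring

theorem interpParam_bounds (h : IsErgodicReversible G P π) (hg : π g ≤ 1 / 2) :
    0 ≤ interpParam π g ∧ 0 < 1 - interpParam π g ∧ interpParam π g ≤ 1 ∧
      (1 - interpParam π g) * (1 - π g) = π g := by
  have h1 : 0 < 1 - π g := by linarith
  have h2 : 1 - interpParam π g = π g / (1 - π g) := by rw [interpParam]; ring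
  have h3 : π g / (1 - π g) ≤ 1 := by rw [div_le_one h1]; linarith
  have h4 : 0 < π g / (1 - π g) := div_pos (h.pos g) h1
  refine ⟨by linarith, by linarith, by linarith, ?_⟩
  rw [h2, div_mul_cancel₀ _ h1.ne']

theorem chosenChain_nonneg (h : IsErgodicReversible G P π) (hg : π g ≤ 1 / 2) (x y : V) :
    0 ≤ chosenChain P π g x y := by
  obtain ⟨h1, h2, -, -⟩ := interpParam_bounds h hg
  have h3 := walkChain_nonneg h x y
  rw [chosenChain_apply]
  split_ifs <;> positivity

theorem chosenChain_row_sum (h : IsErgodicReversible G P π) (x : V) :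
    ∑ y, chosenChain P π g x y = 1 := by
  simp only [chosenChain_apply]
  by_cases hx : x = g
  · simp [hx, Finset.sum_add_distrib, ← Finset.mul_sum, walkChain_row_sum h]
  · simp [hx, walkChain_row_sum h]

theorem chosenChain_on_graph (h : IsErgodicReversible G P π) (x y : V)
    (hxy : chosenChain P π g x y ≠ 0) : x = y ∨ G.Adj x y := by
  by_cases he : x = y
  · exact Or.inl he
  · refine walkChain_on_graph h x y fun h0 => hxy ?_
    rw [chosenChain_apply]; simp [he, h0]

/-- The weights `π x` with `π g` raised to `1 - π g` are reversible for the interpolated chain. -/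
theorem chosenChain_reversible (h : IsErgodicReversible G P π) (hg : π g ≤ 1 / 2) (x y : V) :
    (if x = g then 1 - π g else π x) * chosenChain P π g x y =
      (if y = g then 1 - π g else π y) * chosenChain P π g y x := by
  obtain ⟨-, -, -, h4⟩ := interpParam_bounds h hg
  by_cases hxy : x = y
  · rw [hxy]
  have hyx : y ≠ x := fun e => hxy e.symm
  rw [chosenChain_apply, chosenChain_apply]
  have hr := walkChain_reversible h x y
  by_cases hx : x = g
  · have hy : y ≠ g := fun e => hxy (hx.trans e.symm)
    simp only [hx, hy, if_true, if_false] at hr ⊢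
    rw [if_neg hy.symm]
    linear_combination hr + walkChain P g y * h4
  · by_cases hy : y = g
    · simp only [hx, hy, if_true, if_false] at hr ⊢
      rw [if_neg fun e => hx e.symm]
      linear_combination hr - walkChain P g x * h4
    · simpa [hx, hy] using hr

theorem discriminant_chosenChain_mulVec (h : IsErgodicReversible G P π) (hg : π g ≤ 1 / 2)
    (v : V → ℝ) (x : V) : (discriminant (chosenChain P π g) *ᵥ v) x =
      (if x = g then √(1 - interpParam π g) else 1) *
        (discriminant (walkChain P) *ᵥ damp π g v) x +
      if x = g then interpParam π g * v g else 0 := by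
  obtain ⟨h1, h2, -, -⟩ := interpParam_bounds h hg
  have hw := walkChain_nonneg h
  have hent : ∀ x y, discriminant (chosenChain P π g) x y =
      (if x = g then √(1 - interpParam π g) else 1) *
        (discriminant (walkChain P) x y * (if y = g then √(1 - interpParam π g) else 1)) +
      if x = g then (if y = g then interpParam π g else 0) else 0 := by
    intro x y
    have hs : √(1 - interpParam π g) * √(1 - interpParam π g) = 1 - interpParam π g :=
      Real.mul_self_sqrt h2.le
    simp only [discriminant, chosenChain_apply]
    by_cases hx : x = g
    · by_cases hy : y = g
      · simp only [hx, hy, if_true, mul_one]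
        have h3 : 0 ≤ (1 - interpParam π g) * walkChain P g g + interpParam π g :=
          add_nonneg (mul_nonneg h2.le (hw g g)) h1
        rw [Real.sqrt_mul_self h3, Real.sqrt_mul_self (hw g g)]
        linear_combination -walkChain P g g * hs
      · have hgy : g ≠ y := fun e => hy e.symm
        simp only [hx, hy, hgy, if_true, if_false, mul_zero, add_zero, mul_one]
        rw [mul_assoc, Real.sqrt_mul h2.le]
    · have hgx : g ≠ x := fun e => hx e.symm
      by_cases hy : y = g
      · simp only [hx, hy, hgx, if_true, if_false, mul_zero, add_zero, one_mul]
        rw [show walkChain P x g * ((1 - interpParam π g) * walkChain P g x) =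
          (1 - interpParam π g) * (walkChain P x g * walkChain P g x) by ring,
          Real.sqrt_mul h2.le, mul_comm]
      · simp [hx, hy]
  simp only [Matrix.mulVec, dotProduct, hent, add_mul, Finset.sum_add_distrib, Finset.mul_sum, damp]
  congr 1
  · exact Finset.sum_congr rfl fun y _ => by ring
  · by_cases hx : x = g <;> simp [hx]

/-- With `K` the damping, `1 - D(P(s)) = K (1 - D(P)) K`. -/
theorem energy_chosenChain (h : IsErgodicReversible G P π) (hg : π g ≤ 1 / 2) (v : V → ℝ) :
    energy (discriminant (chosenChain P π g)) v =
      energy (discriminant (walkChain P)) (damp π g v) := by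
  obtain ⟨h1, h2, -, -⟩ := interpParam_bounds h hg
  have e1 : v ⬝ᵥ (discriminant (chosenChain P π g) *ᵥ v) =
      damp π g v ⬝ᵥ (discriminant (walkChain P) *ᵥ damp π g v) + interpParam π g * v g ^ 2 := by
    have : ∀ x, v x * (discriminant (chosenChain P π g) *ᵥ v) x =
        damp π g v x * (discriminant (walkChain P) *ᵥ damp π g v) x +
          if x = g then interpParam π g * v g ^ 2 else 0 := by
      intro x
      rw [discriminant_chosenChain_mulVec h hg]
      by_cases hx : x = g
      · simp only [hx, if_true, damp]; ring
      · simp [hx, damp]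
    simp [dotProduct, this, Finset.sum_add_distrib]
  have e2 : v ⬝ᵥ v = damp π g v ⬝ᵥ damp π g v + interpParam π g * v g ^ 2 := by
    have : ∀ x, v x * v x = damp π g v x * damp π g v x +
        if x = g then interpParam π g * v g ^ 2 else 0 := by
      intro x
      by_cases hx : x = g
      · simp only [hx, if_true, damp]
        linear_combination -(v g ^ 2) * Real.mul_self_sqrt h2.le
      · simp [hx, damp]
    simp [dotProduct, this, Finset.sum_add_distrib]
  rw [energy, energy, e1, e2]; ring

theorem form_chosenChain_nonneg (h : IsErgodicReversible G P π) (hg : π g ≤ 1 / 2) (v : V → ℝ) :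
    0 ≤ v ⬝ᵥ (discriminant (chosenChain P π g) *ᵥ v) := by
  obtain ⟨h1, h2, -, -⟩ := interpParam_bounds h hg
  obtain ⟨κ, -, -, -, hpsd⟩ := walkChain_spec h
  have : ∀ x, v x * (discriminant (chosenChain P π g) *ᵥ v) x =
      damp π g v x * (discriminant (walkChain P) *ᵥ damp π g v) x +
        if x = g then interpParam π g * v g ^ 2 else 0 := by
    intro x
    rw [discriminant_chosenChain_mulVec h hg]
    by_cases hx : x = g
    · simp only [hx, if_true, damp]; ring
    · simp [hx, damp]
  have e : v ⬝ᵥ (discriminant (chosenChain P π g) *ᵥ v) =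
      damp π g v ⬝ᵥ (discriminant (walkChain P) *ᵥ damp π g v) + interpParam π g * v g ^ 2 := by
    simp [dotProduct, this, Finset.sum_add_distrib]
  rw [e]
  exact add_nonneg (hpsd _) (mul_nonneg h1 (sq_nonneg _))

theorem sqrt_two_mul_pos {V : Type*} {π : V → ℝ} {g : V} (hg : π g ≤ 1 / 2) :
    0 < √(2 * (1 - π g)) :=
  Real.sqrt_pos.mpr (by linarith)

theorem damp_mixState (h : IsErgodicReversible G P π) (hg : π g ≤ 1 / 2) :
    damp π g (mixState π g) = (1 / √(2 * (1 - π g))) • sqrtDist π := by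
  obtain ⟨h1, h2, -, h4⟩ := interpParam_bounds h hg
  ext x
  by_cases hx : x = g
  · simp only [damp, mixState, hx, if_true, Pi.smul_apply, smul_eq_mul, sqrtDist]
    rw [mul_div_assoc', ← Real.sqrt_mul h2.le, h4]; ring
  · simp only [damp, mixState, hx, if_false, Pi.smul_apply, smul_eq_mul, sqrtDist]; ring

theorem mixState_unit (h : IsErgodicReversible G P π) (hg : π g ≤ 1 / 2) :
    mixState π g ⬝ᵥ mixState π g = 1 := by
  have h1 : 0 < 2 * (1 - π g) := by linarith
  have : ∀ x, mixState π g x * mixState π g x =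
      (π x + if x = g then 1 - 2 * π g else 0) / (2 * (1 - π g)) := by
    intro x
    simp only [mixState, div_mul_div_comm]
    rw [Real.mul_self_sqrt h1.le]
    by_cases hx : x = g
    · simp only [hx, if_true]
      rw [Real.mul_self_sqrt (by linarith)]; ring
    · simp only [hx, if_false]
      rw [Real.mul_self_sqrt (h.dist_nonneg x)]; ring
  simp only [dotProduct, this, ← Finset.sum_div, Finset.sum_add_distrib, h.dist_sum]
  rw [Finset.sum_ite_eq' Finset.univ g, if_pos (Finset.mem_univ g)]
  rw [div_eq_one_iff_eq h1.ne']; ring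

theorem mixState_fixed (h : IsErgodicReversible G P π) (hg : π g ≤ 1 / 2) :
    discriminant (chosenChain P π g) *ᵥ mixState π g = mixState π g := by
  obtain ⟨h1, h2, -, h4⟩ := interpParam_bounds h hg
  ext x
  rw [discriminant_chosenChain_mulVec h hg, damp_mixState h hg, Matrix.mulVec_smul,
    walkChain_fixed h, ← damp_mixState h hg]
  by_cases hx : x = g
  · simp only [hx, if_true, damp]
    linear_combination mixState π g g * Real.mul_self_sqrt h2.le
  · simp [hx, damp]

/-- Eigenvectors of the interpolated chain other than its stationary vector obey a Poincaré
inequality: the part away from `g` by the Poincaré inequality of `P`, and the coordinate at `g` by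
the hitting time of `g`. -/
theorem sq_le_energy_chosenChain (h : IsErgodicReversible G P π) (hg : π g ≤ 1 / 2) {v : V → ℝ}
    (hv : v ⬝ᵥ mixState π g = 0) :
    v ⬝ᵥ v ≤ 3 / 2 * (maxHittingTime P π * energy (discriminant P) (damp π g v)) := by
  obtain ⟨h1, h2, h3, h4⟩ := interpParam_bounds h hg
  set s := interpParam π g with hs
  have hp : 0 < 1 - π g := by linarith
  set N := √(2 * (1 - π g)) with hN
  have hN0 : 0 < N := sqrt_two_mul_pos hg
  have hN2 : N * N = 2 * (1 - π g) := Real.mul_self_sqrt (by linarith)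
  set q := √(1 - π g) with hq
  have hq0 : 0 < q := Real.sqrt_pos.mpr hp
  have hq2 : q * q = 1 - π g := Real.mul_self_sqrt hp.le
  have hug : mixState π g g = q / N := by simp [mixState, hN, hq]
  -- The overlap of `v` with `|π⟩` outside of `g`.
  have hout : v ⬝ᵥ sqrtDist π = v g * √(π g) - v g * q := by
    have : ∀ x, v x * mixState π g x =
        (v x * sqrtDist π x + if x = g then v g * q - v g * √(π g) else 0) / N := by
      intro x
      by_cases hx : x = g
      · simp only [mixState, hx, if_true, sqrtDist]; ring
      · simp only [mixState, hx, if_false, sqrtDist]; ring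
    have h5 : v ⬝ᵥ mixState π g = (v ⬝ᵥ sqrtDist π + (v g * q - v g * √(π g))) / N := by
      rw [dotProduct]
      simp only [this, ← Finset.sum_div, Finset.sum_add_distrib]
      simp [dotProduct]
    rw [h5] at hv
    have := (div_eq_zero_iff.mp hv).resolve_right hN0.ne'
    linarith
  set w := damp π g v with hw
  set η := maxHittingTime P π * energy (discriminant P) w with hη
  have hwx : ∀ x, w x = v x + if x = g then (√(1 - s) - 1) * v g else 0 := by
    intro x
    by_cases hx : x = g
    · simp only [hw, damp, hx, if_true]; ring
    · simp [hw, damp, hx]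
  have hk2 : √(1 - s) * √(1 - s) = 1 - s := Real.mul_self_sqrt h2.le
  have hkq : √(1 - s) * q = √(π g) := by rw [hq, ← Real.sqrt_mul h2.le, h4]
  have hww : w ⬝ᵥ w = v ⬝ᵥ v - s * v g ^ 2 := by
    have : ∀ x, w x * w x = v x * v x - if x = g then s * v g ^ 2 else 0 := by
      intro x
      by_cases hx : x = g
      · simp only [hwx, hx, if_true]; linear_combination (v g ^ 2) * hk2
      · simp [hwx, hx]
    simp [dotProduct, this, Finset.sum_sub_distrib]
  have hwp : w ⬝ᵥ sqrtDist π = - (s * q * v g) := by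
    have : ∀ x, w x * sqrtDist π x = v x * sqrtDist π x +
        if x = g then (√(1 - s) - 1) * v g * √(π g) else 0 := by
      intro x
      by_cases hx : x = g
      · simp only [hwx, hx, if_true, sqrtDist]; ring
      · simp [hwx, hx]
    have h5 : w ⬝ᵥ sqrtDist π = v ⬝ᵥ sqrtDist π + (√(1 - s) - 1) * v g * √(π g) := by
      rw [dotProduct]
      simp only [this, Finset.sum_add_distrib]
      simp [dotProduct]
    rw [h5, hout, ← hkq]
    linear_combination (v g * q) * hk2
  have hpoin : v ⬝ᵥ v - s * v g ^ 2 - s ^ 2 * (1 - π g) * v g ^ 2 ≤ η := by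
    have := h.poincare hg w
    rw [hww, hwp] at this
    refine le_trans (le_of_eq ?_) this
    rw [← hq2]; ring
  -- The test vector for the hitting time of `g`.
  have hvg : 4 * v g ^ 2 ≤ η := by
    have hf0 : (w - (v g / (q / N)) • ((1 / N) • sqrtDist π)) g = 0 := by
      have : sqrtDist π g = √(1 - s) * q := hkq.symm
      simp only [Pi.sub_apply, Pi.smul_apply, smul_eq_mul, this, hw, damp, if_true]
      field_simp
      ring
    have h5 := h.sq_le_max_mul_energy hg hf0
    rw [smul_smul, energy_sub_smul (discriminant_isHermitian P) h.discriminant_mulVec,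
      sub_dotProduct, smul_dotProduct, h.sqrtDist_dotProduct_self, hwp, smul_eq_mul, mul_one,
      ← hη] at h5
    have e : -(s * q * v g) - v g / (q / N) * (1 / N) = - (2 * q * v g) := by
      have hs1 : s * (q * q) = 2 * (q * q) - 1 := by rw [hq2]; linarith
      field_simp
      linear_combination (-v g) * hs1
    rw [e] at h5
    have h6 : (1 - π g) * (4 * v g ^ 2) ≤ (1 - π g) * η := by
      refine le_trans (le_of_eq ?_) h5
      rw [← hq2]; ring
    exact le_of_mul_le_mul_left h6 hp
  have hv2 : 0 ≤ v g ^ 2 := sq_nonneg _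
  have h7 : s * v g ^ 2 ≤ v g ^ 2 := mul_le_of_le_one_left hv2 h3
  have h8 : s ^ 2 * (1 - π g) * v g ^ 2 ≤ v g ^ 2 := by
    refine mul_le_of_le_one_left hv2 ?_
    have : s ^ 2 ≤ 1 := pow_le_one₀ h1 h3
    have := h.dist_nonneg g
    nlinarith
  linarith

theorem isGapped_chosenChain (h : IsErgodicReversible G P π) (hg : π g ≤ 1 / 2) :
    IsGapped G (chosenChain P π g) (mixState π g) (3 * maxHittingTime P π) := by
  have hH := h.one_le_maxHittingTime hg
  have hD := discriminant_isHermitian (chosenChain P π g)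
  obtain ⟨h1, h2, -, h4⟩ := interpParam_bounds h hg
  have hgap : ∀ (v : V → ℝ) (r : ℝ), v ≠ 0 → discriminant (chosenChain P π g) *ᵥ v = r • v →
      r ≠ 1 → 1 ≤ 3 * maxHittingTime P π * (1 - r) := by
    intro v r hv0 hv hr
    have h5 := sq_le_energy_chosenChain h hg
      (orthogonal_of_eigenvector hD (mixState_fixed h hg) hv hr)
    have h6 := energy_le_two_mul h (damp π g v)
    rw [← energy_chosenChain h hg, energy_of_eigenvector hv] at h6
    have h7 := dotProduct_self_pos hv0
    have h8 := mul_le_mul_of_nonneg_left h6 (zero_le_one.trans hH)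
    have h9 : 1 * (v ⬝ᵥ v) ≤ (3 * maxHittingTime P π * (1 - r)) * (v ⬝ᵥ v) := by linarith
    exact le_of_mul_le_mul_right h9 h7
  have hb := one_div_gap_le (w := fun x => if x = g then 1 - π g else π x)
    (chosenChain_nonneg h hg)
    (fun x => by
      by_cases hx : x = g
      · simp only [hx, if_true]; linarith
      · simp only [hx, if_false]; exact h.pos x)
    (chosenChain_reversible h hg) (by linarith) hgap
  refine ⟨chosenChain_nonneg h hg, chosenChain_on_graph h,
    mixState_fixed h hg, mixState_unit h hg, fun v hv => ?_, fun v r h0 hv hr =>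
    ⟨nonneg_of_form (form_chosenChain_nonneg h hg) h0 hv, hb.2 v r h0 hv hr⟩, hb.1⟩
  have h5 : energy (discriminant P) (damp π g v) = 0 := by
    refine le_antisymm ?_ (h.energy_nonneg _)
    have := energy_le_two_mul h (damp π g v)
    rwa [← energy_chosenChain h hg, energy_of_fixed hv, mul_zero] at this
  obtain ⟨c, hc⟩ := h.eq_smul_of_energy_eq_zero h5
  have hN0 := sqrt_two_mul_pos hg
  refine ⟨c * √(2 * (1 - π g)), ?_⟩
  ext x
  have h6 : damp π g v x = c * √(2 * (1 - π g)) * damp π g (mixState π g) x := by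
    rw [hc, damp_mixState h hg]
    simp only [Pi.smul_apply, smul_eq_mul]
    field_simp
  have h7 : (if x = g then √(1 - interpParam π g) else 1) ≠ 0 := by
    split_ifs
    · exact (Real.sqrt_pos.mpr h2).ne'
    · exact one_ne_zero
  simp only [damp] at h6
  rw [Pi.smul_apply, smul_eq_mul]
  apply mul_left_cancel₀ h7
  rw [h6]; ring

end Interpolated

end WalkChain

/-! ### The walk operator -/

section Walk

variable {V : Type*} [Fintype V] [DecidableEq V]

theorem IsUnitState.star_dotProduct {V : Type*} [Fintype V] {z : V → ℂ} (hz : IsUnitState z) :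
    star z ⬝ᵥ z = 1 := by
  rw [← l2_sq_eq_dotProduct, l2_sq, hz]; simp

theorem zeroProj_conjTranspose {V : Type*} [DecidableEq V] (z : V → ℂ) :
    (zeroProj z)ᴴ = zeroProj z := by
  rw [zeroProj, Matrix.conjTranspose_kronecker, Matrix.conjTranspose_one,
    Matrix.conjTranspose_vecMulVec, star_star]

theorem zeroProj_mul_self {z : V → ℂ} (hz : IsUnitState z) :
    zeroProj z * zeroProj z = zeroProj z := by
  rw [zeroProj, ← Matrix.mul_kronecker_mul, Matrix.one_mul, Matrix.vecMulVec_mul_vecMulVec,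
    hz.star_dotProduct, one_smul]

theorem zeroProj_mulVec_apply (z : V → ℂ) (ψ : V × V → ℂ) (p : V × V) :
    (zeroProj z *ᵥ ψ) p = z p.2 * ∑ y, star (z y) * ψ (p.1, y) := by
  simp only [Matrix.mulVec, dotProduct, zeroProj, Fintype.sum_prod_type, Matrix.kroneckerMap_apply,
    Matrix.one_apply, Matrix.vecMulVec_apply]
  rw [Finset.sum_eq_single p.1, Finset.mul_sum]
  · refine Finset.sum_congr rfl fun y _ => ?_
    simp; ring
  · intro x _ hx
    simp [hx.symm]
  · simp

theorem zeroProj_mulVec_tensor {z : V → ℂ} (hz : IsUnitState z) (a : V → ℂ) :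
    zeroProj z *ᵥ tensor a z = tensor a z := by
  ext p
  rw [zeroProj_mulVec_apply]
  have h : ∑ y, star (z y) * (a p.1 * z y) = a p.1 * (star z ⬝ᵥ z) := by
    rw [dotProduct, Finset.mul_sum]
    exact Finset.sum_congr rfl fun y _ => by simp; ring
  simp only [tensor, h, hz.star_dotProduct]
  ring

theorem zeroReflection_mem_unitary {z : V → ℂ} (hz : IsUnitState z) :
    zeroReflection z ∈ Matrix.unitaryGroup (V × V) ℂ := by
  have hE := zeroProj_mul_self hz
  have h1 : (zeroReflection z)ᴴ = zeroReflection z := by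
    simp [zeroReflection, zeroProj_conjTranspose]
  rw [Matrix.mem_unitaryGroup_iff', Matrix.star_eq_conjTranspose, h1, zeroReflection]
  simp only [Matrix.sub_mul, Matrix.mul_sub, Matrix.smul_mul, Matrix.mul_smul, hE, Matrix.one_mul,
    Matrix.mul_one]
  module

open Classical in
/-- The permutation behind the shift. -/
noncomputable def shiftFun {V : Type*} (G : SimpleGraph V) (q : V × V) : V × V :=
  if G.Adj q.1 q.2 then (q.2, q.1) else q

theorem shiftFun_shiftFun {V : Type*} (G : SimpleGraph V) (q : V × V) :
    shiftFun G (shiftFun G q) = q := by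
  by_cases h : G.Adj q.1 q.2
  · simp [shiftFun, h, h.symm]
  · simp [shiftFun, h]

theorem shift_mulVec_apply (G : SimpleGraph V) (ψ : V × V → ℂ) (p : V × V) :
    (shift G *ᵥ ψ) p = ψ (shiftFun G p) := by
  have h : ∀ q, shift G p q = if q = shiftFun G p then 1 else 0 := by
    intro q
    have : (p = shiftFun G q) ↔ (q = shiftFun G p) :=
      ⟨fun h => by rw [h, shiftFun_shiftFun], fun h => by rw [h, shiftFun_shiftFun]⟩
    simp only [← this]
    rw [shift, shiftFun]
  simp [Matrix.mulVec, dotProduct, h]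

theorem shift_mul_self (G : SimpleGraph V) : shift G * shift G = 1 := by
  apply Matrix.ext_of_mulVec_single
  intro q
  rw [← Matrix.mulVec_mulVec, Matrix.one_mulVec]
  ext p
  rw [shift_mulVec_apply, shift_mulVec_apply, shiftFun_shiftFun]

theorem shift_conjTranspose {V : Type*} [DecidableEq V] (G : SimpleGraph V) :
    (shift G)ᴴ = shift G := by
  ext p q
  have : (q = shiftFun G p) ↔ (p = shiftFun G q) :=
    ⟨fun h => by rw [h, shiftFun_shiftFun], fun h => by rw [h, shiftFun_shiftFun]⟩
  simp only [Matrix.conjTranspose_apply, shift]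
  simp only [shiftFun] at this
  by_cases h : p = if G.Adj q.1 q.2 then (q.2, q.1) else q
  · rw [if_pos h, if_pos (this.mpr h), star_one]
  · rw [if_neg h, if_neg fun h' => h (this.mp h'), star_zero]

theorem shift_mem_unitary (G : SimpleGraph V) : shift G ∈ Matrix.unitaryGroup (V × V) ℂ := by
  rw [Matrix.mem_unitaryGroup_iff', Matrix.star_eq_conjTranspose, shift_conjTranspose,
    shift_mul_self]

theorem walkOp_mem_unitary (G : SimpleGraph V) {z : V → ℂ} (hz : IsUnitState z)
    {A : Matrix (V × V) (V × V) ℂ} (hA : A ∈ Matrix.unitaryGroup (V × V) ℂ) :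
    walkOp G z A ∈ Matrix.unitaryGroup (V × V) ℂ :=
  mul_mem (mul_mem (mul_mem (conjTranspose_mem_unitary hA) (shift_mem_unitary G)) hA)
    (zeroReflection_mem_unitary hz)

theorem tensor_eq_sum (a z : V → ℂ) :
    tensor a z = ∑ x, a x • tensor (Pi.single x 1) z := by
  ext p
  simp [tensor, Finset.sum_apply, Pi.single_apply]

theorem IsStepUnitary.mulVec_tensor {z : V → ℂ} {Q : Matrix V V ℝ}
    {A : Matrix (V × V) (V × V) ℂ} (hA : IsStepUnitary z Q A) (a : V → ℂ) :
    A *ᵥ tensor a z = fun p => a p.1 * (√(Q p.1 p.2) : ℂ) := by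
  rw [tensor_eq_sum, Matrix.mulVec_sum]
  ext p
  simp [Matrix.mulVec_smul, hA.2, tensor, Finset.sum_apply, Pi.single_apply]

/-- The compression of `A† S A` to `|0̄⟩` on the second register is the discriminant. -/
theorem zeroProj_mulVec_step (G : SimpleGraph V) {z : V → ℂ} {Q : Matrix V V ℝ}
    (hQ : ∀ x y, 0 ≤ Q x y) (hG : ∀ x y, Q x y ≠ 0 → x = y ∨ G.Adj x y)
    {A : Matrix (V × V) (V × V) ℂ} (hA : IsStepUnitary z Q A) (a : V → ℂ) :
    zeroProj z *ᵥ ((Aᴴ * shift G * A) *ᵥ tensor a z) =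
      tensor ((discriminant Q).map (algebraMap ℝ ℂ) *ᵥ a) z := by
  ext ⟨x, y⟩
  rw [zeroProj_mulVec_apply]
  set ξ := (Aᴴ * shift G * A) *ᵥ tensor a z with hξ
  have h1 : ∑ y', star (z y') * ξ (x, y') = star (tensor (Pi.single x 1) z) ⬝ᵥ ξ := by
    symm
    rw [dotProduct, Fintype.sum_prod_type, Finset.sum_eq_single x]
    · simp [tensor]
    · intro x' _ hx'
      simp [tensor, hx']
    · simp
  have h2 : star (tensor (Pi.single x 1) z) ⬝ᵥ ξ =
      star (A *ᵥ tensor (Pi.single x 1) z) ⬝ᵥ (shift G *ᵥ (A *ᵥ tensor a z)) := by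
    rw [hξ, Matrix.star_mulVec, ← Matrix.dotProduct_mulVec, Matrix.mulVec_mulVec,
      Matrix.mulVec_mulVec, Matrix.mul_assoc]
  have h3 : star (A *ᵥ tensor (Pi.single x 1) z) ⬝ᵥ (shift G *ᵥ (A *ᵥ tensor a z)) =
      ((discriminant Q).map (algebraMap ℝ ℂ) *ᵥ a) x := by
    rw [hA.mulVec_tensor, hA.mulVec_tensor, dotProduct, Fintype.sum_prod_type,
      Finset.sum_eq_single x]
    · rw [Matrix.mulVec, dotProduct]
      refine Finset.sum_congr rfl fun y' _ => ?_
      rw [shift_mulVec_apply]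
      simp only [Pi.star_apply, Pi.single_eq_same, one_mul, Matrix.map_apply, discriminant]
      rw [Real.sqrt_mul (hQ x y')]
      by_cases h0 : Q x y' = 0
      · simp [h0]
      · by_cases hadj : G.Adj x y'
        · simp [shiftFun, hadj]; ring
        · have he := (hG x y' h0).resolve_right hadj
          subst he
          simp [shiftFun]; ring
    · intro x' _ hx'
      simp [hx']
    · simp
  rw [h1, h2, h3, tensor, mul_comm]

theorem tensor_add {V : Type*} (a b z : V → ℂ) : tensor (a + b) z = tensor a z + tensor b z := by
  ext p; simp [tensor, add_mul]

theorem tensor_sub {V : Type*} (a b z : V → ℂ) : tensor (a - b) z = tensor a z - tensor b z := by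
  ext p; simp [tensor, sub_mul]

theorem tensor_smul {V : Type*} (c : ℂ) (a z : V → ℂ) : tensor (c • a) z = c • tensor a z := by
  ext p; simp [tensor, mul_assoc]

/-- The three-term recurrence of the walk, which makes its powers act by Chebyshev polynomials:
`W² E = 2 W (E U E) - E` for the involution `U = A† S A` and the projection `E` on `|0̄⟩`. -/
theorem walkOp_sq_mulVec (G : SimpleGraph V) {z : V → ℂ} (hz : IsUnitState z) {Q : Matrix V V ℝ}
    (hQ : ∀ x y, 0 ≤ Q x y) (hG : ∀ x y, Q x y ≠ 0 → x = y ∨ G.Adj x y)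
    {A : Matrix (V × V) (V × V) ℂ} (hA : IsStepUnitary z Q A) (a : V → ℂ) :
    walkOp G z A *ᵥ (walkOp G z A *ᵥ tensor a z) = (2 : ℂ) • (walkOp G z A *ᵥ
      tensor ((discriminant Q).map (algebraMap ℝ ℂ) *ᵥ a) z) - tensor a z := by
  set U := Aᴴ * shift G * A with hU
  have hUU : U * U = 1 := by
    have h1 := unitary_conjTranspose_mul hA.1
    have h2 := unitary_mul_conjTranspose hA.1
    calc U * U = Aᴴ * shift G * (A * Aᴴ) * shift G * A := by simp only [hU, Matrix.mul_assoc]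
      _ = Aᴴ * (shift G * shift G) * A := by rw [h2]; simp only [Matrix.mul_assoc, Matrix.one_mul]
      _ = 1 := by rw [shift_mul_self, Matrix.mul_one, h1]
  have hR : ∀ b, zeroReflection z *ᵥ tensor b z = tensor b z := by
    intro b
    rw [zeroReflection, Matrix.sub_mulVec, Matrix.smul_mulVec, zeroProj_mulVec_tensor hz,
      Matrix.one_mulVec]
    module
  have hW : ∀ b, walkOp G z A *ᵥ tensor b z = U *ᵥ tensor b z := by
    intro b
    rw [walkOp, ← Matrix.mulVec_mulVec, hR]
  rw [hW, hW, walkOp, ← hU, ← Matrix.mulVec_mulVec, zeroReflection, Matrix.sub_mulVec,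
    Matrix.smul_mulVec, zeroProj_mulVec_step G hQ hG hA, Matrix.one_mulVec, Matrix.mulVec_sub,
    Matrix.mulVec_smul, Matrix.mulVec_mulVec, hUU, Matrix.one_mulVec]

theorem zeroProj_walkOp_pow (G : SimpleGraph V) {z : V → ℂ} (hz : IsUnitState z)
    {Q : Matrix V V ℝ} (hQ : ∀ x y, 0 ≤ Q x y) (hG : ∀ x y, Q x y ≠ 0 → x = y ∨ G.Adj x y)
    {A : Matrix (V × V) (V × V) ℂ} (hA : IsStepUnitary z Q A) (l : ℕ) :
    (∀ a, zeroProj z *ᵥ (walkOp G z A ^ l *ᵥ tensor a z) = tensor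
      ((Polynomial.aeval (discriminant Q) (Polynomial.Chebyshev.T ℝ (l : ℤ))).map
        (algebraMap ℝ ℂ) *ᵥ a) z) ∧
    ∀ a, zeroProj z *ᵥ (walkOp G z A ^ (l + 1) *ᵥ tensor a z) = tensor
      ((Polynomial.aeval (discriminant Q) (Polynomial.Chebyshev.T ℝ ((l : ℤ) + 1))).map
        (algebraMap ℝ ℂ) *ᵥ a) z := by
  induction l with
  | zero =>
    refine ⟨fun a => ?_, fun a => ?_⟩
    · have : (1 : Matrix V V ℝ).map (algebraMap ℝ ℂ) = 1 := by simp
      simp only [pow_zero, Matrix.one_mulVec, zeroProj_mulVec_tensor hz, Nat.cast_zero,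
        Polynomial.Chebyshev.T_zero, map_one, this]
    · have hR : zeroReflection z *ᵥ tensor a z = tensor a z := by
        rw [zeroReflection, Matrix.sub_mulVec, Matrix.smul_mulVec, zeroProj_mulVec_tensor hz,
          Matrix.one_mulVec]
        module
      simp only [Nat.cast_zero, zero_add, pow_one, Polynomial.Chebyshev.T_one, Polynomial.aeval_X]
      rw [walkOp, ← Matrix.mulVec_mulVec, hR, zeroProj_mulVec_step G hQ hG hA]
  | succ l ih =>
    refine ⟨fun a => by simpa using ih.2 a, fun a => ?_⟩
    have hT : Polynomial.aeval (discriminant Q) (Polynomial.Chebyshev.T ℝ ((l : ℤ) + 2)) =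
        (2 : ℝ) • (Polynomial.aeval (discriminant Q) (Polynomial.Chebyshev.T ℝ ((l : ℤ) + 1)) *
          discriminant Q) -
          Polynomial.aeval (discriminant Q) (Polynomial.Chebyshev.T ℝ (l : ℤ)) := by
      rw [Polynomial.Chebyshev.T_add_two, mul_comm (2 * Polynomial.X), mul_comm 2 Polynomial.X,
        ← mul_assoc, map_sub, map_mul, map_mul, Polynomial.aeval_X, map_ofNat, two_smul, mul_two]
    have hM : ((2 : ℝ) • (Polynomial.aeval (discriminant Q)
          (Polynomial.Chebyshev.T ℝ ((l : ℤ) + 1)) * discriminant Q) -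
          Polynomial.aeval (discriminant Q) (Polynomial.Chebyshev.T ℝ (l : ℤ))).map
          (algebraMap ℝ ℂ) = (2 : ℂ) • ((Polynomial.aeval (discriminant Q)
          (Polynomial.Chebyshev.T ℝ ((l : ℤ) + 1))).map (algebraMap ℝ ℂ) *
          (discriminant Q).map (algebraMap ℝ ℂ)) -
          (Polynomial.aeval (discriminant Q) (Polynomial.Chebyshev.T ℝ (l : ℤ))).map
          (algebraMap ℝ ℂ) := by
      rw [← Matrix.map_mul]
      ext x y
      simp
    have e : walkOp G z A ^ (l + 1 + 1) *ᵥ tensor a z = (2 : ℂ) • (walkOp G z A ^ (l + 1) *ᵥ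
        tensor ((discriminant Q).map (algebraMap ℝ ℂ) *ᵥ a) z) -
        walkOp G z A ^ l *ᵥ tensor a z := by
      rw [pow_succ, pow_succ, Matrix.mul_assoc, ← Matrix.mulVec_mulVec, ← Matrix.mulVec_mulVec,
        walkOp_sq_mulVec G hz hQ hG hA, Matrix.mulVec_sub, Matrix.mulVec_smul,
        Matrix.mulVec_mulVec]
    rw [e, Matrix.mulVec_sub, Matrix.mulVec_smul, ih.2, ih.1, ← tensor_smul, ← tensor_sub]
    rw [show ((l + 1 : ℕ) : ℤ) + 1 = (l : ℤ) + 2 by push_cast; ring, hT, hM, Matrix.sub_mulVec,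
      Matrix.smul_mulVec, Matrix.mulVec_mulVec]

end Walk

/-! ### Unitarity of the gates -/

section Gates

variable {V : Type*} [Fintype V] [DecidableEq V] {Q : Type*} [Fintype Q] [DecidableEq Q]

theorem blockOp_conjTranspose {V Q : Type*} [DecidableEq Q]
    (F : (Q → Bool) → Matrix (V × V) (V × V) ℂ)
    [Fintype Q] : (blockOp F)ᴴ = blockOp fun b => (F b)ᴴ := by
  ext p q
  by_cases h : p.2 = q.2
  · simp [blockOp, h]
  · have h' : q.2 ≠ p.2 := fun e => h e.symm
    simp [blockOp, h, h']

theorem controlled_conjTranspose (W : Matrix (V × V) (V × V) ℂ) (q : Q) :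
    (controlled W q)ᴴ = controlled Wᴴ q := by
  rw [controlled, controlled, blockOp_conjTranspose]
  congr 1
  funext b
  split_ifs <;> simp

theorem controlled_mem_unitary {W : Matrix (V × V) (V × V) ℂ}
    (hW : W ∈ Matrix.unitaryGroup (V × V) ℂ) (q : Q) :
    controlled W q ∈ Matrix.unitaryGroup ((V × V) × (Q → Bool)) ℂ := by
  rw [Matrix.mem_unitaryGroup_iff', Matrix.star_eq_conjTranspose, controlled_conjTranspose,
    controlled, controlled, blockOp_mul, ← blockOp_one]
  congr 1
  funext b
  split_ifs
  · exact unitary_conjTranspose_mul hW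
  · exact Matrix.one_mul 1

theorem Gate.toOp_inv (a : Gate V Q) : a.inv.toOp = a.toOpᴴ := by
  cases a with
  | free U => rfl
  | call W q => exact (controlled_conjTranspose W q).symm
  | callInv W q =>
    rw [Gate.inv, Gate.toOp, Gate.toOp, controlled_conjTranspose,
      Matrix.conjTranspose_conjTranspose]

theorem circuitOp_inv (c : Circuit V Q) : circuitOp (circuitInv c) = (circuitOp c)ᴴ := by
  induction c with
  | nil => simp [circuitInv, circuitOp]
  | cons a c ih =>
    rw [circuitInv, List.map_cons, List.reverse_cons, circuitOp_append, ← circuitInv, ih]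
    simp [circuitOp, Gate.toOp_inv, Matrix.conjTranspose_mul]

theorem circuitOp_mem_unitary {c : Circuit V Q}
    (h : ∀ a ∈ c, a.toOp ∈ Matrix.unitaryGroup ((V × V) × (Q → Bool)) ℂ) :
    circuitOp c ∈ Matrix.unitaryGroup ((V × V) × (Q → Bool)) ℂ := by
  induction c with
  | nil => exact one_mem _
  | cons a c ih =>
    exact mul_mem (ih fun x hx => h x (List.mem_cons_of_mem _ hx)) (h a List.mem_cons_self)

/-- A bit string with the bit at `q` flipped. -/
def flipBit (q : Q) (b : Q → Bool) : Q → Bool := Function.update b q (!b q)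

theorem flipBit_flipBit (q : Q) (b : Q → Bool) : flipBit q (flipBit q b) = b := by
  simp [flipBit]

theorem flipBit_same (q : Q) (b : Q → Bool) : flipBit q b q = !b q := by simp [flipBit]

theorem flipBit_of_ne {q q' : Q} (h : q' ≠ q) (b : Q → Bool) : flipBit q b q' = b q' := by
  simp [flipBit, h]

/-- `X` on qubit `q`, as an operator on the ancilla register. -/
def bitFlip (q : Q) : Matrix (Q → Bool) (Q → Bool) ℂ :=
  Matrix.of fun b b' => if b = flipBit q b' then 1 else 0

theorem notOp_eq (q : Q) : (notOp q : Op V Q) = (1 : Matrix (V × V) (V × V) ℂ) ⊗ₖ bitFlip q := rfl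

theorem eq_flipBit_comm (q : Q) (b b' : Q → Bool) : b = flipBit q b' ↔ b' = flipBit q b :=
  ⟨fun h => by rw [h, flipBit_flipBit], fun h => by rw [h, flipBit_flipBit]⟩

theorem bitFlip_conjTranspose (q : Q) : (bitFlip q)ᴴ = bitFlip q := by
  ext b b'
  simp only [bitFlip, Matrix.conjTranspose_apply, Matrix.of_apply, eq_flipBit_comm q b b']
  split_ifs <;> simp

theorem bitFlip_mulVec_single (q : Q) (b : Q → Bool) :
    bitFlip q *ᵥ Pi.single b 1 = Pi.single (flipBit q b) 1 := by
  rw [Matrix.mulVec_single_one]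
  ext b'
  simp [bitFlip, Matrix.col, Pi.single_apply]

theorem bitFlip_mul_self (q : Q) : bitFlip q * bitFlip q = 1 := by
  apply Matrix.ext_of_mulVec_single
  intro b
  rw [← Matrix.mulVec_mulVec, bitFlip_mulVec_single, bitFlip_mulVec_single, flipBit_flipBit,
    Matrix.one_mulVec]

theorem notOp_conjTranspose (q : Q) : (notOp q : Op V Q)ᴴ = notOp q := by
  rw [notOp_eq, Matrix.conjTranspose_kronecker, Matrix.conjTranspose_one, bitFlip_conjTranspose]

theorem notOp_mem_unitary (q : Q) :
    (notOp q : Op V Q) ∈ Matrix.unitaryGroup ((V × V) × (Q → Bool)) ℂ := by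
  rw [Matrix.mem_unitaryGroup_iff', Matrix.star_eq_conjTranspose, notOp_conjTranspose, notOp_eq,
    ← Matrix.mul_kronecker_mul, bitFlip_mul_self, Matrix.one_mul, Matrix.one_kronecker_one]

theorem phaseOp_mem_unitary (q : Q) (α : ℝ) :
    (phaseOp q α : Op V Q) ∈ Matrix.unitaryGroup ((V × V) × (Q → Bool)) ℂ := by
  have h : Complex.exp (α * Complex.I) * (starRingEnd ℂ) (Complex.exp (α * Complex.I)) = 1 := by
    rw [Complex.mul_conj, Complex.normSq_eq_norm_sq, Complex.norm_exp_ofReal_mul_I]; simp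
  rw [Matrix.mem_unitaryGroup_iff, Matrix.star_eq_conjTranspose, phaseOp,
    Matrix.conjTranspose_kronecker, Matrix.conjTranspose_one, ← Matrix.mul_kronecker_mul,
    Matrix.diagonal_conjTranspose, Matrix.diagonal_mul_diagonal, Matrix.one_mul]
  have : (fun b : Q → Bool => (if b q then Complex.exp (α * Complex.I) else 1) *
      (star fun b : Q → Bool => if b q then Complex.exp (α * Complex.I) else 1) b) =
        fun _ => 1 := by
    funext b
    rw [Pi.star_apply]
    split_ifs
    · exact h
    · simp
  rw [this, Matrix.diagonal_one, Matrix.one_kronecker_one]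

/-- The projection on `|0̄⟩` in `R₂` and zeros on the ancilla qubits in `S`. -/
def controlProj (z : V → ℂ) (S : Finset Q) : Op V Q := zeroProj z ⊗ₖ allZero S

theorem controlProj_conjTranspose (z : V → ℂ) (S : Finset Q) :
    (controlProj z S)ᴴ = controlProj z S := by
  have : (allZero S)ᴴ = allZero S := by
    rw [allZero, Matrix.diagonal_conjTranspose]
    congr 1
    funext b
    rw [Pi.star_apply]
    split_ifs <;> simp
  rw [controlProj, Matrix.conjTranspose_kronecker, zeroProj_conjTranspose, this]

theorem allZero_mul_self (S : Finset Q) : allZero S * allZero S = allZero S := by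
  rw [allZero, Matrix.diagonal_mul_diagonal]
  congr 1
  funext b
  split_ifs <;> simp

theorem controlProj_mul_self {z : V → ℂ} (hz : IsUnitState z) (S : Finset Q) :
    controlProj z S * controlProj z S = controlProj z S := by
  rw [controlProj, ← Matrix.mul_kronecker_mul, zeroProj_mul_self hz, allZero_mul_self]

theorem controlProj_mul_notOp (z : V → ℂ) {S : Finset Q} {q : Q} (hq : q ∉ S) :
    controlProj z S * notOp q = notOp q * controlProj z S := by
  have : allZero S * bitFlip q = bitFlip q * allZero S := by
    ext b b'
    rw [allZero, Matrix.diagonal_mul, Matrix.mul_diagonal]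
    by_cases h : b = flipBit q b'
    · have : (∀ x ∈ S, b x = false) ↔ ∀ x ∈ S, b' x = false := by
        refine forall₂_congr fun x hx => ?_
        have hxq : x ≠ q := fun e => hq (e ▸ hx)
        rw [h, flipBit_of_ne hxq]
      simp only [this]
      ring
    · simp [bitFlip, h]
  rw [controlProj, notOp_eq, ← Matrix.mul_kronecker_mul, ← Matrix.mul_kronecker_mul, this,
    Matrix.one_mul, Matrix.mul_one]

theorem controlProj_mul_phaseOp (z : V → ℂ) (S : Finset Q) (q : Q) (α : ℝ) :
    controlProj z S * phaseOp q α = phaseOp q α * controlProj z S := by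
  rw [controlProj, phaseOp, ← Matrix.mul_kronecker_mul, ← Matrix.mul_kronecker_mul,
    Matrix.one_mul, Matrix.mul_one, allZero, Matrix.diagonal_mul_diagonal,
    Matrix.diagonal_mul_diagonal]
  congr 2
  funext b
  ring

theorem zeroControlled_mem_unitary {z : V → ℂ} (hz : IsUnitState z) {S : Finset Q} {U : Op V Q}
    (hU : U ∈ Matrix.unitaryGroup ((V × V) × (Q → Bool)) ℂ)
    (hc : controlProj z S * U = U * controlProj z S) :
    zeroControlled z S U ∈ Matrix.unitaryGroup ((V × V) × (Q → Bool)) ℂ :=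
  conditional_mem_unitary hU (controlProj_conjTranspose z S) (controlProj_mul_self hz S) hc

theorem zeroControlled_notOp_mem_unitary {z : V → ℂ} (hz : IsUnitState z) {S : Finset Q} {q : Q}
    (hq : q ∉ S) :
    zeroControlled z S (notOp q) ∈ Matrix.unitaryGroup ((V × V) × (Q → Bool)) ℂ :=
  zeroControlled_mem_unitary hz (notOp_mem_unitary q) (controlProj_mul_notOp z hq)

theorem zeroControlled_notOp_conjTranspose (z : V → ℂ) {S : Finset Q} {q : Q} (hq : q ∉ S) :
    (zeroControlled z S (notOp q))ᴴ = zeroControlled z S (notOp q) := by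
  have h := controlProj_mul_notOp z hq
  have h' := controlProj_conjTranspose z S
  rw [controlProj] at h h'
  rw [zeroControlled, Matrix.conjTranspose_add, Matrix.conjTranspose_mul, Matrix.conjTranspose_sub,
    Matrix.conjTranspose_one, h', notOp_conjTranspose, h]

theorem startPhase_mem_unitary {z : V → ℂ} (hz : IsUnitState z) (g : V) (S : Finset Q) (α : ℝ) :
    (startPhase z g S α : Op V Q) ∈ Matrix.unitaryGroup ((V × V) × (Q → Bool)) ℂ := by
  set t := tensor (Pi.single g 1) z with ht
  have htt : star t ⬝ᵥ t = 1 := by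
    rw [← hz.star_dotProduct, dotProduct, Fintype.sum_prod_type, Finset.sum_eq_single g]
    · simp [ht, tensor, dotProduct]
    · intro x _ hx
      simp [ht, tensor, hx]
    · simp
  set E : Op V Q := Matrix.vecMulVec t (star t) ⊗ₖ allZero S with hE
  have hEE : E * E = E := by
    rw [hE, ← Matrix.mul_kronecker_mul, Matrix.vecMulVec_mul_vecMulVec, htt, one_smul,
      allZero_mul_self]
  have hEs : Eᴴ = E := by
    have : (allZero S)ᴴ = allZero S := by
      rw [allZero, Matrix.diagonal_conjTranspose]
      congr 1
      funext b
      rw [Pi.star_apply]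
      split_ifs <;> simp
    rw [hE, Matrix.conjTranspose_kronecker, Matrix.conjTranspose_vecMulVec, star_star, this]
  have h : (starRingEnd ℂ) (Complex.exp (α * Complex.I)) * Complex.exp (α * Complex.I) = 1 := by
    rw [mul_comm, Complex.mul_conj, Complex.normSq_eq_norm_sq, Complex.norm_exp_ofReal_mul_I]; simp
  rw [Matrix.mem_unitaryGroup_iff', Matrix.star_eq_conjTranspose, startPhase, ← ht, ← hE,
    Matrix.conjTranspose_add, Matrix.conjTranspose_one, Matrix.conjTranspose_smul, hEs,
    Matrix.add_mul, Matrix.mul_add, Matrix.mul_add, Matrix.one_mul, Matrix.one_mul, Matrix.mul_one,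
    Matrix.smul_mul, Matrix.mul_smul, hEE, smul_smul, add_assoc, ← add_smul, ← add_smul]
  have h0 : Complex.exp (α * Complex.I) - 1 + (star (Complex.exp (α * Complex.I) - 1) +
      star (Complex.exp (α * Complex.I) - 1) * (Complex.exp (α * Complex.I) - 1)) = 0 := by
    rw [star_sub, star_one, RCLike.star_def]
    linear_combination h
  rw [h0, zero_smul, add_zero]

/-! ### Action of the gates on the states `|a⟩|0̄⟩|b⟩` -/

/-- `f ⊗ |b⟩`. -/
def withBits (b : Q → Bool) (f : V × V → ℂ) : (V × V) × (Q → Bool) → ℂ :=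
  fun p => f p.1 * (Pi.single b 1 : (Q → Bool) → ℂ) p.2

/-- The state `|a⟩|0̄⟩|b⟩`. -/
def regState (z : V → ℂ) (b : Q → Bool) (a : V → ℂ) : (V × V) × (Q → Bool) → ℂ :=
  withBits b (tensor a z)

theorem startState_eq (z : V → ℂ) (g : V) :
    (startState z g : (V × V) × (Q → Bool) → ℂ) =
      regState z (fun _ => false) (Pi.single g 1) := by
  ext p
  simp only [startState, regState, withBits, Pi.single_apply, funext_iff]

theorem withBits_add (b : Q → Bool) (f h : V × V → ℂ) :
    withBits b (f + h) = withBits b f + withBits b h := by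
  ext p; simp [withBits, add_mul]

theorem withBits_sub (b : Q → Bool) (f h : V × V → ℂ) :
    withBits b (f - h) = withBits b f - withBits b h := by
  ext p; simp [withBits, sub_mul]

theorem withBits_smul (b : Q → Bool) (c : ℂ) (f : V × V → ℂ) :
    withBits b (c • f) = c • withBits b f := by
  ext p; simp [withBits, mul_assoc]

theorem regState_add (z : V → ℂ) (b : Q → Bool) (a a' : V → ℂ) :
    regState z b (a + a') = regState z b a + regState z b a' := by
  rw [regState, tensor_add, withBits_add]; rfl

theorem regState_sub (z : V → ℂ) (b : Q → Bool) (a a' : V → ℂ) :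
    regState z b (a - a') = regState z b a - regState z b a' := by
  rw [regState, tensor_sub, withBits_sub]; rfl

theorem regState_smul (z : V → ℂ) (b : Q → Bool) (c : ℂ) (a : V → ℂ) :
    regState z b (c • a) = c • regState z b a := by
  rw [regState, tensor_smul, withBits_smul]; rfl

theorem l2_regState {z : V → ℂ} (hz : IsUnitState z) (b : Q → Bool) (a : V → ℂ) :
    l2 (regState z b a) = l2 a := by
  rw [← sq_eq_sq₀ (l2_nonneg _) (l2_nonneg _), l2_sq, l2_sq, Fintype.sum_prod_type,
    Fintype.sum_prod_type]
  refine Finset.sum_congr rfl fun x _ => ?_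
  have hz' : ∑ y, ‖z y‖ ^ 2 = 1 := hz
  rw [← mul_one (‖a x‖ ^ 2), ← hz', Finset.mul_sum]
  refine Finset.sum_congr rfl fun y _ => ?_
  rw [Finset.sum_eq_single b]
  · simp [regState, withBits, tensor, mul_pow]
  · intro b' _ hb'
    simp [regState, withBits, hb']
  · simp

theorem kronecker_mulVec_withBits (M : Matrix (V × V) (V × V) ℂ)
    (N : Matrix (Q → Bool) (Q → Bool) ℂ) (b : Q → Bool) (f : V × V → ℂ) :
    (M ⊗ₖ N) *ᵥ withBits b f = fun p => (M *ᵥ f) p.1 * N p.2 b := by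
  ext p
  rw [Matrix.mulVec, dotProduct, Fintype.sum_prod_type]
  simp only [Matrix.mulVec, dotProduct, Finset.sum_mul]
  refine Finset.sum_congr rfl fun q _ => ?_
  rw [Finset.sum_eq_single b]
  · simp [withBits]; ring
  · intro b' _ hb'
    simp [withBits, hb']
  · simp

theorem notOp_mulVec_regState (q : Q) (z : V → ℂ) (b : Q → Bool) (a : V → ℂ) :
    notOp q *ᵥ regState z b a = regState z (flipBit q b) a := by
  rw [notOp_eq, regState, kronecker_mulVec_withBits, Matrix.one_mulVec]
  ext p
  simp [regState, withBits, bitFlip, Pi.single_apply]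

theorem phaseOp_mulVec_regState (q : Q) (α : ℝ) (z : V → ℂ) {b : Q → Bool} (hb : b q = true)
    (a : V → ℂ) :
    phaseOp q α *ᵥ regState z b a = Complex.exp (α * Complex.I) • regState z b a := by
  rw [phaseOp, regState, kronecker_mulVec_withBits, Matrix.one_mulVec]
  ext p
  by_cases h : p.2 = b
  · simp [withBits, h, hb]; ring
  · simp [withBits, h]

theorem controlProj_mulVec_withBits (z : V → ℂ) (S : Finset Q) (b : Q → Bool) (f : V × V → ℂ) :
    controlProj z S *ᵥ withBits b f =
      if ∀ q ∈ S, b q = false then withBits b (zeroProj z *ᵥ f) else 0 := by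
  rw [controlProj, kronecker_mulVec_withBits]
  ext p
  by_cases h : p.2 = b
  · by_cases hS : ∀ q ∈ S, b q = false
    · rw [if_pos hS]
      simp only [allZero, h, Matrix.diagonal_apply_eq, if_pos hS, withBits, Pi.single_eq_same]
    · rw [if_neg hS]
      simp only [allZero, h, Matrix.diagonal_apply_eq, if_neg hS, mul_zero, Pi.zero_apply]
  · split_ifs <;> simp [allZero, withBits, h]

theorem controlProj_mulVec_regState {z : V → ℂ} (hz : IsUnitState z) {S : Finset Q}
    {b : Q → Bool} (hb : ∀ q ∈ S, b q = false) (a : V → ℂ) :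
    controlProj z S *ᵥ regState z b a = regState z b a := by
  rw [regState, controlProj_mulVec_withBits, if_pos hb, zeroProj_mulVec_tensor hz]

theorem zeroControlled_mulVec {z : V → ℂ} {S : Finset Q} {U : Op V Q}
    (hc : controlProj z S * U = U * controlProj z S) (ξ : (V × V) × (Q → Bool) → ℂ) :
    zeroControlled z S U *ᵥ ξ =
      ξ + (U *ᵥ (controlProj z S *ᵥ ξ) - controlProj z S *ᵥ ξ) := by
  rw [zeroControlled, ← controlProj, hc, Matrix.add_mulVec, Matrix.sub_mulVec, Matrix.one_mulVec,
    ← Matrix.mulVec_mulVec]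
  abel

theorem zeroControlled_empty_notOp_mulVec {z : V → ℂ} (hz : IsUnitState z) (q : Q) (b : Q → Bool)
    (a : V → ℂ) : zeroControlled z ∅ (notOp q) *ᵥ regState z b a = regState z (flipBit q b) a := by
  rw [zeroControlled_mulVec (controlProj_mul_notOp z (by simp)),
    controlProj_mulVec_regState hz (by simp), notOp_mulVec_regState]
  abel

theorem startPhase_mulVec_regState {z : V → ℂ} (hz : IsUnitState z) (g : V) (S : Finset Q) (α : ℝ)
    (b : Q → Bool) (a : V → ℂ) : startPhase z g S α *ᵥ regState z b a =
      if ∀ q ∈ S, b q = false then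
        regState z b (a + ((Complex.exp (α * Complex.I) - 1) * a g) • Pi.single g 1)
      else regState z b a := by
  have hdot : star (tensor (Pi.single g 1) z) ⬝ᵥ tensor a z = a g := by
    rw [dotProduct, Fintype.sum_prod_type, Finset.sum_eq_single g]
    · have : ∑ y, star (z y) * (a g * z y) = a g * (star z ⬝ᵥ z) := by
        rw [dotProduct, Finset.mul_sum]
        exact Finset.sum_congr rfl fun y _ => by simp; ring
      rw [hz.star_dotProduct, mul_one] at this
      simpa [tensor] using this
    · intro x _ hx
      simp [tensor, hx]
    · simp
  have h : (Matrix.vecMulVec (tensor (Pi.single g 1) z) (star (tensor (Pi.single g 1) z)) ⊗ₖ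
      allZero S) *ᵥ regState z b a =
      if ∀ q ∈ S, b q = false then regState z b (a g • Pi.single g 1) else 0 := by
    rw [regState, kronecker_mulVec_withBits, Matrix.vecMulVec_mulVec, hdot]
    ext p
    by_cases hp : p.2 = b
    · by_cases hS : ∀ q ∈ S, b q = false
      · rw [if_pos hS]
        simp only [allZero, hp, Matrix.diagonal_apply_eq, if_pos hS, regState, withBits,
          Pi.single_eq_same, tensor_smul, Pi.smul_apply, smul_eq_mul, MulOpposite.smul_eq_mul_unop,
          MulOpposite.unop_op]
        ring
      · rw [if_neg hS]
        simp only [allZero, hp, Matrix.diagonal_apply_eq, if_neg hS, mul_zero, Pi.zero_apply]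
    · split_ifs <;> simp [allZero, regState, withBits, hp]
  rw [startPhase, Matrix.add_mulVec, Matrix.one_mulVec, Matrix.smul_mulVec, h]
  split_ifs
  · rw [regState_add, mul_smul, regState_smul z b (Complex.exp _ - 1)]
  · simp

end Gates

/-! ### Fast-forwarding -/

section FastForward

variable {V : Type*} [Fintype V] [DecidableEq V] {Q : Type*} [Fintype Q] [DecidableEq Q]
  {τ : ℕ} {r : Fin τ → Q}

theorem extend_comp (hr : Function.Injective r) (c : Fin τ → Bool) (b : Q → Bool) :
    Function.extend r c b ∘ r = c := Function.extend_comp hr c b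

theorem eq_extend_iff (hr : Function.Injective r) (c : Fin τ → Bool) (b b' : Q → Bool) :
    b' = Function.extend r c b ↔ (∀ q, (∀ i, r i ≠ q) → b' q = b q) ∧ b' ∘ r = c := by
  constructor
  · rintro rfl
    exact ⟨fun q hq => Function.extend_apply' _ _ _ fun ⟨i, hi⟩ => hq i hi, extend_comp hr c b⟩
  · rintro ⟨h1, rfl⟩
    funext q
    by_cases hq : ∃ i, r i = q
    · obtain ⟨i, rfl⟩ := hq
      rw [hr.extend_apply]; rfl
    · rw [Function.extend_apply' _ _ _ hq, h1 q fun i hi => hq ⟨i, hi⟩]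

theorem extend_extend (hr : Function.Injective r) (c c' : Fin τ → Bool) (b : Q → Bool) :
    Function.extend r c' (Function.extend r c b) = Function.extend r c' b := by
  symm
  rw [eq_extend_iff hr]
  refine ⟨fun q hq => ?_, extend_comp hr _ _⟩
  have : ¬∃ i, r i = q := fun ⟨i, hi⟩ => hq i hi
  rw [Function.extend_apply' _ _ _ this, Function.extend_apply' _ _ _ this]

/-- An operator on a register acts on the bits of that register only. -/
theorem onRegister_mulVec_withBits (hr : Function.Injective r)
    (U : Matrix (Fin τ → Bool) (Fin τ → Bool) ℂ) (b : Q → Bool) (f : V × V → ℂ) :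
    onRegister r U *ᵥ withBits b f =
      ∑ c, U c (b ∘ r) • withBits (Function.extend r c b) f := by
  rw [onRegister, kronecker_mulVec_withBits, Matrix.one_mulVec]
  ext p
  simp only [Matrix.of_apply, Finset.sum_apply, Pi.smul_apply, withBits, Pi.single_apply,
    eq_extend_iff hr, smul_eq_mul, mul_ite, mul_one, mul_zero]
  by_cases h : ∀ q, (∀ i, r i ≠ q) → p.2 q = b q
  · rw [if_pos h, Finset.sum_eq_single (p.2 ∘ r)]
    · rw [if_pos ⟨h, rfl⟩, mul_comm]
    · intro c _ hc
      exact if_neg fun h' => hc h'.2.symm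
    · simp
  · rw [if_neg h]
    exact (Finset.sum_eq_zero fun c _ => if_neg fun h' => h h'.1).symm

theorem ext_of_mulVec_withBits {M N : Op V Q}
    (h : ∀ b (f : V × V → ℂ), M *ᵥ withBits b f = N *ᵥ withBits b f) : M = N := by
  apply Matrix.ext_of_mulVec_single
  rintro ⟨p, b⟩
  have : (Pi.single (p, b) 1 : (V × V) × (Q → Bool) → ℂ) = withBits b (Pi.single p 1) := by
    ext q
    by_cases h1 : q.1 = p <;> by_cases h2 : q.2 = b <;>
      simp [withBits, Pi.single_apply, h1, h2, Prod.ext_iff]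
  rw [this, h]

theorem onRegister_mul (hr : Function.Injective r)
    (U U' : Matrix (Fin τ → Bool) (Fin τ → Bool) ℂ) :
    (onRegister r U * onRegister r U' : Op V Q) = onRegister r (U * U') := by
  refine ext_of_mulVec_withBits fun b f => ?_
  rw [← Matrix.mulVec_mulVec, onRegister_mulVec_withBits hr, onRegister_mulVec_withBits hr,
    Matrix.mulVec_sum]
  simp only [Matrix.mulVec_smul, onRegister_mulVec_withBits hr, extend_comp hr, extend_extend hr,
    Finset.smul_sum, smul_smul]
  rw [Finset.sum_comm]
  refine Finset.sum_congr rfl fun c _ => ?_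
  rw [← Finset.sum_smul, Matrix.mul_apply]
  congr 1
  exact Finset.sum_congr rfl fun c' _ => mul_comm _ _

theorem onRegister_one (hr : Function.Injective r) : (onRegister r 1 : Op V Q) = 1 := by
  refine ext_of_mulVec_withBits fun b f => ?_
  rw [onRegister_mulVec_withBits hr, Matrix.one_mulVec, Finset.sum_eq_single (b ∘ r)]
  · rw [Matrix.one_apply_eq, one_smul, ← (eq_extend_iff hr (b ∘ r) b b).mpr ⟨fun _ _ => rfl, rfl⟩]
  · intro c _ hc
    rw [Matrix.one_apply_ne hc, zero_smul]
  · simp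

theorem onRegister_conjTranspose (U : Matrix (Fin τ → Bool) (Fin τ → Bool) ℂ) :
    (onRegister r U : Op V Q)ᴴ = onRegister r Uᴴ := by
  rw [onRegister, onRegister, Matrix.conjTranspose_kronecker, Matrix.conjTranspose_one]
  congr 1
  ext b b'
  simp only [Matrix.conjTranspose_apply, Matrix.of_apply]
  have : (∀ q, (∀ i, r i ≠ q) → b' q = b q) ↔ ∀ q, (∀ i, r i ≠ q) → b q = b' q :=
    forall₂_congr fun _ _ => eq_comm
  simp only [this]
  split_ifs <;> simp

theorem onRegister_mem_unitary (hr : Function.Injective r)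
    {U : Matrix (Fin τ → Bool) (Fin τ → Bool) ℂ} (hU : U ∈ Matrix.unitaryGroup (Fin τ → Bool) ℂ) :
    (onRegister r U : Op V Q) ∈ Matrix.unitaryGroup ((V × V) × (Q → Bool)) ℂ := by
  rw [Matrix.mem_unitaryGroup_iff', Matrix.star_eq_conjTranspose, onRegister_conjTranspose,
    onRegister_mul hr, unitary_conjTranspose_mul hU, onRegister_one hr]

theorem fastForward_mem_unitary (hr : Function.Injective r)
    {W : Matrix (V × V) (V × V) ℂ} (hW : W ∈ Matrix.unitaryGroup (V × V) ℂ)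
    {Vq : Matrix (Fin τ → Bool) (Fin τ → Bool) ℂ} (hV : Vq ∈ Matrix.unitaryGroup (Fin τ → Bool) ℂ) :
    circuitOp (fastForward r W Vq) ∈ Matrix.unitaryGroup ((V × V) × (Q → Bool)) ℂ := by
  refine circuitOp_mem_unitary fun a ha => ?_
  simp only [fastForward, ctrlPowers, List.mem_append, List.mem_flatMap, List.mem_replicate,
    List.mem_singleton] at ha
  rcases ha with (rfl | ⟨i, -, -, rfl⟩) | rfl
  · exact onRegister_mem_unitary hr hV
  · exact controlled_mem_unitary hW _
  · exact onRegister_mem_unitary hr (conjTranspose_mem_unitary hV)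

theorem blockOp_mulVec_withBits (F : (Q → Bool) → Matrix (V × V) (V × V) ℂ) (b : Q → Bool)
    (f : V × V → ℂ) : blockOp F *ᵥ withBits b f = withBits b (F b *ᵥ f) := by
  ext p
  rw [Matrix.mulVec, dotProduct, Fintype.sum_prod_type]
  simp only [withBits, Matrix.mulVec, dotProduct, Finset.sum_mul]
  refine Finset.sum_congr rfl fun q _ => ?_
  rw [Finset.sum_eq_single b]
  · by_cases h : p.2 = b <;> simp [blockOp, h]
  · intro b' _ hb'
    simp [hb']
  · simp

theorem bitVal_eq (c : Fin τ → Bool) :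
    bitVal c = (finFunctionFinEquiv (m := 2) (n := τ) fun i => if c i then 1 else 0 : ℕ) := by
  rw [finFunctionFinEquiv_apply, bitVal]
  refine Finset.sum_congr rfl fun i _ => ?_
  split_ifs <;> simp

/-- Bit strings enumerate the numbers below `2 ^ τ`. -/
theorem sum_bitVal {E : Type*} [AddCommMonoid E] (f : ℕ → E) :
    ∑ c : Fin τ → Bool, f (bitVal c) = ∑ l ∈ Finset.range (2 ^ τ), f l := by
  rw [← Fin.sum_univ_eq_sum_range]
  refine Fintype.sum_equiv
    ((Equiv.arrowCongr (Equiv.refl (Fin τ)) finTwoEquiv.symm).trans finFunctionFinEquiv) _ _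
    fun c => ?_
  have h : (fun i => if c i then (1 : Fin 2) else 0) = fun i => finTwoEquiv.symm (c i) := by
    funext i
    cases h : c i <;> simp [finTwoEquiv]
  rw [bitVal_eq, h]
  rfl

/-- The matrix that fast-forwarding applies to the first register. -/
noncomputable def ffMatrix (P : Matrix V V ℝ) (τ t : ℕ) : Matrix V V ℂ :=
  (Polynomial.aeval (discriminant P) (ffPoly τ t)).map (algebraMap ℝ ℂ)

theorem ffMatrix_mulVec (P : Matrix V V ℝ) (τ t : ℕ) (a : V → ℂ) :
    ffMatrix P τ t *ᵥ a = ∑ l ∈ Finset.range (2 ^ τ),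
      ((qffProb t l / (1 - qffTail τ t) : ℝ) : ℂ) • ((Polynomial.aeval (discriminant P)
        (Polynomial.Chebyshev.T ℝ (l : ℤ))).map (algebraMap ℝ ℂ) *ᵥ a) := by
  have h : ffMatrix P τ t = ∑ l ∈ Finset.range (2 ^ τ),
      ((qffProb t l / (1 - qffTail τ t) : ℝ) : ℂ) • (Polynomial.aeval (discriminant P)
        (Polynomial.Chebyshev.T ℝ (l : ℤ))).map (algebraMap ℝ ℂ) := by
    rw [ffMatrix, ffPoly, map_sum]
    ext x y
    simp only [map_mul, Polynomial.aeval_C, Matrix.map_apply, Matrix.sum_apply,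
      ← Algebra.smul_def, Matrix.smul_apply]
    simp
  rw [h, Matrix.sum_mulVec]
  simp only [Matrix.smul_mulVec]

/-- Compressed to the zero states of `R₂` and of the control register, the circuit `W_τ` acts on the
first register as the truncated and renormalised Chebyshev series of `D ^ t`. -/
theorem controlProj_mulVec_fastForward (G : SimpleGraph V) {z : V → ℂ} (hz : IsUnitState z)
    {P : Matrix V V ℝ} (hP : ∀ x y, 0 ≤ P x y) (hG : ∀ x y, P x y ≠ 0 → x = y ∨ G.Adj x y)
    {A : Matrix (V × V) (V × V) ℂ} (hA : IsStepUnitary z P A) (hr : Function.Injective r)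
    {Vq : Matrix (Fin τ → Bool) (Fin τ → Bool) ℂ} {t : ℕ} (hV : IsPrepUnitary τ t Vq)
    (ht : qffTail τ t < 1) {S : Finset Q} (hS : ∀ i, r i ∈ S) {b : Q → Bool}
    (hb : ∀ q ∈ S, b q = false) (a : V → ℂ) :
    controlProj z S *ᵥ (circuitOp (fastForward r (walkOp G z A) Vq) *ᵥ regState z b a) =
      regState z b (ffMatrix P τ t *ᵥ a) := by
  have hbr : b ∘ r = fun _ => false := funext fun i => hb _ (hS i)
  have hop : circuitOp (fastForward r (walkOp G z A) Vq) = onRegister r Vqᴴ *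
      ((blockOp fun b : Q → Bool => walkOp G z A ^ bitVal (b ∘ r)) * onRegister r Vq) := by
    rw [fastForward, circuitOp_append, circuitOp_append, circuitOp_ctrlPowers]
    simp [circuitOp, Gate.toOp]
  have hzero : ∀ c : Fin τ → Bool,
      (∀ q ∈ S, Function.extend r c b q = false) ↔ c = fun _ => false := by
    intro c
    constructor
    · intro h
      funext i
      rw [← hr.extend_apply c b i]
      exact h _ (hS i)
    · rintro rfl q hq
      by_cases he : ∃ i, r i = q
      · obtain ⟨i, rfl⟩ := he
        rw [hr.extend_apply]
      · rw [Function.extend_apply' _ _ _ he, hb q hq]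
  have hext : Function.extend r (fun _ => false) b = b :=
    ((eq_extend_iff hr _ b b).mpr ⟨fun _ _ => rfl, hbr⟩).symm
  have hcoef : ∀ c, Vq c (fun _ => false) * Vqᴴ (fun _ => false) c =
      ((qffProb t (bitVal c) / (1 - qffTail τ t) : ℝ) : ℂ) := by
    intro c
    have h0 : 0 ≤ qffProb t (bitVal c) / (1 - qffTail τ t) :=
      div_nonneg (qffProb_nonneg _ _) (by linarith)
    rw [Matrix.conjTranspose_apply, hV.2 c, ← qffTail, RCLike.star_def, Complex.conj_ofReal,
      ← Complex.ofReal_mul, Real.mul_self_sqrt h0]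
  calc controlProj z S *ᵥ (circuitOp (fastForward r (walkOp G z A) Vq) *ᵥ regState z b a)
      = ∑ c, (Vq c (fun _ => false) * Vqᴴ (fun _ => false) c) •
          withBits b (zeroProj z *ᵥ (walkOp G z A ^ bitVal c *ᵥ tensor a z)) := by
        rw [hop, regState, ← Matrix.mulVec_mulVec, ← Matrix.mulVec_mulVec,
          onRegister_mulVec_withBits hr, hbr, Matrix.mulVec_sum, Matrix.mulVec_sum,
          Matrix.mulVec_sum]
        refine Finset.sum_congr rfl fun c _ => ?_
        rw [Matrix.mulVec_smul, Matrix.mulVec_smul, Matrix.mulVec_smul, blockOp_mulVec_withBits,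
          extend_comp hr, onRegister_mulVec_withBits hr, extend_comp hr, Matrix.mulVec_sum,
          Finset.sum_eq_single fun _ => false, Matrix.mulVec_smul, extend_extend hr, hext,
          controlProj_mulVec_withBits, if_pos hb, smul_smul]
        · intro c' _ hc'
          rw [Matrix.mulVec_smul, extend_extend hr, controlProj_mulVec_withBits,
            if_neg fun h => hc' ((hzero c').mp h), smul_zero]
        · simp
    _ = ∑ c : Fin τ → Bool, ((qffProb t (bitVal c) / (1 - qffTail τ t) : ℝ) : ℂ) • regState z b
          ((Polynomial.aeval (discriminant P)
            (Polynomial.Chebyshev.T ℝ ((bitVal c : ℕ) : ℤ))).map (algebraMap ℝ ℂ) *ᵥ a) := by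
        refine Finset.sum_congr rfl fun c _ => ?_
        rw [hcoef, (zeroProj_walkOp_pow G hz hP hG hA (bitVal c)).1]; rfl
    _ = regState z b (ffMatrix P τ t *ᵥ a) := by
        rw [sum_bitVal fun l => ((qffProb t l / (1 - qffTail τ t) : ℝ) : ℂ) • regState z b
          ((Polynomial.aeval (discriminant P)
            (Polynomial.Chebyshev.T ℝ (l : ℤ))).map (algebraMap ℝ ℂ) *ᵥ a), ffMatrix_mulVec]
        simp only [← regState_smul]
        have : ∀ s : Finset ℕ, ∀ F : ℕ → V → ℂ,
            ∑ l ∈ s, regState z b (F l) = regState z b (∑ l ∈ s, F l) := by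
          intro s F
          induction s using Finset.induction_on with
          | empty => ext p; simp [regState, withBits, tensor]
          | insert l s hl ih => rw [Finset.sum_insert hl, Finset.sum_insert hl, ih, regState_add]
        exact this _ _

/-- The fast-forwarding matrix is a polynomial in the discriminant that maps the eigenvalue `1` to
`1` and, by the gap, all others to `[-e, e]`; so it is within `e` of the projection on `u`. -/
theorem l2_ffMatrix_sub_le {G : SimpleGraph V} {P : Matrix V V ℝ} {u : V → ℝ} {H : ℝ}
    (h : IsGapped G P u H) {τ t : ℕ} (ht : qffTail τ t < 1) {e : ℝ} (he0 : 0 ≤ e)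
    (he : 0 < gap P → gap P ≤ 1 → ((1 - gap P) ^ t + qffTail τ t) / (1 - qffTail τ t) ≤ e)
    (a : V → ℂ) :
    l2 (ffMatrix P τ t *ᵥ a - (∑ x, (u x : ℂ) * a x) • fun x => (u x : ℂ)) ≤ e * l2 a := by
  have hD := discriminant_isHermitian P
  set M := Polynomial.aeval (discriminant P) (ffPoly τ t) with hM
  set X : Matrix V V ℝ := M - Matrix.vecMulVec u u with hX
  have hXa : ffMatrix P τ t *ᵥ a - (∑ x, (u x : ℂ) * a x) • (fun x => (u x : ℂ)) =
      X.map (algebraMap ℝ ℂ) *ᵥ a := by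
    ext x
    simp only [ffMatrix, ← hM, hX, Pi.sub_apply, Matrix.mulVec, dotProduct, Matrix.map_apply,
      Matrix.sub_apply, Matrix.vecMulVec_apply, Pi.smul_apply, smul_eq_mul, map_sub, map_mul,
      sub_mul, Finset.sum_sub_distrib, Finset.sum_mul]
    congr 1
    exact Finset.sum_congr rfl fun y _ => by simp; ring
  rw [hXa]
  refine l2_map_mulVec_le he0 (fun f => ?_) a
  have hvec : ∀ k, discriminant P *ᵥ (hD.eigenvectorBasis k).ofLp =
      hD.eigenvalues k • (hD.eigenvectorBasis k).ofLp := hD.mulVec_eigenvectorBasis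
  have hXk : ∀ k, X *ᵥ (hD.eigenvectorBasis k).ofLp =
      (if hD.eigenvalues k = 1 then 0 else (ffPoly τ t).eval (hD.eigenvalues k)) •
        (hD.eigenvectorBasis k).ofLp := by
    intro k
    set v := (hD.eigenvectorBasis k).ofLp
    have huv : Matrix.vecMulVec u u *ᵥ v = (u ⬝ᵥ v) • u := by
      rw [Matrix.vecMulVec_mulVec]
      ext x; simp [mul_comm]
    rw [hX, Matrix.sub_mulVec, hM, aeval_mulVec_of_eigenvector (hvec k), huv]
    split_ifs with h1
    · have h2 := hvec k
      rw [h1, one_smul] at h2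
      obtain ⟨c, hc⟩ := h.simple _ h2
      have h3 : u ⬝ᵥ v = c := by
        rw [show v = c • u from hc, dotProduct_smul, h.unit, smul_eq_mul, mul_one]
      rw [h1, eval_one_ffPoly ht, one_smul, h3, zero_smul]
      exact sub_eq_zero.mpr hc
    · have : v ⬝ᵥ u = 0 := orthogonal_of_eigenvector hD h.fixed (hvec k) h1
      rw [dotProduct_comm, this, zero_smul, sub_zero]
  refine sum_sq_mulVec_le_of_eigenbasis hD.eigenvectorBasis X _ hXk (fun k => ?_) f
  split_ifs with h1
  · simpa using he0
  · have hne : (hD.eigenvectorBasis k).ofLp ≠ 0 := fun h0 =>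
      hD.eigenvectorBasis.orthonormal.ne_zero k (by ext x; simpa using congrFun h0 x)
    obtain ⟨hr0, hg0, hr1⟩ := h.eigenvalue_bounds _ _ hne (hvec k) h1
    refine (abs_eval_ffPoly_le ht ?_).trans (le_trans ?_ (he hg0 (by linarith)))
    · rw [abs_le]; constructor <;> linarith
    · rw [abs_of_nonneg hr0]
      have : 0 ≤ 1 - qffTail τ t := by linarith
      gcongr

theorem ffMatrix_mulVec_fixed {G : SimpleGraph V} {P : Matrix V V ℝ} {u : V → ℝ} {H : ℝ}
    (h : IsGapped G P u H) {τ t : ℕ} (ht : qffTail τ t < 1) :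
    ffMatrix P τ t *ᵥ (fun x => (u x : ℂ)) = fun x => (u x : ℂ) := by
  have h1 : discriminant P *ᵥ u = (1 : ℝ) • u := by rw [h.fixed, one_smul]
  have h2 := aeval_mulVec_of_eigenvector h1 (ffPoly τ t)
  rw [eval_one_ffPoly ht, one_smul] at h2
  ext x
  have h3 := congrFun h2 x
  simp only [Matrix.mulVec, dotProduct, ffMatrix, Matrix.map_apply] at h3 ⊢
  rw [← h3]
  push_cast
  rfl

end FastForward

/-! ### The circuits as approximate rotations -/

section Approximation

variable {V : Type*} [Fintype V] [DecidableEq V] {Q : Type*} [Fintype Q] [DecidableEq Q]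
  {τ : ℕ} {r : Fin τ → Q}

/-- The overlap of a complex vector with a real one. -/
noncomputable def overlap (u : V → ℝ) (a : V → ℂ) : ℂ := ∑ x, (u x : ℂ) * a x

/-- A real vector, regarded as a complex one. -/
def toC (u : V → ℝ) : V → ℂ := fun x => (u x : ℂ)

/-- The unitary `B` compresses, for zero bits of the register `r` and `|0̄⟩` in `R₂`, to a matrix
that fixes `u` and has distance at most `e` to the projection on `u`. -/
structure IsApproxProjector (z : V → ℂ) (r : Fin τ → Q) (B : Op V Q) (u : V → ℝ) (e : ℝ) :
    Prop where
  unitary : B ∈ Matrix.unitaryGroup ((V × V) × (Q → Bool)) ℂ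
  compression : ∃ M : Matrix V V ℂ,
    (∀ (S : Finset Q) (b : Q → Bool) (a : V → ℂ), (∀ i, r i ∈ S) → (∀ q ∈ S, b q = false) →
      controlProj z S *ᵥ (B *ᵥ regState z b a) = regState z b (M *ᵥ a)) ∧
    M *ᵥ toC u = toC u ∧ ∀ a, l2 (M *ᵥ a - overlap u a • toC u) ≤ e * l2 a

theorem IsApproxProjector.conjTranspose_mulVec {z : V → ℂ} (hz : IsUnitState z) {B : Op V Q}
    {u : V → ℝ} {e : ℝ} (hB : IsApproxProjector z r B u e) {b : Q → Bool}
    (hb : ∀ i, b (r i) = false) :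
    Bᴴ *ᵥ regState z b (toC u) = regState z b (toC u) := by
  obtain ⟨M, h1, h2, -⟩ := hB.compression
  have hb' : ∀ q ∈ Finset.univ.image r, b q = false := by
    intro q hq
    obtain ⟨i, -, rfl⟩ := Finset.mem_image.mp hq
    exact hb i
  have hfix : B *ᵥ regState z b (toC u) = regState z b (toC u) := by
    refine unitary_fixes_of_compression hB.unitary
      (controlProj_conjTranspose z (Finset.univ.image r)) (controlProj_mulVec_regState hz hb' _) ?_
    rw [h1 _ _ _ (by simp) hb', h2]
  conv_lhs => rw [← hfix]
  rw [Matrix.mulVec_mulVec, unitary_conjTranspose_mul hB.unitary, Matrix.one_mulVec]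

/-- Conjugating a conditional operation `N` by `B` applies `N` to the component along `u`, up to an
error that is linear in `e`. -/
theorem IsApproxProjector.conj_approx {z : V → ℂ} (hz : IsUnitState z) {B : Op V Q} {u : V → ℝ}
    {e : ℝ} (hB : IsApproxProjector z r B u e) {S : Finset Q} (hS : ∀ i, r i ∈ S) {N : Op V Q}
    (hc : controlProj z S * N = N * controlProj z S) {b b' : Q → Bool}
    (hb : ∀ q ∈ S, b q = false) (hb' : ∀ i, b' (r i) = false) {κ : ℂ} (hκ : ‖κ‖ = 1)
    (hN : ∀ v, N *ᵥ regState z b v = κ • regState z b' v) (a : V → ℂ) :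
    l2 (Bᴴ *ᵥ (zeroControlled z S N *ᵥ (B *ᵥ regState z b a)) - (regState z b a +
      overlap u a • (κ • regState z b' (toC u) - regState z b (toC u)))) ≤ 2 * (e * l2 a) := by
  obtain ⟨M, h1, h2, h3⟩ := hB.compression
  have hBu := hB.conjTranspose_mulVec hz (b := b) fun i => hb _ (hS i)
  have hBu' := hB.conjTranspose_mulVec hz hb'
  set d := M *ᵥ a - overlap u a • toC u with hd
  have hMa : M *ᵥ a = overlap u a • toC u + d := by rw [hd]; abel
  have key : Bᴴ *ᵥ (zeroControlled z S N *ᵥ (B *ᵥ regState z b a)) - (regState z b a +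
      overlap u a • (κ • regState z b' (toC u) - regState z b (toC u))) =
      Bᴴ *ᵥ (κ • regState z b' d - regState z b d) := by
    rw [zeroControlled_mulVec hc, h1 S b a hS hb, hN, Matrix.mulVec_add, Matrix.mulVec_mulVec,
      unitary_conjTranspose_mul hB.unitary, Matrix.one_mulVec, hMa, regState_add, regState_add,
      regState_smul, regState_smul]
    simp only [Matrix.mulVec_sub, Matrix.mulVec_add, Matrix.mulVec_smul, smul_add, hBu, hBu']
    module
  rw [key, l2_unitary (conjTranspose_mem_unitary hB.unitary)]
  refine (l2_sub_le _ _).trans ?_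
  rw [l2_smul, hκ, l2_regState hz, l2_regState hz]
  have := h3 a
  rw [← hd] at this
  linarith

/-- The main circuit is the same when read backwards. -/
theorem circuitOp_mainCircuit (r₃ : Fin τ → Q) (r₄ r₅ : Q) (z : V → ℂ)
    (W : Matrix (V × V) (V × V) ℂ) (Vq : Matrix (Fin τ → Bool) (Fin τ → Bool) ℂ) :
    circuitOp (mainCircuit r₃ r₄ r₅ z W Vq) = zeroControlled z ∅ (notOp r₄) * (notOp r₄ *
      ((circuitOp (fastForward r₃ W Vq))ᴴ *
      (zeroControlled z (insert r₄ (Finset.univ.image r₃)) (notOp r₅) *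
      (circuitOp (fastForward r₃ W Vq) * (notOp r₄ * zeroControlled z ∅ (notOp r₄)))))) := by
  rw [mainCircuit, circuitOp_append, circuitOp_append, circuitOp_append, circuitOp_append,
    circuitOp_inv]
  simp [circuitOp, Gate.toOp, Matrix.mul_assoc]

theorem circuitOp_mainCircuit_conjTranspose {r₃ : Fin τ → Q} {r₄ r₅ : Q} (h₃₅ : ∀ i, r₃ i ≠ r₅)
    (h₄₅ : r₄ ≠ r₅) (z : V → ℂ) (W : Matrix (V × V) (V × V) ℂ)
    (Vq : Matrix (Fin τ → Bool) (Fin τ → Bool) ℂ) :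
    (circuitOp (mainCircuit r₃ r₄ r₅ z W Vq))ᴴ = circuitOp (mainCircuit r₃ r₄ r₅ z W Vq) := by
  have h5 : r₅ ∉ insert r₄ (Finset.univ.image r₃) := by
    simp only [Finset.mem_insert, Finset.mem_image, Finset.mem_univ, true_and, not_or, not_exists]
    exact ⟨h₄₅.symm, h₃₅⟩
  rw [circuitOp_mainCircuit]
  simp only [Matrix.conjTranspose_mul, Matrix.conjTranspose_conjTranspose, notOp_conjTranspose,
    zeroControlled_notOp_conjTranspose z h5,
    zeroControlled_notOp_conjTranspose z (Finset.notMem_empty r₄), Matrix.mul_assoc]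

theorem circuitOp_reflectionCircuit (r₃ : Fin τ → Q) (r₄ : Q) (z : V → ℂ)
    (W : Matrix (V × V) (V × V) ℂ) (Vq : Matrix (Fin τ → Bool) (Fin τ → Bool) ℂ) (α : ℝ) :
    circuitOp (reflectionCircuit r₃ r₄ z W Vq α) = zeroControlled z ∅ (notOp r₄) *
      ((circuitOp (fastForward r₃ W Vq))ᴴ *
      (zeroControlled z (Finset.univ.image r₃) (phaseOp r₄ α) *
      (circuitOp (fastForward r₃ W Vq) * zeroControlled z ∅ (notOp r₄)))) := by
  rw [reflectionCircuit, circuitOp_append, circuitOp_append, circuitOp_append, circuitOp_append,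
    circuitOp_inv]
  simp [circuitOp, Gate.toOp]

theorem mainCircuit_mem_unitary {z : V → ℂ} (hz : IsUnitState z) {r₃ : Fin τ → Q} {r₄ r₅ : Q}
    (h₃₅ : ∀ i, r₃ i ≠ r₅) (h₄₅ : r₄ ≠ r₅) {W : Matrix (V × V) (V × V) ℂ}
    {Vq : Matrix (Fin τ → Bool) (Fin τ → Bool) ℂ}
    (hB : circuitOp (fastForward r₃ W Vq) ∈ Matrix.unitaryGroup ((V × V) × (Q → Bool)) ℂ) :
    circuitOp (mainCircuit r₃ r₄ r₅ z W Vq) ∈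
      Matrix.unitaryGroup ((V × V) × (Q → Bool)) ℂ := by
  have h5 : r₅ ∉ insert r₄ (Finset.univ.image r₃) := by
    simp only [Finset.mem_insert, Finset.mem_image, Finset.mem_univ, true_and, not_or, not_exists]
    exact ⟨h₄₅.symm, h₃₅⟩
  have h4 := zeroControlled_notOp_mem_unitary hz (Finset.notMem_empty r₄)
  rw [circuitOp_mainCircuit]
  exact mul_mem h4 (mul_mem (notOp_mem_unitary r₄) (mul_mem (conjTranspose_mem_unitary hB)
    (mul_mem (zeroControlled_notOp_mem_unitary hz h5) (mul_mem hB
      (mul_mem (notOp_mem_unitary r₄) h4)))))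

theorem reflectionCircuit_mem_unitary {z : V → ℂ} (hz : IsUnitState z) {r₃ : Fin τ → Q} {r₄ : Q}
    {W : Matrix (V × V) (V × V) ℂ} {Vq : Matrix (Fin τ → Bool) (Fin τ → Bool) ℂ}
    (hB : circuitOp (fastForward r₃ W Vq) ∈ Matrix.unitaryGroup ((V × V) × (Q → Bool)) ℂ) (α : ℝ) :
    circuitOp (reflectionCircuit r₃ r₄ z W Vq α) ∈
      Matrix.unitaryGroup ((V × V) × (Q → Bool)) ℂ := by
  have h4 := zeroControlled_notOp_mem_unitary hz (Finset.notMem_empty r₄)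
  rw [circuitOp_reflectionCircuit]
  exact mul_mem h4 (mul_mem (conjTranspose_mem_unitary hB)
    (mul_mem (zeroControlled_mem_unitary hz (phaseOp_mem_unitary r₄ α)
      (controlProj_mul_phaseOp z _ r₄ α)) (mul_mem hB h4)))

/-- The main circuit approximately flips the bit `r₅` on the component of the first register along
`u`. -/
theorem mainCircuit_approx {z : V → ℂ} (hz : IsUnitState z) {r₃ : Fin τ → Q} {r₄ r₅ : Q}
    (h₃₄ : ∀ i, r₃ i ≠ r₄) (h₃₅ : ∀ i, r₃ i ≠ r₅) (h₄₅ : r₄ ≠ r₅)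
    {W : Matrix (V × V) (V × V) ℂ} {Vq : Matrix (Fin τ → Bool) (Fin τ → Bool) ℂ}
    {u : V → ℝ} {e : ℝ} (hB : IsApproxProjector z r₃ (circuitOp (fastForward r₃ W Vq)) u e)
    {b : Q → Bool} (hb₃ : ∀ i, b (r₃ i) = false) (hb₄ : b r₄ = false) (a : V → ℂ) :
    l2 (circuitOp (mainCircuit r₃ r₄ r₅ z W Vq) *ᵥ regState z b a - (regState z b a +
      overlap u a • (regState z (flipBit r₅ b) (toC u) - regState z b (toC u)))) ≤
      2 * (e * l2 a) := by
  have h5 : r₅ ∉ insert r₄ (Finset.univ.image r₃) := by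
    simp only [Finset.mem_insert, Finset.mem_image, Finset.mem_univ, true_and, not_or, not_exists]
    exact ⟨h₄₅.symm, h₃₅⟩
  have hback : ∀ (b' : Q → Bool) (v : V → ℂ), zeroControlled z ∅ (notOp r₄) *ᵥ
      (notOp r₄ *ᵥ regState z b' v) = regState z b' v := by
    intro b' v
    rw [notOp_mulVec_regState, zeroControlled_empty_notOp_mulVec hz, flipBit_flipBit]
  have hforth : notOp r₄ *ᵥ (zeroControlled z ∅ (notOp r₄) *ᵥ regState z b a) =
      regState z b a := by
    rw [zeroControlled_empty_notOp_mulVec hz, notOp_mulVec_regState, flipBit_flipBit]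
  have hconj := hB.conj_approx hz (S := insert r₄ (Finset.univ.image r₃)) (by simp)
    (controlProj_mul_notOp z h5) (b := b) (b' := flipBit r₅ b)
    (by
      intro q hq
      rcases Finset.mem_insert.mp hq with rfl | hq
      · exact hb₄
      · obtain ⟨i, -, rfl⟩ := Finset.mem_image.mp hq
        exact hb₃ i)
    (fun i => by rw [flipBit_of_ne (h₃₅ i), hb₃]) (κ := 1) (by simp)
    (fun v => by rw [notOp_mulVec_regState, one_smul]) a
  rw [one_smul] at hconj
  have htarget : zeroControlled z ∅ (notOp r₄) *ᵥ (notOp r₄ *ᵥ (regState z b a +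
      overlap u a • (regState z (flipBit r₅ b) (toC u) - regState z b (toC u)))) =
      regState z b a +
      overlap u a • (regState z (flipBit r₅ b) (toC u) - regState z b (toC u)) := by
    simp only [Matrix.mulVec_add, Matrix.mulVec_sub, Matrix.mulVec_smul, hback]
  refine le_trans (le_of_eq ?_) hconj
  rw [circuitOp_mainCircuit]
  simp only [← Matrix.mulVec_mulVec, hforth]
  conv_lhs => rw [← htarget]
  rw [← Matrix.mulVec_sub, ← Matrix.mulVec_sub,
    l2_unitary (zeroControlled_notOp_mem_unitary hz (Finset.notMem_empty r₄)),
    l2_unitary (notOp_mem_unitary r₄)]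

/-- The reflection circuit approximately multiplies the component along `u` by the phase. -/
theorem reflectionCircuit_approx {z : V → ℂ} (hz : IsUnitState z) {r₃ : Fin τ → Q} {r₄ : Q}
    (h₃₄ : ∀ i, r₃ i ≠ r₄)
    {W : Matrix (V × V) (V × V) ℂ} {Vq : Matrix (Fin τ → Bool) (Fin τ → Bool) ℂ}
    {u : V → ℝ} {e : ℝ} (hB : IsApproxProjector z r₃ (circuitOp (fastForward r₃ W Vq)) u e)
    (α : ℝ) {b : Q → Bool} (hb₃ : ∀ i, b (r₃ i) = false) (hb₄ : b r₄ = false) (a : V → ℂ) :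
    l2 (circuitOp (reflectionCircuit r₃ r₄ z W Vq α) *ᵥ regState z b a - (regState z b a +
      ((Complex.exp (α * Complex.I) - 1) * overlap u a) • regState z b (toC u))) ≤
      2 * (e * l2 a) := by
  have hfl : ∀ i, flipBit r₄ b (r₃ i) = false := fun i => by rw [flipBit_of_ne (h₃₄ i), hb₃]
  have hback : ∀ v : V → ℂ, zeroControlled z ∅ (notOp r₄) *ᵥ regState z (flipBit r₄ b) v =
      regState z b v := by
    intro v
    rw [zeroControlled_empty_notOp_mulVec hz, flipBit_flipBit]
  have hconj := hB.conj_approx hz (S := Finset.univ.image r₃) (by simp)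
    (controlProj_mul_phaseOp z _ r₄ α) (b := flipBit r₄ b) (b' := flipBit r₄ b)
    (by
      intro q hq
      obtain ⟨i, -, rfl⟩ := Finset.mem_image.mp hq
      exact hfl i)
    hfl (κ := Complex.exp (α * Complex.I)) (Complex.norm_exp_ofReal_mul_I α)
    (fun v => phaseOp_mulVec_regState r₄ α z (by rw [flipBit_same, hb₄]; rfl) v) a
  refine le_trans (le_of_eq ?_) hconj
  rw [circuitOp_reflectionCircuit]
  simp only [← Matrix.mulVec_mulVec, zeroControlled_empty_notOp_mulVec hz]
  have htarget : regState z b a +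
      ((Complex.exp (α * Complex.I) - 1) * overlap u a) • regState z b (toC u) =
      zeroControlled z ∅ (notOp r₄) *ᵥ (regState z (flipBit r₄ b) a + overlap u a •
        (Complex.exp (α * Complex.I) • regState z (flipBit r₄ b) (toC u) -
          regState z (flipBit r₄ b) (toC u))) := by
    simp only [Matrix.mulVec_add, Matrix.mulVec_sub, Matrix.mulVec_smul, hback]
    module
  rw [htarget, ← Matrix.mulVec_sub,
    l2_unitary (zeroControlled_notOp_mem_unitary hz (Finset.notMem_empty r₄))]

/-! ### Counting walk calls -/

theorem circuitCalls_append (c d : Circuit V Q) :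
    circuitCalls (c ++ d) = circuitCalls c + circuitCalls d := by
  simp [circuitCalls]

theorem circuitCalls_inv (c : Circuit V Q) : circuitCalls (circuitInv c) = circuitCalls c := by
  have h : ∀ a : Gate V Q, a.inv.calls = a.calls := fun a => by cases a <;> rfl
  simp only [circuitCalls, circuitInv, List.map_reverse, List.sum_reverse, List.map_map]
  congr 1
  exact List.map_congr_left fun a _ => h a

theorem circuitCalls_fastForward (r : Fin τ → Q) (W : Matrix (V × V) (V × V) ℂ)
    (Vq : Matrix (Fin τ → Bool) (Fin τ → Bool) ℂ) :
    circuitCalls (fastForward r W Vq) = 2 ^ τ - 1 := by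
  have key : ∀ l : List (Fin τ), circuitCalls (l.flatMap fun (i : Fin τ) =>
      List.replicate (2 ^ (i : ℕ)) (Gate.call W (r i) : Gate V Q)) =
      (l.map fun (i : Fin τ) => 2 ^ (i : ℕ)).sum := by
    intro l
    induction l with
    | nil => rfl
    | cons a l ih =>
      rw [List.flatMap_cons, circuitCalls_append, ih, List.map_cons, List.sum_cons]
      congr 1
      simp [circuitCalls, Gate.calls]
  rw [fastForward, circuitCalls_append, circuitCalls_append, ctrlPowers, key,
    ← List.ofFn_eq_map, List.sum_ofFn, Fin.sum_univ_eq_sum_range (fun i => 2 ^ i),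
    Nat.geomSum_eq le_rfl]
  simp [circuitCalls, Gate.calls]

theorem circuitCalls_mainCircuit (r₃ : Fin τ → Q) (r₄ r₅ : Q) (z : V → ℂ)
    (W : Matrix (V × V) (V × V) ℂ) (Vq : Matrix (Fin τ → Bool) (Fin τ → Bool) ℂ) :
    circuitCalls (mainCircuit r₃ r₄ r₅ z W Vq) = 2 * (2 ^ τ - 1) := by
  simp only [mainCircuit, circuitCalls_append, circuitCalls_inv, circuitCalls_fastForward]
  simp [circuitCalls, Gate.calls]
  ring

theorem circuitCalls_reflectionCircuit (r₃ : Fin τ → Q) (r₄ : Q) (z : V → ℂ)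
    (W : Matrix (V × V) (V × V) ℂ) (Vq : Matrix (Fin τ → Bool) (Fin τ → Bool) ℂ) (α : ℝ) :
    circuitCalls (reflectionCircuit r₃ r₄ z W Vq α) = 2 * (2 ^ τ - 1) := by
  simp only [reflectionCircuit, circuitCalls_append, circuitCalls_inv, circuitCalls_fastForward]
  simp [circuitCalls, Gate.calls]
  ring

end Approximation

/-! ### Existence of the unitaries -/

section Realizations

variable {V : Type*} [Fintype V] [DecidableEq V]

/-- An orthonormal family in `ι → ℂ` consists of columns of a unitary matrix. -/
theorem exists_unitary_col {ι κ : Type*} [Fintype ι] [DecidableEq ι] [DecidableEq κ]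
    {j : κ → ι} (hj : Function.Injective j) {v : κ → ι → ℂ}
    (hv : ∀ i k, star (v i) ⬝ᵥ v k = if i = k then 1 else 0) :
    ∃ U ∈ Matrix.unitaryGroup ι ℂ, ∀ i, U *ᵥ Pi.single (j i) 1 = v i := by
  set f : ι → EuclideanSpace ℂ ι := Function.extend j (fun i => WithLp.toLp 2 (v i)) 0 with hf
  have hfj : ∀ i, f (j i) = WithLp.toLp 2 (v i) := fun i => hj.extend_apply _ _ i
  have hon : Orthonormal ℂ ((Set.range j).domRestrict f) := by
    rw [orthonormal_iff_ite]
    rintro ⟨_, i, rfl⟩ ⟨_, k, rfl⟩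
    simp only [Set.domRestrict_apply, hfj, EuclideanSpace.inner_eq_star_dotProduct]
    rw [dotProduct_comm]
    refine (hv i k).trans ?_
    by_cases h : i = k
    · rw [if_pos h, if_pos (Subtype.ext (congrArg j h))]
    · rw [if_neg h, if_neg fun e => h (hj (congrArg Subtype.val e))]
  obtain ⟨b, hb⟩ := hon.exists_orthonormalBasis_extension_of_card_eq (by simp)
  refine ⟨Matrix.of fun x i => b i x, ?_, fun i => ?_⟩
  · rw [Matrix.mem_unitaryGroup_iff', Matrix.star_eq_conjTranspose]
    ext i k
    have h := orthonormal_iff_ite.mp b.orthonormal i k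
    rw [EuclideanSpace.inner_eq_star_dotProduct, dotProduct_comm] at h
    rw [Matrix.one_apply, ← h]
    rfl
  · rw [Matrix.mulVec_single_one]
    ext x
    have h := hb (j i) ⟨i, rfl⟩
    rw [hfj] at h
    simp [Matrix.col, h]

/-- A unitary that maps one orthonormal family to another. -/
theorem exists_unitary_mulVec {ι κ : Type*} [Fintype ι] [DecidableEq ι] [DecidableEq κ]
    {j : κ → ι} (hj : Function.Injective j) {v w : κ → ι → ℂ}
    (hv : ∀ i k, star (v i) ⬝ᵥ v k = if i = k then 1 else 0)
    (hw : ∀ i k, star (w i) ⬝ᵥ w k = if i = k then 1 else 0) :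
    ∃ U ∈ Matrix.unitaryGroup ι ℂ, ∀ i, U *ᵥ v i = w i := by
  obtain ⟨X, hX, hXv⟩ := exists_unitary_col hj hv
  obtain ⟨Y, hY, hYw⟩ := exists_unitary_col hj hw
  refine ⟨Y * Xᴴ, mul_mem hY (conjTranspose_mem_unitary hX), fun i => ?_⟩
  rw [← hXv, ← hYw, Matrix.mulVec_mulVec, Matrix.mul_assoc, unitary_conjTranspose_mul hX,
    Matrix.mul_one]

theorem exists_stepUnitary {z : V → ℂ} (hz : IsUnitState z) {P : Matrix V V ℝ}
    (hP : ∀ x y, 0 ≤ P x y) (hrow : ∀ x, ∑ y, P x y = 1) : ∃ A, IsStepUnitary z P A := by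
  have hten : ∀ (f h : V → V → ℂ), (∀ x, star (f x) ⬝ᵥ h x = 1) → ∀ x x',
      star (tensor (Pi.single x 1) (f x)) ⬝ᵥ tensor (Pi.single x' 1) (h x') =
        if x = x' then 1 else 0 := by
    intro f h hfh x x'
    rw [dotProduct, Fintype.sum_prod_type, Finset.sum_eq_single x]
    · by_cases hx : x = x'
      · subst hx
        rw [if_pos rfl]
        refine Eq.trans ?_ (hfh x)
        rw [dotProduct]
        simp [tensor]
      · simp [tensor, hx]
    · intro y _ hy
      simp [tensor, hy]
    · simp
  obtain ⟨A, hA, hAx⟩ := exists_unitary_mulVec (j := fun x : V => (x, x))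
    (fun _ _ h => congrArg Prod.fst h) (hten (fun _ => z) (fun _ => z) fun _ => hz.star_dotProduct)
    (hten (fun x y => (√(P x y) : ℂ)) (fun x y => (√(P x y) : ℂ)) fun x => by
      rw [dotProduct]
      have : ∀ y, (star fun y => (√(P x y) : ℂ)) y * (√(P x y) : ℂ) = (P x y : ℂ) := by
        intro y
        rw [Pi.star_apply, RCLike.star_def, Complex.conj_ofReal, ← Complex.ofReal_mul,
          Real.mul_self_sqrt (hP x y)]
      simp only [this]
      exact_mod_cast hrow x)
  exact ⟨A, hA, hAx⟩

theorem exists_prepUnitary {τ : ℕ} (hτ : 1 ≤ τ) (t : ℕ) : ∃ U, IsPrepUnitary τ t U := by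
  have htail := qffTail_lt_one hτ t
  set c : (Fin τ → Bool) → ℂ := fun b => (√(qffProb t (bitVal b) / (1 - qffTail τ t)) : ℂ) with hc
  have hcc : star c ⬝ᵥ c = 1 := by
    have : ∀ b, star c b * c b = ((qffProb t (bitVal b) / (1 - qffTail τ t) : ℝ) : ℂ) := by
      intro b
      have h0 : 0 ≤ qffProb t (bitVal b) / (1 - qffTail τ t) :=
        div_nonneg (qffProb_nonneg _ _) (by linarith)
      rw [Pi.star_apply, hc, RCLike.star_def, Complex.conj_ofReal, ← Complex.ofReal_mul,
        Real.mul_self_sqrt h0]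
    rw [dotProduct]
    simp only [this]
    rw [← Complex.ofReal_sum, sum_bitVal fun l => qffProb t l / (1 - qffTail τ t),
      ← Finset.sum_div, sum_range_qffProb, div_self (by linarith), Complex.ofReal_one]
  obtain ⟨U, hU, hUb⟩ := exists_unitary_mulVec (κ := Unit)
    (j := fun _ _ => false) (fun _ _ _ => rfl)
    (v := fun _ => Pi.single (fun _ => false) 1) (w := fun _ => c)
    (by intro i j; simp) (by intro i j; rw [hcc, if_pos rfl])
  refine ⟨U, hU, fun b => ?_⟩
  have := congrFun (hUb ()) b
  rw [Matrix.mulVec_single_one] at this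
  exact this

end Realizations

/-! ### Measuring the first register -/

section Measurement

variable {V : Type*} [Fintype V] [DecidableEq V] {Q : Type*} [Fintype Q] [DecidableEq Q]

/-- The amplitudes of `|π⟩` in `R₁`, as a vector on the other registers. -/
noncomputable def distAmplitude (π : V → ℝ) (ψ : (V × V) × (Q → Bool) → ℂ) :
    V × (Q → Bool) → ℂ :=
  fun p => ∑ x, (√(π x) : ℂ) * ψ ((x, p.1), p.2)

/-- The part of `distAmplitude` in which the ancilla qubit `q` is set. -/
noncomputable def flaggedAmplitude (π : V → ℝ) (q : Q) (ψ : (V × V) × (Q → Bool) → ℂ) :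
    V × (Q → Bool) → ℂ :=
  fun p => if p.2 q then distAmplitude π ψ p else 0

theorem successProb_eq (π : V → ℝ) (ψ : (V × V) × (Q → Bool) → ℂ) :
    successProb π ψ = l2 (distAmplitude π ψ) ^ 2 := by
  rw [l2_sq, Fintype.sum_prod_type]; rfl

theorem flaggedProb_eq (π : V → ℝ) (q : Q) (ψ : (V × V) × (Q → Bool) → ℂ) :
    flaggedProb π q ψ = l2 (flaggedAmplitude π q ψ) ^ 2 := by
  rw [l2_sq, Fintype.sum_prod_type, flaggedProb]
  refine Finset.sum_congr rfl fun y _ => Finset.sum_congr rfl fun b _ => ?_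
  rw [flaggedAmplitude]
  split_ifs
  · rfl
  · simp

theorem flaggedProb_le_successProb (π : V → ℝ) (q : Q) (ψ : (V × V) × (Q → Bool) → ℂ) :
    flaggedProb π q ψ ≤ successProb π ψ := by
  refine Finset.sum_le_sum fun y _ => Finset.sum_le_sum fun b _ => ?_
  split_ifs
  · exact le_rfl
  · positivity

/-- The squared distance to the line of a unit vector `p` is at most that to any of its points. -/
theorem sum_norm_sq_sub_le {p : V → ℝ} (hp : ∑ x, p x ^ 2 = 1) (f : V → ℂ) (c : ℂ) :
    ∑ x, ‖f x‖ ^ 2 - ‖∑ x, (p x : ℂ) * f x‖ ^ 2 ≤ ∑ x, ‖f x - c * p x‖ ^ 2 := by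
  have hn : ∀ w : ℂ, ‖w‖ ^ 2 = w.re ^ 2 + w.im ^ 2 := fun w => by
    rw [← Complex.normSq_eq_norm_sq, Complex.normSq_apply]; ring
  have key : ∀ (f : V → ℝ) (c : ℝ),
      ∑ x, f x ^ 2 - (∑ x, p x * f x) ^ 2 ≤ ∑ x, (f x - c * p x) ^ 2 := by
    intro f c
    have h : ∑ x, (f x - c * p x) ^ 2 = ∑ x, f x ^ 2 - 2 * c * ∑ x, p x * f x + c ^ 2 := by
      rw [← mul_one (c ^ 2), ← hp, Finset.mul_sum, Finset.mul_sum, ← Finset.sum_sub_distrib,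
        ← Finset.sum_add_distrib]
      exact Finset.sum_congr rfl fun x _ => by ring
    rw [h]
    nlinarith [sq_nonneg (∑ x, p x * f x - c)]
  have h1 := key (fun x => (f x).re) c.re
  have h2 := key (fun x => (f x).im) c.im
  simp only [hn, Complex.re_sum, Complex.im_sum, Complex.re_ofReal_mul, Complex.im_ofReal_mul,
    Complex.sub_re, Complex.sub_im, Complex.re_mul_ofReal, Complex.im_mul_ofReal,
    Finset.sum_add_distrib]
  linarith

theorem l2_sq_sub_successProb_le {π : V → ℝ} (h0 : ∀ x, 0 ≤ π x) (h1 : ∑ x, π x = 1)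
    {ψ φ : (V × V) × (Q → Bool) → ℂ} {c : V → (Q → Bool) → ℂ}
    (hφ : ∀ x y b, φ ((x, y), b) = c y b * (√(π x) : ℂ)) :
    l2 ψ ^ 2 - successProb π ψ ≤ l2 (ψ - φ) ^ 2 := by
  have hswap : ∀ ξ : (V × V) × (Q → Bool) → ℂ,
      l2 ξ ^ 2 = ∑ y, ∑ b, ∑ x, ‖ξ ((x, y), b)‖ ^ 2 := by
    intro ξ
    rw [l2_sq, Fintype.sum_prod_type, Fintype.sum_prod_type, Finset.sum_comm]
    exact Finset.sum_congr rfl fun y _ => Finset.sum_comm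
  have hp : ∑ x, √(π x) ^ 2 = 1 := by
    rw [← h1]; exact Finset.sum_congr rfl fun x _ => Real.sq_sqrt (h0 x)
  rw [hswap, hswap, successProb]
  simp only [← Finset.sum_sub_distrib]
  refine Finset.sum_le_sum fun y _ => Finset.sum_le_sum fun b _ => ?_
  refine (sum_norm_sq_sub_le hp (fun x => ψ ((x, y), b)) (c y b)).trans (le_of_eq ?_)
  exact Finset.sum_congr rfl fun x _ => by rw [Pi.sub_apply, hφ]

theorem l2_distAmplitude_le {π : V → ℝ} (h0 : ∀ x, 0 ≤ π x) (h1 : ∑ x, π x = 1)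
    (ψ : (V × V) × (Q → Bool) → ℂ) : l2 (distAmplitude π ψ) ≤ l2 ψ := by
  rw [← sq_le_sq₀ (l2_nonneg _) (l2_nonneg _), ← successProb_eq]
  have hp : ∑ x, √(π x) ^ 2 = 1 := by
    rw [← h1]; exact Finset.sum_congr rfl fun x _ => Real.sq_sqrt (h0 x)
  have h : ∀ f : V → ℂ, ‖∑ x, (√(π x) : ℂ) * f x‖ ^ 2 ≤ ∑ x, ‖f x‖ ^ 2 := by
    intro f
    have h2 : ‖∑ x, (√(π x) : ℂ) * f x‖ ≤ ∑ x, √(π x) * ‖f x‖ := by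
      refine (norm_sum_le _ _).trans (le_of_eq (Finset.sum_congr rfl fun x _ => ?_))
      rw [norm_mul, Complex.norm_real, Real.norm_of_nonneg (Real.sqrt_nonneg _)]
    have h3 := Finset.sum_mul_sq_le_sq_mul_sq Finset.univ (fun x => √(π x)) fun x => ‖f x‖
    rw [hp, one_mul] at h3
    exact (pow_le_pow_left₀ (norm_nonneg _) h2 2).trans h3
  have hswap : l2 ψ ^ 2 = ∑ y, ∑ b, ∑ x, ‖ψ ((x, y), b)‖ ^ 2 := by
    rw [l2_sq, Fintype.sum_prod_type, Fintype.sum_prod_type, Finset.sum_comm]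
    exact Finset.sum_congr rfl fun y _ => Finset.sum_comm
  rw [hswap, successProb]
  exact Finset.sum_le_sum fun y _ => Finset.sum_le_sum fun b _ => h fun x => ψ ((x, y), b)

theorem flaggedAmplitude_add (π : V → ℝ) (q : Q) (ψ φ : (V × V) × (Q → Bool) → ℂ) :
    flaggedAmplitude π q (ψ + φ) = flaggedAmplitude π q ψ + flaggedAmplitude π q φ := by
  ext p
  by_cases h : p.2 q <;>
    simp [flaggedAmplitude, distAmplitude, h, mul_add, Finset.sum_add_distrib]

theorem l2_flaggedAmplitude_le {π : V → ℝ} (h0 : ∀ x, 0 ≤ π x) (h1 : ∑ x, π x = 1) (q : Q)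
    (ψ : (V × V) × (Q → Bool) → ℂ) : l2 (flaggedAmplitude π q ψ) ≤ l2 ψ := by
  refine le_trans ?_ (l2_distAmplitude_le h0 h1 ψ)
  rw [← sq_le_sq₀ (l2_nonneg _) (l2_nonneg _), ← flaggedProb_eq, ← successProb_eq]
  exact flaggedProb_le_successProb π q ψ

theorem flaggedAmplitude_regState_of_false (π : V → ℝ) {q : Q} (z : V → ℂ) {b : Q → Bool}
    (hb : b q = false) (a : V → ℂ) : flaggedAmplitude π q (regState z b a) = 0 := by
  ext p
  by_cases h : p.2 = b
  · simp [flaggedAmplitude, h, hb]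
  · simp [flaggedAmplitude, distAmplitude, regState, withBits, h]

theorem l2_flaggedAmplitude_regState (π : V → ℝ) {q : Q} {z : V → ℂ} (hz : IsUnitState z)
    {b : Q → Bool} (hb : b q = true) (a : V → ℂ) :
    l2 (flaggedAmplitude π q (regState z b a)) = ‖overlap (sqrtDist π) a‖ := by
  have hz' : ∑ y, ‖z y‖ ^ 2 = 1 := hz
  rw [← sq_eq_sq₀ (l2_nonneg _) (norm_nonneg _), l2_sq, Fintype.sum_prod_type]
  rw [← mul_one (‖overlap (sqrtDist π) a‖ ^ 2), ← hz', Finset.mul_sum]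
  refine Finset.sum_congr rfl fun y _ => ?_
  rw [Finset.sum_eq_single b]
  · have : distAmplitude π (regState z b a) (y, b) = overlap (sqrtDist π) a * z y := by
      simp only [distAmplitude, regState, withBits, tensor, Pi.single_eq_same, mul_one, overlap,
        sqrtDist, Finset.sum_mul]
      exact Finset.sum_congr rfl fun x _ => by ring
    simp only [flaggedAmplitude, hb, if_true, this, norm_mul, mul_pow]
  · intro b' _ hb'
    simp [flaggedAmplitude, distAmplitude, regState, withBits, hb']
  · simp

end Measurement

/-! ### Amplitude amplification from probability one half -/

section Amplification

variable {V : Type*} [Fintype V] [DecidableEq V] {Q : Type*} [Fintype Q] [DecidableEq Q]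

theorem overlap_sub (u : V → ℝ) (a b : V → ℂ) : overlap u (a - b) = overlap u a - overlap u b := by
  simp [overlap, mul_sub, Finset.sum_sub_distrib]

theorem overlap_smul (u : V → ℝ) (c : ℂ) (a : V → ℂ) : overlap u (c • a) = c * overlap u a := by
  simp only [overlap, Pi.smul_apply, smul_eq_mul, Finset.mul_sum]
  exact Finset.sum_congr rfl fun x _ => by ring

theorem overlap_toC (u v : V → ℝ) : overlap u (toC v) = ((u ⬝ᵥ v : ℝ) : ℂ) := by
  simp [overlap, toC, dotProduct]

theorem overlap_single (u : V → ℝ) (g : V) : overlap u (Pi.single g 1) = u g := by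
  simp [overlap, Pi.single_apply]

theorem l2_toC {u : V → ℝ} (hu : u ⬝ᵥ u = 1) : l2 (toC u) = 1 := by
  have h : l2 (toC u) ^ 2 = 1 := by
    rw [l2_sq, ← hu, dotProduct]
    refine Finset.sum_congr rfl fun x _ => ?_
    rw [toC, Complex.norm_real, Real.norm_eq_abs, sq_abs, sq]
  nlinarith [l2_nonneg (toC u)]

theorem l2_single (g : V) : l2 (Pi.single g 1 : V → ℂ) = 1 := by
  have h : l2 (Pi.single g 1 : V → ℂ) ^ 2 = 1 := by
    rw [l2_sq, Finset.sum_eq_single g]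
    · simp
    · intro x _ hx; simp [hx]
    · simp
  nlinarith [l2_nonneg (Pi.single g 1 : V → ℂ)]

/-- One round of amplification with both phases `i`, for approximate operators. In the ideal round
`U` swaps the bit strings `b` and `b'` on the component along `u`, which makes it an involution, and
`T` multiplies the component along `p` by `i`. The ideal `T U |g⟩` is `U |g⟩ + w` with `w` along
`p`, so that `U T U |g⟩ = |g⟩ + U w`. Because `p` has probability one half in `U |g⟩`, the phase on
the start state cancels exactly the term `|g⟩`, and the last `U` returns `w`. -/
theorem amplification_approx {z : V → ℂ} {U T S : Op V Q}
    (hU : U ∈ Matrix.unitaryGroup ((V × V) × (Q → Bool)) ℂ) (hUs : Uᴴ = U)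
    (hT : T ∈ Matrix.unitaryGroup ((V × V) × (Q → Bool)) ℂ)
    (hS : S ∈ Matrix.unitaryGroup ((V × V) × (Q → Bool)) ℂ)
    {u p : V → ℝ} {g : V} {α k σ : ℝ} {e : ℝ} {b b' : Q → Bool}
    (hu : u ⬝ᵥ u = 1) (hp : p ⬝ᵥ p = 1) (hσ : u ⬝ᵥ p = σ) (hk : u g = k) (hα : p g = α)
    (hk2 : k ^ 2 = 1 / 2) (hhalf : α ^ 2 - 2 * (k * σ) * α + σ ^ 2 = 1 / 2)
    (hb1 : |α - k * σ| ≤ 1 / 2) (hb2 : |k * σ| ≤ 3 / 4)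
    (hUb : ∀ a, l2 (U *ᵥ regState z b a - (regState z b a +
      overlap u a • (regState z b' (toC u) - regState z b (toC u)))) ≤ 2 * (e * l2 a))
    (hUb' : ∀ a, l2 (U *ᵥ regState z b' a - (regState z b' a +
      overlap u a • (regState z b (toC u) - regState z b' (toC u)))) ≤ 2 * (e * l2 a))
    (hTb : ∀ a, l2 (T *ᵥ regState z b a - (regState z b a +
      ((Complex.I - 1) * overlap p a) • regState z b (toC p))) ≤ 2 * (e * l2 a))
    (hTb' : ∀ a, l2 (T *ᵥ regState z b' a - (regState z b' a +
      ((Complex.I - 1) * overlap p a) • regState z b' (toC p))) ≤ 2 * (e * l2 a))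
    (hSb : ∀ a, S *ᵥ regState z b a =
      regState z b (a + ((Complex.I - 1) * a g) • Pi.single g 1))
    (hSb' : ∀ a, S *ᵥ regState z b' a = regState z b' a) :
    l2 (U *ᵥ (S *ᵥ (Uᴴ *ᵥ (T *ᵥ (U *ᵥ regState z b (Pi.single g 1))))) -
      (((Complex.I - 1) * (α - k * σ)) • regState z b (toC p) +
        ((Complex.I - 1) * (k * σ)) • regState z b' (toC p))) ≤ 17 * e := by
  set c : ℂ := Complex.I - 1 with hc
  have hcn : ‖c‖ ≤ 3 / 2 := by
    have : ‖c‖ ^ 2 = 2 := by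
      rw [← Complex.normSq_eq_norm_sq, Complex.normSq_apply, hc]
      simp; norm_num
    nlinarith [norm_nonneg c]
  have hkn : |k| ≤ 3 / 4 := by
    rw [← sq_abs] at hk2
    nlinarith [abs_nonneg k]
  have he : 0 ≤ e := by
    have := (l2_nonneg _).trans (hUb (Pi.single g 1))
    rw [l2_single] at this; linarith
  set γ : V → ℂ := Pi.single g 1 with hγ
  have hUU : ∀ ξ, U *ᵥ (U *ᵥ ξ) = ξ := by
    intro ξ
    have := unitary_conjTranspose_mul hU
    rw [hUs] at this
    rw [Matrix.mulVec_mulVec, this, Matrix.one_mulVec]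
  have ou : overlap u (toC p) = σ := by rw [overlap_toC, hσ]
  have ouu : overlap u (toC u) = 1 := by rw [overlap_toC, hu]; simp
  have opp : overlap p (toC p) = 1 := by rw [overlap_toC, hp]; simp
  have opu : overlap p (toC u) = σ := by rw [overlap_toC, dotProduct_comm, hσ]
  have oug : overlap u γ = k := by rw [overlap_single, hk]
  have opg : overlap p γ = α := by rw [overlap_single, hα]
  -- The ideal states: `χ` after `U`, and `w` the final one, with its ideal image `w'` under `U`.
  set χ := regState z b (γ - (k : ℂ) • toC u) + regState z b' ((k : ℂ) • toC u) with hχ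
  set w := (c * (α - k * σ)) • regState z b (toC p) + (c * (k * σ)) • regState z b' (toC p) with hw
  set w' := (c * (α - k * σ)) • (regState z b (toC p) +
      (σ : ℂ) • (regState z b' (toC u) - regState z b (toC u))) +
    (c * (k * σ)) • (regState z b' (toC p) +
      (σ : ℂ) • (regState z b (toC u) - regState z b' (toC u))) with hw'
  have e1 : l2 (U *ᵥ regState z b γ - χ) ≤ 2 * e := by
    have := hUb γ
    rw [l2_single, oug, mul_one] at this
    refine le_trans (le_of_eq ?_) this
    congr 1
    rw [hχ, regState_sub, regState_smul, regState_smul]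
    module
  have e2 : l2 (T *ᵥ χ - (χ + w)) ≤ 5 * e := by
    have h1 := hTb (γ - (k : ℂ) • toC u)
    have h2 := hTb' ((k : ℂ) • toC u)
    rw [overlap_sub, overlap_smul, opu, opg] at h1
    rw [overlap_smul, opu] at h2
    have h3 : l2 (γ - (k : ℂ) • toC u) ≤ 1 + 3 / 4 := by
      refine (l2_sub_le _ _).trans ?_
      rw [l2_single, l2_smul, l2_toC hu, Complex.norm_real, Real.norm_eq_abs]
      linarith
    have h4 : l2 ((k : ℂ) • toC u) ≤ 3 / 4 := by
      rw [l2_smul, l2_toC hu, Complex.norm_real, Real.norm_eq_abs]; linarith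
    have h5 := mul_le_mul_of_nonneg_left h3 he
    have h6 := mul_le_mul_of_nonneg_left h4 he
    have h7 : T *ᵥ χ - (χ + w) =
        (T *ᵥ regState z b (γ - (k : ℂ) • toC u) - (regState z b (γ - (k : ℂ) • toC u) +
          (c * (α - k * σ)) • regState z b (toC p))) +
        (T *ᵥ regState z b' ((k : ℂ) • toC u) - (regState z b' ((k : ℂ) • toC u) +
          (c * (k * σ)) • regState z b' (toC p))) := by
      rw [hχ, hw, Matrix.mulVec_add]; abel
    rw [h7]
    refine (l2_add_le _ _).trans ?_
    linarith
  have e3 : l2 (U *ᵥ w - w') ≤ 15 / 4 * e := by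
    have h1 := hUb (toC p)
    have h2 := hUb' (toC p)
    rw [ou, l2_toC hp, mul_one] at h1 h2
    have h3 : ‖c * (α - k * σ)‖ ≤ 3 / 2 * (1 / 2) := by
      rw [norm_mul]
      refine mul_le_mul hcn ?_ (norm_nonneg _) (by norm_num)
      rw [← Complex.ofReal_mul, ← Complex.ofReal_sub, Complex.norm_real, Real.norm_eq_abs]
      exact hb1
    have h4 : ‖c * (k * σ)‖ ≤ 3 / 2 * (3 / 4) := by
      rw [norm_mul]
      refine mul_le_mul hcn ?_ (norm_nonneg _) (by norm_num)
      rw [← Complex.ofReal_mul, Complex.norm_real, Real.norm_eq_abs]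
      exact hb2
    have h5 : U *ᵥ w - w' =
        (c * (α - k * σ)) • (U *ᵥ regState z b (toC p) - (regState z b (toC p) +
          (σ : ℂ) • (regState z b' (toC u) - regState z b (toC u)))) +
        (c * (k * σ)) • (U *ᵥ regState z b' (toC p) - (regState z b' (toC p) +
          (σ : ℂ) • (regState z b (toC u) - regState z b' (toC u)))) := by
      rw [hw, hw', Matrix.mulVec_add, Matrix.mulVec_smul, Matrix.mulVec_smul]
      module
    rw [h5]
    refine (l2_add_le _ _).trans ?_
    rw [l2_smul, l2_smul]
    have h6 := mul_le_mul h3 h1 (l2_nonneg _) (by norm_num)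
    have h7 := mul_le_mul h4 h2 (l2_nonneg _) (by norm_num)
    linarith
  -- The phase on the start state removes `|g⟩` from `|g⟩ + w'`.
  have e4 : S *ᵥ (regState z b γ + w') = w' := by
    have hcoef : c * (1 + (c * (α - k * σ)) * α + (c * σ * (2 * (k * σ) - α)) * k) = -1 := by
      have h1 : (α : ℂ) ^ 2 - 2 * (k * σ) * α + σ ^ 2 = 1 / 2 := by
        have := congrArg (fun x : ℝ => (x : ℂ)) hhalf
        push_cast at this
        exact this
      have h2 : (k : ℂ) ^ 2 = 1 / 2 := by
        have := congrArg (fun x : ℝ => (x : ℂ)) hk2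
        push_cast at this
        exact this
      have hcc : c * c = -2 * Complex.I := by
        rw [hc]; ring_nf; rw [Complex.I_sq]; ring
      have h3 : c * (1 + c * (1 / 2)) = -1 := by
        rw [hc]; ring_nf; rw [Complex.I_sq]; ring
      rw [← h3]
      linear_combination (c * c) * h1 + (2 * c * c * (σ : ℂ) ^ 2) * h2
    have hsplit : regState z b γ + w' =
        regState z b (γ + (c * (α - k * σ)) • toC p + (c * σ * (2 * (k * σ) - α)) • toC u) +
        regState z b' ((c * (k * σ)) • toC p - (c * σ * (2 * (k * σ) - α)) • toC u) := by
      simp only [hw', regState_add, regState_sub, regState_smul]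
      module
    have hval : (γ + (c * (α - k * σ)) • toC p + (c * σ * (2 * (k * σ) - α)) • toC u) g =
        1 + (c * (α - k * σ)) * α + (c * σ * (2 * (k * σ) - α)) * k := by
      simp [hγ, toC, hk, hα]
    have hw'2 : w' = regState z b γ + w' - regState z b γ := by abel
    conv_rhs => rw [hw'2, hsplit]
    rw [hsplit, Matrix.mulVec_add, hSb, hSb', hval, hcoef, neg_one_smul, ← sub_eq_add_neg,
      regState_sub z b _ (Pi.single g 1)]
    abel
  have e5 : l2 (U *ᵥ χ - regState z b γ) ≤ 2 * e := by
    rw [← l2_unitary hU, Matrix.mulVec_sub, hUU, l2_sub_rev]; exact e1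
  have e6 : l2 (U *ᵥ w' - w) ≤ 15 / 4 * e := by
    rw [← l2_unitary hU, Matrix.mulVec_sub, hUU, l2_sub_rev]; exact e3
  have hfinal : U *ᵥ (S *ᵥ (U *ᵥ (T *ᵥ (U *ᵥ regState z b γ)))) - w =
      U *ᵥ (S *ᵥ (U *ᵥ (T *ᵥ (U *ᵥ regState z b γ - χ)))) +
      (U *ᵥ (S *ᵥ (U *ᵥ (T *ᵥ χ - (χ + w)))) +
      (U *ᵥ (S *ᵥ ((U *ᵥ χ - regState z b γ) + (U *ᵥ w - w'))) + (U *ᵥ w' - w))) := by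
    have h1 : U *ᵥ w' = U *ᵥ (S *ᵥ (regState z b γ + w')) := by rw [e4]
    rw [h1]
    simp only [Matrix.mulVec_sub, Matrix.mulVec_add]
    abel
  rw [hUs, hfinal]
  refine (l2_add_le _ _).trans ?_
  have f1 : l2 (U *ᵥ (S *ᵥ (U *ᵥ (T *ᵥ (U *ᵥ regState z b γ - χ))))) ≤ 2 * e := by
    rw [l2_unitary hU, l2_unitary hS, l2_unitary hU, l2_unitary hT]; exact e1
  have f2 : l2 (U *ᵥ (S *ᵥ (U *ᵥ (T *ᵥ χ - (χ + w))))) ≤ 5 * e := by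
    rw [l2_unitary hU, l2_unitary hS, l2_unitary hU]; exact e2
  have f3 : l2 (U *ᵥ (S *ᵥ ((U *ᵥ χ - regState z b γ) + (U *ᵥ w - w')))) ≤
      2 * e + 15 / 4 * e := by
    rw [l2_unitary hU, l2_unitary hS]
    exact (l2_add_le _ _).trans (add_le_add e5 e3)
  have f4 := (l2_add_le (U *ᵥ (S *ᵥ ((U *ᵥ χ - regState z b γ) + (U *ᵥ w - w'))))
    (U *ᵥ w' - w)).trans (add_le_add f3 e6)
  have f5 := (l2_add_le (U *ᵥ (S *ᵥ (U *ᵥ (T *ᵥ χ - (χ + w))))) _).trans (add_le_add f2 f4)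
  linarith

end Amplification

/-! ### The choice of the parameters -/

section Parameters

theorem log_two_le_log_one_div {ε : ℝ} (h0 : 0 < ε) (h1 : ε < 1 / 2) :
    Real.log 2 ≤ Real.log (1 / ε) :=
  Real.log_le_log two_pos (by rw [le_div_iff₀ h0]; linarith)

theorem le_two_pow_tau {Γ : ℝ} (h : 0 < Γ) : Γ ≤ 2 ^ tau Γ := by
  have h1 := Real.rpow_le_rpow_of_exponent_le one_le_two (Nat.le_ceil (Real.logb 2 Γ))
  rwa [Real.rpow_logb two_pos (by norm_num) h, Real.rpow_natCast] at h1

theorem tau_le {Γ : ℝ} (h : 1 ≤ Γ) : (tau Γ : ℝ) ≤ Real.logb 2 Γ + 1 :=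
  (Nat.ceil_lt_add_one (Real.logb_nonneg one_lt_two h)).le

theorem two_pow_tau_le {Γ : ℝ} (h : 1 ≤ Γ) : (2 : ℝ) ^ tau Γ ≤ 2 * Γ := by
  have h1 := Real.rpow_le_rpow_of_exponent_le one_le_two (tau_le h)
  rwa [Real.rpow_natCast, Real.rpow_add two_pos, Real.rpow_one,
    Real.rpow_logb two_pos (by norm_num) (zero_lt_one.trans_le h), mul_comm] at h1

theorem one_le_tau {Γ : ℝ} (h : 1 < Γ) : 1 ≤ tau Γ :=
  Nat.one_le_ceil_iff.mpr (Real.logb_pos one_lt_two h)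

theorem two_thirds_lt_scale {H ε : ℝ} (hH : 1 ≤ H) (h0 : 0 < ε) (h1 : ε < 1 / 2) :
    2 / 3 < Real.log (1 / ε) * √H := by
  have h2 := log_two_le_log_one_div h0 h1
  have h3 := Real.log_two_gt_d9
  have h4 : 1 ≤ √H := Real.one_le_sqrt.mpr hH
  nlinarith

/-- The steps that are cut off when the walk is fast-forwarded with `2 ^ τ ≥ Γ` calls have
probability at most `ε / 100`. -/
theorem qffTail_ffSteps_le {V : Type*} [Fintype V] [DecidableEq V] {P : Matrix V V ℝ} {H ε Γ : ℝ}
    (hH : 1 ≤ H) (h0 : 0 < ε) (h1 : ε < 1 / 2) (hgap : 1 / gap P ≤ 3 * H)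
    (hΓ : 20 * (Real.log (1 / ε) * √H) ≤ Γ) :
    qffTail (tau Γ) (ffSteps P ε) ≤ ε / 100 := by
  set ℓ := Real.log (1 / ε) with hℓ
  have hX := two_thirds_lt_scale hH h0 h1
  have hΓ0 : 0 < Γ := by linarith
  have hl := log_two_le_log_one_div h0 h1
  have hl2 := Real.log_two_gt_d9
  rw [← hℓ] at hX hl
  set t := ffSteps P ε with ht
  rcases Nat.eq_zero_or_pos t with ht0 | ht0
  -- Without steps nothing is cut off, while `qffTail_le` has the junk exponent `x / 0 = 0`.
  · have : qffTail (tau Γ) t = 0 := by simp [ht0, qffTail]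
    rw [this]; positivity
  have hlog : Real.log (4 / ε) ≤ 3 * ℓ := by
    have : Real.log (4 / ε) = 2 * Real.log 2 + ℓ := by
      rw [hℓ, show 4 / ε = 2 ^ 2 * (1 / ε) by ring, Real.log_mul (by norm_num) (by positivity),
        Real.log_pow]
      norm_num
    linarith
  have hlog0 : 0 ≤ Real.log (4 / ε) :=
    Real.log_nonneg (by rw [le_div_iff₀ h0]; linarith)
  have ht1 : (t : ℝ) ≤ 20 * (H * ℓ) := by
    have h2 : (t : ℝ) < 2 / gap P * Real.log (4 / ε) + 1 := by
      refine Nat.ceil_lt_add_one (le_of_lt ?_)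
      exact Nat.ceil_pos.mp ht0
    have h3 : 2 / gap P * Real.log (4 / ε) ≤ 2 * (3 * H) * (3 * ℓ) := by
      refine mul_le_mul ?_ hlog hlog0 (by linarith)
      rw [show 2 / gap P = 2 * (1 / gap P) by ring]
      linarith
    nlinarith
  have ht' : (0 : ℝ) < t := by exact_mod_cast ht0
  have hpow : 400 * (ℓ * (H * ℓ)) ≤ (2 ^ tau Γ : ℝ) ^ 2 := by
    have h2 : 20 * (ℓ * √H) ≤ 2 ^ tau Γ := hΓ.trans (le_two_pow_tau hΓ0)
    have h3 := pow_le_pow_left₀ (by linarith) h2 2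
    have h4 : √H ^ 2 = H := Real.sq_sqrt (by linarith)
    calc 400 * (ℓ * (H * ℓ)) = (20 * (ℓ * √H)) ^ 2 := by rw [mul_pow, mul_pow, h4]; ring
      _ ≤ _ := h3
  have hexp : 10 * ℓ ≤ (2 ^ tau Γ : ℝ) ^ 2 / (2 * t) := by
    rw [le_div_iff₀ (by positivity)]
    nlinarith
  have hε : Real.exp (-(10 * ℓ)) = ε ^ 10 := by
    rw [hℓ, one_div, Real.log_inv, mul_neg, neg_neg, mul_comm,
      show (10 : ℝ) = ((10 : ℕ) : ℝ) by norm_num, Real.exp_mul, Real.exp_log h0, Real.rpow_natCast]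
  have hε9 : ε ^ 9 ≤ (1 / 2) ^ 9 := pow_le_pow_left₀ h0.le h1.le 9
  calc qffTail (tau Γ) t ≤ 2 * Real.exp (-((2 ^ tau Γ : ℝ) ^ 2 / (2 * t))) := qffTail_le _ _
    _ ≤ 2 * Real.exp (-(10 * ℓ)) := by gcongr
    _ = 2 * (ε ^ 9 * ε) := by rw [hε]; ring
    _ ≤ 2 * ((1 / 2) ^ 9 * ε) := by gcongr
    _ ≤ ε / 100 := by linarith

/-- After `ffSteps` steps the eigenvalues other than `1` have decayed to `(ε / 4) ^ 2`. -/
theorem one_sub_gap_pow_le {V : Type*} [Fintype V] [DecidableEq V] {P : Matrix V V ℝ} {ε : ℝ}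
    (h0 : 0 < ε) (hg0 : 0 < gap P) (hg1 : gap P ≤ 1) :
    (1 - gap P) ^ ffSteps P ε ≤ (ε / 4) ^ 2 := by
  have h1 : (1 - gap P) ^ ffSteps P ε ≤ Real.exp (-gap P) ^ ffSteps P ε :=
    pow_le_pow_left₀ (by linarith) (by linarith [Real.add_one_le_exp (-gap P)]) _
  refine h1.trans ?_
  rw [← Real.exp_nat_mul]
  have h2 : 2 * Real.log (4 / ε) ≤ ffSteps P ε * gap P := by
    have h3 := mul_le_mul_of_nonneg_right (Nat.le_ceil (2 / gap P * Real.log (4 / ε))) hg0.le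
    refine le_trans (le_of_eq ?_) h3
    field_simp
  have h4 : (ε / 4) ^ 2 = Real.exp (-(2 * Real.log (4 / ε))) := by
    rw [← mul_neg, ← Real.log_inv, inv_div, ← Real.log_rpow (by positivity),
      Real.exp_log (by positivity)]
    norm_num
  rw [h4]
  exact Real.exp_le_exp.mpr (by linarith)

/-- Fast-forwarding a gapped chain is an approximate projection on its stationary vector. -/
theorem IsGapped.isApproxProjector {V : Type*} [Fintype V] [DecidableEq V] {Q : Type*} [Fintype Q]
    [DecidableEq Q] {G : SimpleGraph V} {P : Matrix V V ℝ} {u : V → ℝ} {H ε Γ : ℝ}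
    (h : IsGapped G P u (3 * H)) (hH : 1 ≤ H) (h0 : 0 < ε) (h1 : ε < 1 / 2)
    (hΓ : 20 * (Real.log (1 / ε) * √H) ≤ Γ) {z : V → ℂ} (hz : IsUnitState z)
    {A : Matrix (V × V) (V × V) ℂ} (hA : IsStepUnitary z P A)
    {r : Fin (tau Γ) → Q} (hr : Function.Injective r)
    {Vq : Matrix (Fin (tau Γ) → Bool) (Fin (tau Γ) → Bool) ℂ}
    (hV : IsPrepUnitary (tau Γ) (ffSteps P ε) Vq) :
    IsApproxProjector z r (circuitOp (fastForward r (walkOp G z A) Vq)) u (ε / 20) := by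
  have htail := qffTail_ffSteps_le hH h0 h1 h.one_div_gap_le hΓ
  have ht : qffTail (tau Γ) (ffSteps P ε) < 1 := by linarith
  refine ⟨fastForward_mem_unitary hr (walkOp_mem_unitary G hz hA.1) hV.1,
    ffMatrix P (tau Γ) (ffSteps P ε), fun S b a hS hb => ?_, ffMatrix_mulVec_fixed h ht, ?_⟩
  · exact controlProj_mulVec_fastForward G hz h.nonneg h.on_graph hA hr hV ht hS hb a
  · refine l2_ffMatrix_sub_le h ht (by positivity) fun hg0 hg1 => ?_
    have hpow := one_sub_gap_pow_le h0 hg0 hg1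
    rw [div_le_iff₀ (by linarith)]
    nlinarith

end Parameters

/-! ### Overlaps of the ideal states -/

section Overlaps

variable {V : Type*} [Fintype V] [DecidableEq V] {G : SimpleGraph V} {P : Matrix V V ℝ}
  {π : V → ℝ} {g : V}

theorem mixState_apply_sq {π : V → ℝ} {g : V} (hg : π g ≤ 1 / 2) :
    mixState π g g ^ 2 = 1 / 2 := by
  rw [mixState, if_pos rfl, div_pow, Real.sq_sqrt (by linarith), Real.sq_sqrt (by linarith),
    div_eq_div_iff (by linarith) two_ne_zero]
  ring

theorem mixState_dotProduct_sqrtDist (h : IsErgodicReversible G P π) (hg : π g ≤ 1 / 2) :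
    mixState π g ⬝ᵥ sqrtDist π = mixState π g g * (√(π g) + √(1 - π g)) := by
  have hq : √(1 - π g) * √(1 - π g) = 1 - π g := Real.mul_self_sqrt (by linarith)
  have hsum : ∑ x, (if x = g then √(1 - π g) else √(π x)) * √(π x) =
      √(1 - π g) * (√(π g) + √(1 - π g)) := by
    have h1 : ∀ x, (if x = g then √(1 - π g) else √(π x)) * √(π x) =
        π x + if x = g then √(1 - π g) * √(π g) - π g else 0 := by
      intro x
      by_cases hx : x = g
      · subst hx; simp
      · simp [hx, Real.mul_self_sqrt (h.dist_nonneg x)]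
    rw [Finset.sum_congr rfl fun x _ => h1 x, Finset.sum_add_distrib, h.dist_sum]
    simp only [Finset.sum_ite_eq', Finset.mem_univ, if_true]
    linear_combination -hq
  simp only [dotProduct, mixState, sqrtDist, if_true]
  rw [div_mul_eq_mul_div, ← hsum, Finset.sum_div]
  exact Finset.sum_congr rfl fun x _ => by ring

theorem mixState_mul_overlap (h : IsErgodicReversible G P π) (hg : π g ≤ 1 / 2) :
    mixState π g g * (mixState π g ⬝ᵥ sqrtDist π) = (√(π g) + √(1 - π g)) / 2 := by
  rw [mixState_dotProduct_sqrtDist h hg, ← mul_assoc, ← sq, mixState_apply_sq hg]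
  ring

/-- In the ideal output of the preparation algorithm, the stationary state has probability one half:
with `k = u g` and `σ` the overlap of `u` with `|π⟩`, its amplitudes without and with the flag are
`√(π g) - k σ` and `k σ`, and `k ^ 2 = 1 / 2` turns the sum of their squares into this form. -/
theorem overlap_half (h : IsErgodicReversible G P π) (hg : π g ≤ 1 / 2) :
    √(π g) ^ 2 - 2 * (mixState π g g * (mixState π g ⬝ᵥ sqrtDist π)) * √(π g) +
      (mixState π g ⬝ᵥ sqrtDist π) ^ 2 = 1 / 2 := by
  have h1 : √(π g) ^ 2 = π g := Real.sq_sqrt (h.dist_nonneg g)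
  have h2 : √(1 - π g) ^ 2 = 1 - π g := Real.sq_sqrt (by linarith)
  rw [mixState_mul_overlap h hg, mixState_dotProduct_sqrtDist h hg, mul_pow, mixState_apply_sq hg]
  linear_combination 1 / 2 * h1 + 1 / 2 * h2

end Overlaps

/-! ### The two algorithms -/

section Algorithms

variable {V : Type*} [Fintype V] [DecidableEq V] {G : SimpleGraph V} {P : Matrix V V ℝ}
  {π : V → ℝ} {g : V} {z : V → ℂ} {ε Γ : ℝ}

theorem nonempty_realization (h : IsErgodicReversible G P π) (hg : π g ≤ 1 / 2)
    (hz : IsUnitState z) {τ : ℕ} (hτ : 1 ≤ τ) : Nonempty (Realization z P π g ε τ) := by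
  obtain ⟨A, hA⟩ := exists_stepUnitary hz (chosenChain_nonneg h hg) (chosenChain_row_sum h)
  obtain ⟨A', hA'⟩ := exists_stepUnitary hz (walkChain_nonneg h) (walkChain_row_sum h)
  obtain ⟨Vq, hV⟩ := exists_prepUnitary hτ (ffSteps (chosenChain P π g) ε)
  obtain ⟨Vq', hV'⟩ := exists_prepUnitary hτ (ffSteps (walkChain P) ε)
  exact ⟨⟨A, hA, A', hA', Vq, hV, Vq', hV'⟩⟩

theorem abs_sqrt_flaggedProb_sub_le (h : IsErgodicReversible G P π) (hg : π g ≤ 1 / 2)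
    (hz : IsUnitState z) (h0 : 0 < ε) (h1 : ε < 1 / 2)
    (hΓ : 20 * (Real.log (1 / ε) * √(maxHittingTime P π)) ≤ Γ)
    (A : Realization z P π g ε (tau Γ)) :
    |√(flaggedProb π (Sum.inr 1) (circuitOp (prepAlgorithm G A) *ᵥ startState z g)) -
      (√(π g) + √(1 - π g)) / 2| ≤ ε := by
  have hB := (isGapped_chosenChain h hg).isApproxProjector (h.one_le_maxHittingTime hg) h0 h1 hΓ hz
    A.stepS_spec (r := (Sum.inl : Fin (tau Γ) → MainQubits (tau Γ))) Sum.inl_injective A.prepS_spec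
  have happ := mainCircuit_approx hz (r₄ := Sum.inr 0) (r₅ := Sum.inr 1) (by simp) (by simp)
    (by simp) hB (b := fun _ => false) (by simp) rfl (Pi.single g 1)
  set b : MainQubits (tau Γ) → Bool := fun _ => false with hb
  set χ := regState z b (Pi.single g 1) + overlap (mixState π g) (Pi.single g 1) •
    (regState z (flipBit (Sum.inr 1) b) (toC (mixState π g)) -
      regState z b (toC (mixState π g))) with hχ
  have hψ : l2 (circuitOp (prepAlgorithm G A) *ᵥ startState z g - χ) ≤ ε := by
    rw [startState_eq, hχ]
    refine happ.trans ?_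
    rw [l2_single]; linarith
  have hideal : l2 (flaggedAmplitude π (Sum.inr 1) χ) = (√(π g) + √(1 - π g)) / 2 := by
    have hneg : χ = regState z b (Pi.single g 1 - overlap (mixState π g) (Pi.single g 1) •
        toC (mixState π g)) + regState z (flipBit (Sum.inr 1) b)
          (overlap (mixState π g) (Pi.single g 1) • toC (mixState π g)) := by
      rw [hχ, regState_sub, regState_smul, regState_smul]; module
    rw [hneg, flaggedAmplitude_add, flaggedAmplitude_regState_of_false π z rfl, zero_add,
      l2_flaggedAmplitude_regState π hz (by rw [flipBit_same]; rfl), overlap_smul, overlap_single,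
      overlap_toC, dotProduct_comm, ← Complex.ofReal_mul, mixState_mul_overlap h hg,
      Complex.norm_real, Real.norm_of_nonneg (by positivity)]
  rw [flaggedProb_eq, Real.sqrt_sq (l2_nonneg _), ← hideal]
  set ψ := circuitOp (prepAlgorithm G A) *ᵥ startState z g with hψdef
  have hsub : flaggedAmplitude π (Sum.inr 1) ψ - flaggedAmplitude π (Sum.inr 1) χ =
      flaggedAmplitude π (Sum.inr 1) (ψ - χ) := by
    have := flaggedAmplitude_add π (Sum.inr 1) (ψ - χ) χ
    rw [sub_add_cancel] at this
    rw [this, add_sub_cancel_right]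
  refine (abs_l2_sub_le _ _).trans ?_
  rw [hsub]
  exact (l2_flaggedAmplitude_le h.dist_nonneg h.dist_sum _ _).trans hψ

theorem le_successProb_prepAlgorithm (h : IsErgodicReversible G P π) (hg : π g ≤ 1 / 2)
    (hz : IsUnitState z) (h0 : 0 < ε) (h1 : ε < 1 / 2)
    (hΓ : 20 * (Real.log (1 / ε) * √(maxHittingTime P π)) ≤ Γ)
    (A : Realization z P π g ε (tau Γ)) :
    (1 / 2 - ε) ^ 2 ≤ successProb π (circuitOp (prepAlgorithm G A) *ᵥ startState z g) := by
  refine le_trans ?_ (flaggedProb_le_successProb π (Sum.inr 1) _)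
  have h2 := (abs_le.mp (abs_sqrt_flaggedProb_sub_le h hg hz h0 h1 hΓ A)).1
  have h3 : 1 ≤ √(π g) + √(1 - π g) := by
    have ha := Real.sq_sqrt (h.dist_nonneg g)
    have hb : √(1 - π g) ^ 2 = 1 - π g := Real.sq_sqrt (by linarith)
    nlinarith [Real.sqrt_nonneg (π g), Real.sqrt_nonneg (1 - π g)]
  exact (Real.le_sqrt' (by linarith)).mp (by linarith)

theorem one_sub_le_successProb_ampAlgorithm (h : IsErgodicReversible G P π) (hg : π g ≤ 1 / 2)
    (hz : IsUnitState z) (h0 : 0 < ε) (h1 : ε < 1 / 2)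
    (hΓ : 20 * (Real.log (1 / ε) * √(maxHittingTime P π)) ≤ Γ)
    (A : Realization z P π g ε (tau Γ)) :
    1 - ε ^ 2 ≤ successProb π (circuitOp (ampAlgorithm G A [(Real.pi / 2, Real.pi / 2)]) *ᵥ
      startState z g) := by
  have hH := h.one_le_maxHittingTime hg
  have hBS := (isGapped_chosenChain h hg).isApproxProjector hH h0 h1 hΓ hz A.stepS_spec
    (r := (fun i => Sum.inl (Sum.inl i) : Fin (tau Γ) → AmpQubits (tau Γ)))
    (fun i j hij => by simpa using hij) A.prepS_spec
  have hBT := (isGapped_walkChain h hg).isApproxProjector hH h0 h1 hΓ hz A.step_spec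
    (r := (fun i => Sum.inr (Sum.inl i) : Fin (tau Γ) → AmpQubits (tau Γ)))
    (fun i j hij => by simpa using hij) A.prep_spec
  set r₅ : AmpQubits (tau Γ) := Sum.inl (Sum.inr 1) with hr5
  set b : AmpQubits (tau Γ) → Bool := fun _ => false with hb
  have hb' : ∀ q, q ≠ r₅ → flipBit r₅ b q = false := fun q hq => flipBit_of_ne hq b
  have hexp : Complex.exp ((Real.pi / 2 : ℝ) * Complex.I) - 1 = Complex.I - 1 := by
    push_cast
    rw [Complex.exp_pi_div_two_mul_I]
  set U : Op V (AmpQubits (tau Γ)) :=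
    circuitOp (mainCircuit (fun i => Sum.inl (Sum.inl i)) (Sum.inl (Sum.inr 0)) r₅ z
      (walkOp G z A.stepS) A.prepS) with hU
  set T : Op V (AmpQubits (tau Γ)) :=
    circuitOp (reflectionCircuit (fun i => Sum.inr (Sum.inl i)) (Sum.inr (Sum.inr 0)) z
      (walkOp G z A.step) A.prep (Real.pi / 2)) with hT
  set S : Op V (AmpQubits (tau Γ)) :=
    startPhase z g (Finset.univ.image Sum.inl) (Real.pi / 2) with hS
  have hUu : U ∈ Matrix.unitaryGroup ((V × V) × (AmpQubits (tau Γ) → Bool)) ℂ :=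
    mainCircuit_mem_unitary hz (by simp [hr5]) (by simp [hr5]) hBS.unitary
  have hTu : T ∈ Matrix.unitaryGroup ((V × V) × (AmpQubits (tau Γ) → Bool)) ℂ :=
    reflectionCircuit_mem_unitary hz hBT.unitary _
  have hSu : S ∈ Matrix.unitaryGroup ((V × V) × (AmpQubits (tau Γ) → Bool)) ℂ :=
    startPhase_mem_unitary hz g _ _
  have hop : circuitOp (ampAlgorithm G A [(Real.pi / 2, Real.pi / 2)]) *ᵥ startState z g =
      U *ᵥ (S *ᵥ (Uᴴ *ᵥ (T *ᵥ (U *ᵥ regState z b (Pi.single g 1))))) := by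
    rw [startState_eq, ampAlgorithm, amplify, circuitOp_append]
    simp only [List.flatMap_cons, List.flatMap_nil, List.append_nil, circuitOp_append,
      circuitOp_inv, circuitOp, Gate.toOp, Matrix.one_mul, ← Matrix.mulVec_mulVec]
    rfl
  have hα := mixState_mul_overlap h hg
  have ha : √(π g) ^ 2 = π g := Real.sq_sqrt (h.dist_nonneg g)
  have hβ : √(1 - π g) ^ 2 = 1 - π g := Real.sq_sqrt (by linarith)
  have ha0 := Real.sqrt_nonneg (π g)
  have hβ0 := Real.sqrt_nonneg (1 - π g)
  have hfin := amplification_approx (z := z) hUu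
    (circuitOp_mainCircuit_conjTranspose (by simp [hr5]) (by simp [hr5]) _ _ _) hTu hSu
    (mixState_unit h hg) h.sqrtDist_dotProduct_self rfl rfl rfl (mixState_apply_sq hg)
    (overlap_half h hg)
    (by
      rw [hα, sqrtDist, abs_le]
      constructor <;> nlinarith)
    (by
      rw [hα, abs_le]
      constructor <;> nlinarith [sq_nonneg (√(π g) - √(1 - π g))])
    (mainCircuit_approx hz (by simp) (by simp [hr5]) (by simp [hr5]) hBS (b := b) (by simp [hb])
      rfl)
    (fun a => by
      have := mainCircuit_approx hz (r₄ := Sum.inl (Sum.inr 0)) (r₅ := r₅) (by simp)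
        (by simp [hr5]) (by simp [hr5]) hBS (b := flipBit r₅ b) (fun i => hb' _ (by simp [hr5]))
        (hb' _ (by simp [hr5])) a
      rwa [flipBit_flipBit] at this)
    (fun a => by
      have := reflectionCircuit_approx hz (r₄ := Sum.inr (Sum.inr 0)) (by simp) hBT (Real.pi / 2)
        (b := b) (by simp [hb]) rfl a
      rwa [hexp] at this)
    (fun a => by
      have := reflectionCircuit_approx hz (r₄ := Sum.inr (Sum.inr 0)) (by simp) hBT (Real.pi / 2)
        (b := flipBit r₅ b) (fun i => hb' _ (by simp [hr5])) (hb' _ (by simp [hr5])) a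
      rwa [hexp] at this)
    (fun a => by
      rw [hS, startPhase_mulVec_regState hz, if_pos (fun _ _ => rfl), hexp])
    (fun a => by
      rw [hS, startPhase_mulVec_regState hz, if_neg]
      intro hq
      have := hq r₅ (by simp [hr5])
      rw [flipBit_same] at this
      simp [hb] at this)
  rw [hop]
  have hproj := l2_sq_sub_successProb_le h.dist_nonneg h.dist_sum
    (ψ := U *ᵥ (S *ᵥ (Uᴴ *ᵥ (T *ᵥ (U *ᵥ regState z b (Pi.single g 1))))))
    (φ := ((Complex.I - 1) * ((√(π g) : ℝ) - (mixState π g g : ℝ) *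
        (mixState π g ⬝ᵥ sqrtDist π : ℝ))) • regState z b (toC (sqrtDist π)) +
      ((Complex.I - 1) * ((mixState π g g : ℝ) * (mixState π g ⬝ᵥ sqrtDist π : ℝ))) •
        regState z (flipBit r₅ b) (toC (sqrtDist π)))
    (c := fun y b₁ => ((Complex.I - 1) * ((√(π g) : ℝ) - (mixState π g g : ℝ) *
        (mixState π g ⬝ᵥ sqrtDist π : ℝ))) * (z y * (Pi.single b 1 : _ → ℂ) b₁) +
      ((Complex.I - 1) * ((mixState π g g : ℝ) * (mixState π g ⬝ᵥ sqrtDist π : ℝ))) *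
        (z y * (Pi.single (flipBit r₅ b) 1 : _ → ℂ) b₁))
    (fun x y b₁ => by
      simp only [Pi.add_apply, Pi.smul_apply, smul_eq_mul, regState, withBits, tensor, toC,
        sqrtDist]
      ring)
  rw [l2_unitary hUu, l2_unitary hSu, l2_unitary (conjTranspose_mem_unitary hUu), l2_unitary hTu,
    l2_unitary hUu, l2_regState hz, l2_single] at hproj
  have hle := pow_le_pow_left₀ (l2_nonneg _) (hfin.trans (by linarith : 17 * (ε / 20) ≤ ε)) 2
  have := hproj.trans hle
  linarith

end Algorithms

/-! ### The cost of the algorithms -/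

section Cost

theorem logb_cost_eq {H ε : ℝ} (hH : 1 ≤ H) (h0 : 0 < ε) (h1 : ε < 1 / 2) :
    1 + Real.logb 2 √H + Real.logb 2 (Real.logb 2 (1 / ε)) =
      Real.logb 2 (2 / Real.log 2 * (Real.log (1 / ε) * √H)) := by
  have hl : 0 < Real.log (1 / ε) :=
    (Real.log_pos one_lt_two).trans_le (log_two_le_log_one_div h0 h1)
  have h2 := Real.log_pos one_lt_two
  have hs : 0 < √H := Real.sqrt_pos.mpr (by linarith)
  have e : 2 / Real.log 2 * (Real.log (1 / ε) * √H) = 2 * (√H * Real.logb 2 (1 / ε)) := by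
    rw [← Real.log_div_log]; ring
  have hb : 0 < Real.logb 2 (1 / ε) := by
    rw [← Real.log_div_log]; positivity
  rw [e, Real.logb_mul two_ne_zero (by positivity), Real.logb_mul hs.ne' hb.ne',
    Real.logb_self_eq_one one_lt_two]
  ring

theorem one_le_logb_cost {H ε : ℝ} (hH : 1 ≤ H) (h0 : 0 < ε) (h1 : ε < 1 / 2) :
    1 ≤ 1 + Real.logb 2 √H + Real.logb 2 (Real.logb 2 (1 / ε)) := by
  have h2 : 0 ≤ Real.logb 2 √H := Real.logb_nonneg one_lt_two (Real.one_le_sqrt.mpr hH)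
  have h3 : 1 ≤ Real.logb 2 (1 / ε) := by
    rw [← Real.log_div_log, le_div_iff₀ (Real.log_pos one_lt_two), one_mul]
    exact log_two_le_log_one_div h0 h1
  have h4 : 0 ≤ Real.logb 2 (Real.logb 2 (1 / ε)) := Real.logb_nonneg one_lt_two h3
  linarith

theorem le_tau {H ε Γ : ℝ} (hH : 1 ≤ H) (h0 : 0 < ε) (h1 : ε < 1 / 2)
    (hΓ : 20 * (Real.log (1 / ε) * √H) ≤ Γ) :
    1 + Real.logb 2 √H + Real.logb 2 (Real.logb 2 (1 / ε)) ≤ tau Γ := by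
  have hX := two_thirds_lt_scale hH h0 h1
  have hl2 := Real.log_two_gt_d9
  rw [logb_cost_eq hH h0 h1]
  refine (Real.logb_le_logb_of_le one_lt_two (by positivity) ?_).trans (Nat.le_ceil _)
  refine le_trans (mul_le_mul_of_nonneg_right ?_ (by linarith)) hΓ
  rw [div_le_iff₀ (by linarith)]
  linarith

theorem tau_le_logb_cost_add {H ε Γ B : ℝ} (hH : 1 ≤ H) (h0 : 0 < ε) (h1 : ε < 1 / 2)
    (hΓ : 1 ≤ Γ) (hB : Γ ≤ B * (Real.log (1 / ε) * √H)) :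
    (tau Γ : ℝ) ≤
      1 + Real.logb 2 √H + Real.logb 2 (Real.logb 2 (1 / ε)) + |Real.logb 2 B| := by
  have hX := two_thirds_lt_scale hH h0 h1
  have hl2 := Real.log_two_lt_d9
  have hl0 := Real.log_pos one_lt_two
  have hBX : 0 < B * (Real.log (1 / ε) * √H) := by linarith
  have hB0 : 0 < B := (pos_iff_pos_of_mul_pos hBX).mpr (by linarith)
  have h3 : Real.logb 2 (B * (Real.log (1 / ε) * √H)) =
      Real.logb 2 B + Real.logb 2 (Real.log (1 / ε) * √H) :=
    Real.logb_mul hB0.ne' (by linarith)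
  have h4 : Real.logb 2 2 ≤ Real.logb 2 (2 / Real.log 2) :=
    Real.logb_le_logb_of_le one_lt_two two_pos (by rw [le_div_iff₀ hl0]; linarith)
  rw [Real.logb_self_eq_one one_lt_two] at h4
  rw [logb_cost_eq hH h0 h1, Real.logb_mul (by positivity) (by linarith)]
  have h5 := Real.logb_le_logb_of_le one_lt_two (by linarith) hB
  linarith [tau_le hΓ, le_abs_self (Real.logb 2 B)]

variable {V : Type*} [Fintype V] [DecidableEq V] {G : SimpleGraph V} {P : Matrix V V ℝ}
  {π : V → ℝ} {g : V} {z : V → ℂ} {ε : ℝ} {τ : ℕ}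

theorem circuitCalls_prepAlgorithm (A : Realization z P π g ε τ) :
    (circuitCalls (prepAlgorithm G A) : ℝ) = 2 * (2 ^ τ - 1) := by
  rw [prepAlgorithm, circuitCalls_mainCircuit]
  push_cast [Nat.one_le_two_pow]
  ring

theorem circuitCalls_ampAlgorithm (A : Realization z P π g ε τ) (p : ℝ × ℝ) :
    (circuitCalls (ampAlgorithm G A [p]) : ℝ) = 8 * (2 ^ τ - 1) := by
  have h : circuitCalls (ampAlgorithm G A [p]) = 8 * (2 ^ τ - 1) := by
    simp only [ampAlgorithm, amplify, List.flatMap_cons, List.flatMap_nil, List.append_nil,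
      circuitCalls_append, circuitCalls_inv, circuitCalls_mainCircuit,
      circuitCalls_reflectionCircuit]
    simp only [circuitCalls, List.map_cons, List.map_nil, Gate.calls, List.sum_cons, List.sum_nil]
    ring
  rw [h]
  push_cast [Nat.one_le_two_pow]
  ring

theorem ancillaCount_prepAlgorithm (A : Realization z P π g ε τ) :
    (ancillaCount (prepAlgorithm G A) : ℝ) = τ + 2 := by
  simp [ancillaCount, MainQubits]

theorem ancillaCount_ampAlgorithm (A : Realization z P π g ε τ) (l : List (ℝ × ℝ)) :
    (ancillaCount (ampAlgorithm G A l) : ℝ) = 2 * τ + 3 := by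
  simp [ancillaCount, AmpQubits, MainQubits]
  ring

end Cost

end QSampling

open QSampling in
theorem mainTheorem2 :
    ∃ b₀ : ℝ, 0 < b₀ ∧ ∃ phases : List (ℝ × ℝ), ∀ B : ℝ, ∃ c C : ℝ, 0 < c ∧ 0 < C ∧
      ∀ (V : Type*) [Fintype V] [DecidableEq V] (G : SimpleGraph V)
        (P : Matrix V V ℝ) (π : V → ℝ), IsErgodicReversible G P π →
      ∀ g : V, π g ≤ 1 / 2 →
      ∀ z : V → ℂ, IsUnitState z →
      ∀ ε : ℝ, 0 < ε → ε < 1 / 2 →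
      ∀ Γ : ℝ, b₀ * (Real.log (1 / ε) * √(maxHittingTime P π)) ≤ Γ →
        Γ ≤ B * (Real.log (1 / ε) * √(maxHittingTime P π)) →
      Nonempty (Realization z P π g ε (tau Γ)) ∧
      ∀ A : Realization z P π g ε (tau Γ),
        -- the preparation algorithm: success probability, walk calls, ancilla qubits
        (1 / 2 - ε) ^ 2 ≤
            successProb π (circuitOp (prepAlgorithm G A) *ᵥ startState z g) ∧
        |√(flaggedProb π (Sum.inr 1) (circuitOp (prepAlgorithm G A) *ᵥ startState z g)) -
            (√(π g) + √(1 - π g)) / 2| ≤ ε ∧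
        c * (Real.log (1 / ε) * √(maxHittingTime P π)) ≤ circuitCalls (prepAlgorithm G A) ∧
        circuitCalls (prepAlgorithm G A) ≤ C * (Real.log (1 / ε) * √(maxHittingTime P π)) ∧
        c * (1 + Real.logb 2 √(maxHittingTime P π) + Real.logb 2 (Real.logb 2 (1 / ε))) ≤
            ancillaCount (prepAlgorithm G A) ∧
        ancillaCount (prepAlgorithm G A) ≤
            C * (1 + Real.logb 2 √(maxHittingTime P π) + Real.logb 2 (Real.logb 2 (1 / ε))) ∧
        -- with amplitude amplification: success probability, walk calls, ancilla qubits
        1 - ε ^ 2 ≤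
            successProb π (circuitOp (ampAlgorithm G A phases) *ᵥ startState z g) ∧
        c * (Real.log (1 / ε) * √(maxHittingTime P π)) ≤
            circuitCalls (ampAlgorithm G A phases) ∧
        circuitCalls (ampAlgorithm G A phases) ≤
            C * (Real.log (1 / ε) * √(maxHittingTime P π)) ∧
        c * (1 + Real.logb 2 √(maxHittingTime P π) + Real.logb 2 (Real.logb 2 (1 / ε))) ≤
            ancillaCount (ampAlgorithm G A phases) ∧
        ancillaCount (ampAlgorithm G A phases) ≤
            C * (1 + Real.logb 2 √(maxHittingTime P π) + Real.logb 2 (Real.logb 2 (1 / ε))) := by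
  refine ⟨20, by norm_num, [(Real.pi / 2, Real.pi / 2)], fun B =>
    ⟨1, 16 * |B| + 2 * |Real.logb 2 B| + 5, one_pos, by positivity, ?_⟩⟩
  intro V _ _ G P π h g hg z hz ε h0 h1 Γ hΓ hB
  have hH := h.one_le_maxHittingTime hg
  have hX := two_thirds_lt_scale hH h0 h1
  have hΓ1 : 1 < Γ := by linarith
  refine ⟨nonempty_realization h hg hz (one_le_tau hΓ1), fun A => ?_⟩
  have hpow := le_two_pow_tau (zero_lt_one.trans hΓ1)
  have hpow' := two_pow_tau_le hΓ1.le
  have hL := one_le_logb_cost hH h0 h1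
  have hτ := le_tau hH h0 h1 hΓ
  have hτ' := tau_le_logb_cost_add hH h0 h1 hΓ1.le hB
  have hlogB := abs_nonneg (Real.logb 2 B)
  have hBX : B * (Real.log (1 / ε) * √(maxHittingTime P π)) ≤
      |B| * (Real.log (1 / ε) * √(maxHittingTime P π)) :=
    mul_le_mul_of_nonneg_right (le_abs_self B) (by linarith)
  rw [circuitCalls_prepAlgorithm, circuitCalls_ampAlgorithm, ancillaCount_prepAlgorithm,
    ancillaCount_ampAlgorithm]
  set X := Real.log (1 / ε) * √(maxHittingTime P π)
  set L := 1 + Real.logb 2 √(maxHittingTime P π) + Real.logb 2 (Real.logb 2 (1 / ε))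
  have hX0 : 0 ≤ |Real.logb 2 B| * X := mul_nonneg hlogB (by linarith)
  have hL0 : |Real.logb 2 B| * 1 ≤ |Real.logb 2 B| * L := mul_le_mul_of_nonneg_left hL hlogB
  have hL1 : 0 ≤ |B| * L := mul_nonneg (abs_nonneg B) (by linarith)
  exact ⟨le_successProb_prepAlgorithm h hg hz h0 h1 hΓ A,
    abs_sqrt_flaggedProb_sub_le h hg hz h0 h1 hΓ A,
    by linarith, by linarith, by linarith, by linarith,
    one_sub_le_successProb_ampAlgorithm h hg hz h0 h1 hΓ A,
    by linarith, by linarith, by linarith, by linarith⟩
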